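/- For $s\in\mathbb{C}$ let \[ \mathcal{R}(s)=\int_{0\swarrow 1}\frac{x^{-s}e^{\pi i x^2}}{e^{\pi i x}-e^{-\pi i x}}\,dx \] be Riemann's auxiliary function, where $0\swarrow1$ denotes the straight line through the point $\tfrac12$ of the interval $(0,1)$, traversed in the direction $e^{-3\pi i/4}$ (from upper right to lower left), and $x^{-s}$ is the principal branch. Write $s=\sigma+it$ with $\sigma,t$ real. There exist real constants $t_0>0$ and $A>0$ such that $\mathcal{R}(s)\neq 0$ for every $s=\sigma+it$ with \[ t\ge t_0\qquad\text{and}\qquad 1-\sigma\ge A\,t^{2/5}\log t . \] This region improves Siegel's left limit $1-\sigma\ge a\,t^{3/7}$ for the zeros in the upper half plane: for every $a>0$ there is a $t_1$ such that $A\,t^{2/5}\log t<a\,t^{3/7}$ for all $t\ge t_1$, so that every $\sigma+it$ with $t\ge \max(t_0,t_1)$ and $1-\sigma\ge a\,t^{3/7}$ lies in the zero-free region. -/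

import Mathlib

open Complex MeasureTheory

/-- The path `0 ↙ 1`: the straight line through the point `1/2` of the interval `(0, 1)`,
traversed with constant unit velocity `exp (-3πi/4)`, that is, from the upper right
(`u → -∞`) to the lower left (`u → +∞`). It never meets the cut `(-∞, 0]` of the
principal branch. -/
noncomputable def auxPath (u : ℝ) : ℂ :=
  1 / 2 + (u : ℂ) * exp (-(3 * (Real.pi : ℂ) * I / 4))

/-- The integrand `x ^ (-s) * e ^ (π i x ^ 2) / (e ^ (π i x) - e ^ (-π i x))`, where
`x ^ (-s)` is the principal branch. -/
noncomputable def auxIntegrand (s x : ℂ) : ℂ :=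
  x ^ (-s) * exp ((Real.pi : ℂ) * I * x ^ 2) /
    (exp ((Real.pi : ℂ) * I * x) - exp (-((Real.pi : ℂ) * I * x)))

/-- Riemann's auxiliary function
`R(s) = ∫_{0 ↙ 1} x ^ (-s) e ^ (π i x ^ 2) / (e ^ (π i x) - e ^ (-π i x)) dx`,
an absolutely convergent contour integral for every complex `s`. -/
noncomputable def riemannAux (s : ℂ) : ℂ :=
  ∫ u : ℝ, auxIntegrand s (auxPath u) * exp (-(3 * (Real.pi : ℂ) * I / 4))

/-! Write `s = 2πi η²` with `0 < η.im < η.re`, and put `r = ‖η‖`. The numerator `x ^ (-s) e ^ (πi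
x²)` has a critical point exactly at `x = η`. Since `Re s < -1`, the contour may be pushed from
`1/2` to the line through `0`, where the zero of `x ^ (-s)` outweighs the simple pole. On the ray in
the third quadrant `arg x = -3π/4`, so its contribution is exponentially small compared with the
saddle (`norm_lowerPart_le`). On the other ray `1 / (q(x) - q(x)⁻¹)`, with `q(x) = e ^ (πi x)`, is
expanded as a finite geometric sum (`riemannAux_eq_sum`). This gives integrals with an extra factor
`e ^ (πi m x)`, `m = 2k + 1`, and a tail damped by `e ^ (2πi K x)` (`norm_rayTail_le`).

Near `η` the exponent of the `m`-th integral is `2πi (x - η)² + πi m (x - η)`, whose critical point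
is `η - m/4` and whose value there is `-πi m²/8`. Hence the `m`-th integral is a common factor times
`e ^ (-πi m²/8) q ^ m`, now with `q = e ^ (πi η)`, up to a relative error `O(m³ / r)`
(`norm_rayTerm_sub_le_of_small`). The phases change sign under `k ↦ k + 2`, so multiplication by `1
+ q⁴` collapses the sum to `q - q³` and two boundary terms (`one_add_pow_mul_sum_saddlePhase`). The
main term is therefore at least of order `|q| D` with `D = 1 - |q|²`, while the errors add up to
`O(|q| / (r D⁴))`.

The main term wins once `r D⁵` is large, which holds for `η.im ≥ r ^ (-1/5) log r`. As `t` is of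
order `r²` and `-σ = 4π η.re η.im`, this is `1 - σ ≥ A t ^ (2/5) log t`. That argument covers `sin
(2 arg η) ≤ 1/2` (`riemannAux_ne_zero_of_small_im`). For larger `arg η` one has `η.im ≥ r / 4`, and
the single term `m = 1` already dominates (`riemannAux_ne_zero_of_large_im`). -/

/-! ### Shifting lines and rotating rays -/

open Set Filter Topology Real in
theorem integrable_exp_neg_abs : Integrable fun u : ℝ => Real.exp (-|u|) := by
  rw [← integrableOn_univ, ← Iic_union_Ioi (a := (0 : ℝ))]
  refine IntegrableOn.union ?_ ?_
  · refine (integrableOn_exp_Iic 0).congr_fun (fun x hx => ?_) measurableSet_Iic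
    simp only [abs_of_nonpos (show x ≤ 0 from hx), neg_neg]
  · refine (integrableOn_exp_neg_Ioi 0).congr_fun (fun x hx => ?_) measurableSet_Ioi
    simp only [abs_of_pos (show 0 < x from hx)]

-- Cauchy's theorem on rectangles; the decay kills the vertical sides. Differentiability is asked
-- only in the open strip because the integrands used below may fail to be holomorphic at `0`, which
-- lies on the upper edge.
open Set Filter Topology in
theorem integral_horizontal_eq {F : ℂ → ℂ} {a b C : ℝ} (hab : a ≤ b)
    (hc : ContinuousOn F {z | a ≤ z.im ∧ z.im ≤ b})
    (hd : DifferentiableOn ℂ F {z | a < z.im ∧ z.im < b})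
    (hF : ∀ u v : ℝ, a ≤ v → v ≤ b → ‖F (u + v * I)‖ ≤ C * Real.exp (-|u|)) :
    ∫ u : ℝ, F (u + a * I) = ∫ u : ℝ, F (u + b * I) := by
  have hint : ∀ v : ℝ, a ≤ v → v ≤ b → Integrable fun u : ℝ => F (u + v * I) := by
    intro v h1 h2
    refine (integrable_exp_neg_abs.const_mul C).mono' ?_ (Eventually.of_forall fun u => hF u v h1 h2)
    refine Continuous.aestronglyMeasurable ?_
    refine hc.comp_continuous (by fun_prop) fun u => ?_
    simp [h1, h2]
  have hlim : ∀ v : ℝ, a ≤ v → v ≤ b →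
      Tendsto (fun T : ℝ => ∫ u in (-T)..T, F (u + v * I)) atTop (𝓝 (∫ u : ℝ, F (u + v * I))) :=
    fun v h1 h2 => intervalIntegral_tendsto_integral (hint v h1 h2) tendsto_neg_atTop_atBot tendsto_id
  have hexp : Tendsto (fun T : ℝ => C * Real.exp (-T) * |b - a|) atTop (𝓝 0) := by
    have := (Real.tendsto_exp_neg_atTop_nhds_zero.const_mul C).mul_const |b - a|
    simpa using this
  have hside : ∀ σ : ℝ, |σ| = 1 →
      Tendsto (fun T : ℝ => ∫ v in a..b, F (((σ * T : ℝ) : ℂ) + v * I)) atTop (𝓝 0) := by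
    intro σ hσ
    refine squeeze_zero_norm' ?_ hexp
    filter_upwards [eventually_ge_atTop 0] with T hT
    refine intervalIntegral.norm_integral_le_of_norm_le_const fun v hv => ?_
    rw [uIoc_of_le hab] at hv
    refine (hF _ v hv.1.le hv.2).trans_eq ?_
    rw [abs_mul, hσ, one_mul, abs_of_nonneg hT]
  have hrect : ∀ᶠ T : ℝ in atTop, (∫ u in (-T)..T, F (u + a * I)) - (∫ u in (-T)..T, F (u + b * I))
      + I * (∫ v in a..b, F (((1 * T : ℝ) : ℂ) + v * I))
      - I * (∫ v in a..b, F (((-1 * T : ℝ) : ℂ) + v * I)) = 0 := by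
    filter_upwards [eventually_ge_atTop 0] with T hT
    have := integral_boundary_rect_eq_zero_of_continuousOn_of_differentiableOn F
      ((-T : ℝ) + a * I) ((T : ℝ) + b * I) ?_ ?_
    · simpa [smul_eq_mul] using this
    · refine hc.mono fun z hz => ?_
      simpa [mem_reProdIm, uIcc_of_le hab] using hz.2
    · refine hd.mono fun z hz => ?_
      simpa [mem_reProdIm, hab] using hz.2
  have h0 := (((hlim a le_rfl hab).sub (hlim b hab le_rfl)).add
    ((hside 1 (by simp)).const_mul I)).sub ((hside (-1) (by simp)).const_mul I)
  have := tendsto_nhds_unique (h0.congr' (hrect.mono fun T h => h)) tendsto_const_nhds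
  simpa [sub_eq_zero] using this

open Set in
theorem integral_Ioi_eq_integral_exp (f : ℝ → ℂ) :
    ∫ u in Ioi (0 : ℝ), f u = ∫ v : ℝ, Real.exp v * f (Real.exp v) := by
  rw [← Real.range_exp, ← image_univ, integral_image_eq_integral_abs_deriv_smul MeasurableSet.univ
    (fun x _ => (Real.hasDerivAt_exp x).hasDerivWithinAt) Real.exp_injective.injOn]
  simp

-- The substitution `x = exp w` turns the sector into a horizontal strip. Its Jacobian has norm `e ^
-- u`, whence the weight `exp (-u - |u|)`.
open Set in
theorem integral_ray_eq {F : ℂ → ℂ} {a b C : ℝ} (hab : a ≤ b)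
    (hd : ∀ w : ℂ, a ≤ w.im → w.im ≤ b → DifferentiableAt ℂ F (exp w))
    (hF : ∀ u v : ℝ, a ≤ v → v ≤ b →
      ‖F (exp (u + v * I))‖ ≤ C * Real.exp (-u - |u|)) :
    (∫ u in Ioi (0 : ℝ), F (exp (a * I) * u)) * exp (a * I) =
      (∫ u in Ioi (0 : ℝ), F (exp (b * I) * u)) * exp (b * I) := by
  have key : ∀ v : ℝ, (∫ u in Ioi (0 : ℝ), F (exp (v * I) * u)) * exp (v * I) =
      ∫ u : ℝ, (fun w => F (exp w) * exp w) (u + v * I) := by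
    intro v
    rw [integral_Ioi_eq_integral_exp, ← integral_mul_const]
    refine integral_congr_ae (Filter.Eventually.of_forall fun u => ?_)
    simp only [exp_add, ofReal_exp]
    rw [mul_comm (exp (v * I)) (exp u)]
    ring
  rw [key, key]
  have hdiff : ∀ w : ℂ, a ≤ w.im → w.im ≤ b →
      DifferentiableAt ℂ (fun w => F (exp w) * exp w) w := fun w h1 h2 =>
    ((hd w h1 h2).comp w differentiable_exp.differentiableAt).mul differentiable_exp.differentiableAt
  refine integral_horizontal_eq (C := C) hab
    (fun w hw => (hdiff w hw.1 hw.2).continuousAt.continuousWithinAt)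
    (fun w hw => (hdiff w hw.1.le hw.2.le).differentiableWithinAt) fun u v h1 h2 => ?_
  simp only [norm_mul]
  calc _ ≤ C * Real.exp (-u - |u|) * ‖exp (u + v * I)‖ := by gcongr; exact hF u v h1 h2
    _ = _ := by rw [norm_exp, mul_assoc, ← Real.exp_add]; congr 2; simp; ring

/-! ### The kernel and the denominator -/

/-- The primitive eighth root of unity `exp (π i / 4)`. -/
noncomputable def zeta8 : ℂ := exp ((Real.pi / 4 : ℝ) * I)

/-- The numerator `x ^ (-s) * e ^ (π i x ^ 2)` of the integrand of `riemannAux`. -/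
noncomputable def kern (s x : ℂ) : ℂ := x ^ (-s) * exp ((Real.pi : ℂ) * I * x ^ 2)

theorem zeta8_eq : zeta8 = ((√2 / 2 : ℝ) : ℂ) + ((√2 / 2 : ℝ) : ℂ) * I := by
  rw [zeta8, exp_mul_I, ← ofReal_cos, ← ofReal_sin, Real.cos_pi_div_four, Real.sin_pi_div_four]

theorem zeta8_re : zeta8.re = √2 / 2 := by simp [zeta8_eq]

theorem zeta8_im : zeta8.im = √2 / 2 := by simp [zeta8_eq]

theorem norm_zeta8 : ‖zeta8‖ = 1 := norm_exp_ofReal_mul_I _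

theorem zeta8_ne_zero : zeta8 ≠ 0 := exp_ne_zero _

theorem zeta8_sq : zeta8 ^ 2 = I := by
  rw [zeta8, ← exp_nat_mul, show ((2 : ℕ) : ℂ) * (((Real.pi / 4 : ℝ) : ℂ) * I) = Real.pi / 2 * I by
    push_cast; ring, exp_pi_div_two_mul_I]

theorem exp_neg_three_pi_div_four : exp (-(3 * (Real.pi : ℂ) * I / 4)) = -zeta8 := by
  rw [zeta8, show -(3 * (Real.pi : ℂ) * I / 4) = ((Real.pi / 4 : ℝ) : ℂ) * I - Real.pi * I by
    push_cast; ring, exp_sub, exp_pi_mul_I, div_neg, div_one]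

theorem zeta8_mul_re (u v : ℝ) : (zeta8 * (u + v * I)).re = √2 / 2 * (u - v) := by
  simp [zeta8_re, zeta8_im]; ring

theorem zeta8_mul_im (u v : ℝ) : (zeta8 * (u + v * I)).im = √2 / 2 * (u + v) := by
  simp [zeta8_re, zeta8_im]; ring

theorem norm_exp_pi_I_mul (x : ℂ) : ‖exp ((Real.pi : ℂ) * I * x)‖ = Real.exp (-(Real.pi * x.im)) := by
  rw [norm_exp]; simp

theorem norm_exp_neg_pi_I_mul (x : ℂ) :
    ‖exp (-((Real.pi : ℂ) * I * x))‖ = Real.exp (Real.pi * x.im) := by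
  rw [norm_exp]; simp

theorem auxIntegrand_eq (s x : ℂ) : auxIntegrand s x =
    kern s x / (exp ((Real.pi : ℂ) * I * x) - exp (-((Real.pi : ℂ) * I * x))) := rfl

theorem exp_sub_exp_le_norm_den (x : ℂ) :
    Real.exp (Real.pi * |x.im|) - Real.exp (-(Real.pi * |x.im|)) ≤
      ‖exp ((Real.pi : ℂ) * I * x) - exp (-((Real.pi : ℂ) * I * x))‖ := by
  have h1 := norm_sub_norm_le (exp ((Real.pi : ℂ) * I * x)) (exp (-((Real.pi : ℂ) * I * x)))
  have h2 := norm_sub_norm_le (exp (-((Real.pi : ℂ) * I * x))) (exp ((Real.pi : ℂ) * I * x))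
  rw [norm_exp_pi_I_mul, norm_exp_neg_pi_I_mul] at h1 h2
  rw [norm_sub_rev] at h2
  rcases abs_cases x.im with ⟨h, _⟩ | ⟨h, _⟩ <;> rw [h]
  · exact h2
  · simpa using h1

theorem two_pi_mul_abs_im_le_norm_den (x : ℂ) : 2 * Real.pi * |x.im| ≤
    ‖exp ((Real.pi : ℂ) * I * x) - exp (-((Real.pi : ℂ) * I * x))‖ := by
  refine le_trans ?_ (exp_sub_exp_le_norm_den x)
  have h : (0 : ℝ) ≤ Real.pi * |x.im| := by positivity
  have := Real.self_le_sinh_iff.2 h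
  rw [Real.sinh_eq] at this
  linarith

theorem two_mul_abs_sin_le_norm_den (x : ℂ) : 2 * |Real.sin (Real.pi * x.re)| ≤
    ‖exp ((Real.pi : ℂ) * I * x) - exp (-((Real.pi : ℂ) * I * x))‖ := by
  refine le_trans ?_ (abs_im_le_norm _)
  have : (exp ((Real.pi : ℂ) * I * x) - exp (-((Real.pi : ℂ) * I * x))).im =
      (Real.exp (-(Real.pi * x.im)) + Real.exp (Real.pi * x.im)) * Real.sin (Real.pi * x.re) := by
    simp [exp_im]; ring
  rw [this, abs_mul]
  gcongr
  have := Real.one_le_cosh (Real.pi * x.im)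
  rw [Real.cosh_eq] at this
  rw [abs_of_pos (by positivity)]
  linarith

/-- The denominator vanishes only at the integers, and the strip between the lines of slope one
through `0` and `1/2` contains only the integer `0`. For small `|x.im|` Jordan's inequality for `sin
(π x.re)` applies, reflected about `1/2` where necessary; otherwise `2π |x.im|` alone suffices. -/
theorem half_norm_le_norm_den {x : ℂ} (h0 : 0 ≤ x.re - x.im) (h1 : x.re - x.im ≤ 1 / 2) :
    ‖x‖ / 2 ≤ ‖exp ((Real.pi : ℂ) * I * x) - exp (-((Real.pi : ℂ) * I * x))‖ := by
  have hx := norm_le_abs_re_add_abs_im x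
  have hI := two_pi_mul_abs_im_le_norm_den x
  have hpi := Real.pi_gt_three
  have hIm : 6 * |x.im| ≤ 2 * Real.pi * |x.im| := by
    have := abs_nonneg x.im; nlinarith
  have hRe := two_mul_abs_sin_le_norm_den x
  rcases le_or_gt |x.im| (1 / 4) with h | h
  · have hsin : 2 / 3 * |x.re| ≤ |Real.sin (Real.pi * x.re)| := by
      have h2 := abs_le.1 h
      rcases le_or_gt x.re (1 / 2) with h3 | h3
      · have := Real.mul_abs_le_abs_sin (x := Real.pi * x.re) (by
          rw [abs_mul, abs_of_pos Real.pi_pos]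
          have : |x.re| ≤ 1 / 2 := abs_le.2 ⟨by linarith, h3⟩
          nlinarith)
        rw [abs_mul, abs_of_pos Real.pi_pos, ← mul_assoc, div_mul_cancel₀ _ Real.pi_ne_zero] at this
        have := abs_nonneg x.re
        linarith
      · have hsy : Real.sin (Real.pi * x.re) = Real.sin (Real.pi * (1 - x.re)) := by
          rw [mul_sub, mul_one, Real.sin_pi_sub]
        have h4 : 0 ≤ 1 - x.re := by linarith
        have := Real.mul_le_sin (x := Real.pi * (1 - x.re)) (by positivity) (by nlinarith)
        rw [← mul_assoc, div_mul_cancel₀ _ Real.pi_ne_zero, ← hsy] at this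
        refine le_trans ?_ (le_abs_self _)
        rw [abs_of_pos (by linarith)]
        linarith
    have := abs_nonneg x.re
    have := abs_nonneg x.im
    linarith
  · have : |x.re| ≤ |x.im| + 1 / 2 := by
      rw [abs_le]
      rcases abs_cases x.im with ⟨h, _⟩ | ⟨h, _⟩ <;> rw [h] <;> constructor <;> linarith
    linarith

theorem norm_kern {s x : ℂ} (hx : x ≠ 0) : ‖kern s x‖ =
    ‖x‖ ^ (-s.re) * Real.exp (s.im * arg x - 2 * Real.pi * (x.re * x.im)) := by
  rw [kern, norm_mul, norm_cpow_of_ne_zero hx, norm_exp, neg_re, neg_im, div_eq_mul_inv,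
    ← Real.exp_neg, mul_assoc, ← Real.exp_add]
  congr 2
  simp [pow_two]; ring

theorem kern_zero {s : ℂ} (hs : s.re < 0) : kern s 0 = 0 := by
  rw [kern, zero_cpow, zero_mul]
  rintro h
  simp [neg_eq_zero.1 h] at hs

theorem rpow_le_exp_mul_sub_one {x k : ℝ} (hx : 0 ≤ x) (hk : 0 ≤ k) :
    x ^ k ≤ Real.exp (k * (x - 1)) := by
  calc x ^ k ≤ (Real.exp (x - 1)) ^ k :=
        Real.rpow_le_rpow hx (by linarith [Real.add_one_le_exp (x - 1)]) hk
    _ = _ := by rw [← Real.exp_mul, mul_comm]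

/-! ### Moving the contour to the line through the origin -/

theorem norm_kern_zeta8_le {s : ℂ} (ht : 0 ≤ s.im) {b u v : ℝ} (hv : v ≤ 0)
    (hb : -b ≤ v) (hX : (u + v * I : ℂ) ≠ 0) : ‖kern s (zeta8 * (u + v * I))‖ ≤
      ‖(u + v * I : ℂ)‖ ^ (-s.re) * Real.exp (Real.pi * s.im + Real.pi * b ^ 2 - Real.pi * u ^ 2) := by
  rw [norm_kern (mul_ne_zero zeta8_ne_zero hX), norm_mul, norm_zeta8, one_mul, zeta8_mul_re,
    zeta8_mul_im]
  refine mul_le_mul_of_nonneg_left (Real.exp_le_exp.2 ?_) (by positivity)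
  have h1 := mul_le_mul_of_nonneg_left (arg_le_pi (zeta8 * (u + v * I))) ht
  have h2 : (√2 : ℝ) ^ 2 = 2 := Real.sq_sqrt (by norm_num)
  have h3 : √2 / 2 * (u - v) * (√2 / 2 * (u + v)) = (u ^ 2 - v ^ 2) / 2 := by
    linear_combination (u ^ 2 - v ^ 2) / 4 * h2
  rw [h3]
  have h4 : v ^ 2 ≤ b ^ 2 := by nlinarith
  nlinarith [Real.pi_pos]

theorem zeta8_mul_mem_slitPlane {u v : ℝ} (hv : v ≤ 0) (hX : (u + v * I : ℂ) ≠ 0) :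
    zeta8 * (u + v * I) ∈ slitPlane := by
  rw [mem_slitPlane_iff, zeta8_mul_re, zeta8_mul_im]
  have h2 : 0 < √2 / 2 := by positivity
  by_cases h : u + v = 0
  · left
    have hv' : v ≠ 0 := by
      rintro rfl
      simp at h
      simp [h] at hX
    have : v < 0 := lt_of_le_of_ne hv hv'
    exact mul_pos h2 (by linarith)
  · right
    exact mul_ne_zero h2.ne' h

theorem differentiableAt_kern {s x : ℂ} (hx : x ∈ slitPlane) : DifferentiableAt ℂ (kern s) x := by
  unfold kern
  exact (differentiableAt_id.cpow_const hx).mul (by fun_prop)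

theorem differentiableAt_auxIntegrand {s x : ℂ} (hx : x ∈ slitPlane)
    (h : exp ((Real.pi : ℂ) * I * x) - exp (-((Real.pi : ℂ) * I * x)) ≠ 0) :
    DifferentiableAt ℂ (auxIntegrand s) x :=
  (differentiableAt_kern hx).fun_div (by fun_prop) h

theorem mul_abs_sub_pi_mul_sq_le (k u : ℝ) :
    k * |u| - Real.pi * u ^ 2 ≤ (k + 1) ^ 2 / 4 - |u| := by
  have := Real.pi_gt_three
  have h := sq_abs u
  nlinarith [sq_nonneg (|u| - (k + 1) / 2), sq_nonneg |u|]

theorem norm_rpow_le_exp {k b u v : ℝ} (hk : 0 ≤ k) (hv : v ≤ 0) (hb : -b ≤ v) :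
    ‖(u + v * I : ℂ)‖ ^ k ≤ Real.exp (k * (|u| + b)) := by
  refine (rpow_le_exp_mul_sub_one (norm_nonneg _) hk).trans (Real.exp_le_exp.2 ?_)
  have h1 : ‖(u + v * I : ℂ)‖ ≤ |u| + |v| := by
    simpa using norm_le_abs_re_add_abs_im (u + v * I : ℂ)
  rw [abs_of_nonpos hv] at h1
  exact mul_le_mul_of_nonneg_left (by linarith) hk

/-- In the coordinate `x = zeta8 * X` the original path is `Im X = -√2/4` and the target is `Im X =
0`. The pole of the reciprocal denominator at `0` costs one power of `‖X‖`, which is why `Re s < -1`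
is needed later. -/
theorem norm_auxIntegrand_zeta8_le {s : ℂ} (ht : 0 ≤ s.im) {u v : ℝ} (hv : v ≤ 0)
    (hb : -(√2 / 4) ≤ v) (hX : (u + v * I : ℂ) ≠ 0) :
    ‖auxIntegrand s (zeta8 * (u + v * I))‖ ≤ 2 * ‖(u + v * I : ℂ)‖ ^ (-s.re - 1) *
      Real.exp (Real.pi * s.im + Real.pi * (√2 / 4) ^ 2 - Real.pi * u ^ 2) := by
  have h2 : (√2 : ℝ) ^ 2 = 2 := Real.sq_sqrt (by norm_num)
  have h3 : (√2 : ℝ) * v * (√2 * v) = 2 * v ^ 2 := by linear_combination v ^ 2 * h2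
  have hd := half_norm_le_norm_den (x := zeta8 * (u + v * I))
    (by rw [zeta8_mul_re, zeta8_mul_im]; nlinarith [Real.sqrt_nonneg 2])
    (by rw [zeta8_mul_re, zeta8_mul_im]; nlinarith [Real.sqrt_nonneg 2])
  rw [norm_mul, norm_zeta8, one_mul] at hd
  have hXn : 0 < ‖(u + v * I : ℂ)‖ := norm_pos_iff.2 hX
  rw [auxIntegrand_eq, norm_div]
  calc _ ≤ (‖(u + v * I : ℂ)‖ ^ (-s.re) *
        Real.exp (Real.pi * s.im + Real.pi * (√2 / 4) ^ 2 - Real.pi * u ^ 2)) /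
        (‖(u + v * I : ℂ)‖ / 2) := by
        gcongr
        exact norm_kern_zeta8_le ht hv hb hX
    _ = _ := by
        rw [Real.rpow_sub_one hXn.ne']
        field_simp

theorem norm_auxIntegrand_zeta8_le_exp {s : ℂ} (ht : 0 ≤ s.im) (hs : s.re < -1) :
    ∃ C : ℝ, ∀ u v : ℝ, -(√2 / 4) ≤ v → v ≤ 0 →
      ‖auxIntegrand s (zeta8 * (u + v * I))‖ ≤ C * Real.exp (-|u|) := by
  refine ⟨2 * Real.exp ((-s.re - 1) * (√2 / 4) + Real.pi * s.im + Real.pi * (√2 / 4) ^ 2 +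
    ((-s.re - 1) + 1) ^ 2 / 4), fun u v hb hv => ?_⟩
  by_cases hX : (u + v * I : ℂ) = 0
  · rw [hX, mul_zero, auxIntegrand_eq, kern_zero (by linarith), zero_div, norm_zero]
    positivity
  · refine (norm_auxIntegrand_zeta8_le ht hv hb hX).trans ?_
    calc _ ≤ 2 * Real.exp ((-s.re - 1) * (|u| + √2 / 4)) *
          Real.exp (Real.pi * s.im + Real.pi * (√2 / 4) ^ 2 - Real.pi * u ^ 2) := by
          gcongr
          exact norm_rpow_le_exp (by linarith) hv hb
      _ ≤ _ := by
          rw [mul_assoc, mul_assoc, ← Real.exp_add, ← Real.exp_add]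
          gcongr 2 * Real.exp ?_
          linarith [mul_abs_sub_pi_mul_sq_le (-s.re - 1) u]

theorem zeta8_den_ne_zero {u v : ℝ} (hv : v ≤ 0) (hb : -(√2 / 4) ≤ v)
    (hX : (u + v * I : ℂ) ≠ 0) : exp ((Real.pi : ℂ) * I * (zeta8 * (u + v * I))) -
      exp (-((Real.pi : ℂ) * I * (zeta8 * (u + v * I)))) ≠ 0 := by
  have h2 : (√2 : ℝ) ^ 2 = 2 := Real.sq_sqrt (by norm_num)
  have hd := half_norm_le_norm_den (x := zeta8 * (u + v * I))
    (by rw [zeta8_mul_re, zeta8_mul_im]; nlinarith [Real.sqrt_nonneg 2])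
    (by rw [zeta8_mul_re, zeta8_mul_im]; nlinarith [Real.sqrt_nonneg 2])
  have hXn : 0 < ‖zeta8 * (u + v * I : ℂ)‖ := norm_pos_iff.2 (mul_ne_zero zeta8_ne_zero hX)
  rw [← norm_pos_iff]
  linarith

theorem zeta8_mul_conj_half (u : ℝ) :
    zeta8 * ((u + √2 / 4 : ℝ) + (-(√2 / 4) : ℝ) * I) = 1 / 2 + u * zeta8 := by
  have h2 : ((√2 : ℝ) : ℂ) ^ 2 = 2 := by
    rw [← ofReal_pow, Real.sq_sqrt (by norm_num)]; norm_num
  rw [zeta8_eq]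
  push_cast
  linear_combination (1 / 8 - I ^ 2 / 8) * h2 - I_sq / 4

open Set Filter Topology in
theorem continuousOn_auxIntegrand_zeta8 {s : ℂ} (ht : 0 ≤ s.im) (hs : s.re < -1) :
    ContinuousOn (fun X => auxIntegrand s (zeta8 * X)) {z | -(√2 / 4) ≤ z.im ∧ z.im ≤ 0} := by
  intro z hz
  by_cases h0 : z = 0
  · subst h0
    -- Here `0 ^ (-s) = 0` and `0 / 0 = 0`; this value agrees with the limit, because `‖X‖ ^ (-σ -
    -- 1)` tends to `0`.
    have hval : auxIntegrand s (zeta8 * 0) = 0 := by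
      rw [mul_zero, auxIntegrand_eq, kern_zero (by linarith), zero_div]
    rw [ContinuousWithinAt, hval]
    have hk : 0 < -s.re - 1 := by linarith
    refine squeeze_zero_norm' (a := fun z : ℂ => 2 * ‖z‖ ^ (-s.re - 1) *
      Real.exp (Real.pi * s.im + Real.pi * (√2 / 4) ^ 2)) ?_ ?_
    · filter_upwards [self_mem_nhdsWithin] with w hw
      by_cases hw0 : w = 0
      · rw [hw0, hval, norm_zero]; positivity
      · have hX : (w.re + w.im * I : ℂ) ≠ 0 := by rwa [re_add_im]
        have := norm_auxIntegrand_zeta8_le ht hw.2 hw.1 hX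
        rw [re_add_im] at this
        refine this.trans ?_
        gcongr
        have := Real.pi_pos
        nlinarith [sq_nonneg w.re]
    · have hc : ContinuousAt (fun z : ℂ => 2 * ‖z‖ ^ (-s.re - 1) *
          Real.exp (Real.pi * s.im + Real.pi * (√2 / 4) ^ 2)) 0 :=
        (continuousAt_const.mul (continuous_norm.continuousAt.rpow_const (Or.inr hk.le))).mul
          continuousAt_const
      have := hc.tendsto
      simp only [norm_zero, Real.zero_rpow hk.ne', mul_zero, zero_mul] at this
      exact this.mono_left nhdsWithin_le_nhds
  · have hX : (z.re + z.im * I : ℂ) ≠ 0 := by rwa [re_add_im]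
    have h1 := zeta8_mul_mem_slitPlane hz.2 hX
    have h2 := zeta8_den_ne_zero hz.2 hz.1 hX
    rw [re_add_im] at h1 h2
    exact (((differentiableAt_auxIntegrand (s := s) h1 h2).comp z
      (differentiableAt_id.const_mul zeta8)).continuousAt).continuousWithinAt

open Set Filter Topology in
theorem integrable_auxIntegrand_zeta8 {s : ℂ} (ht : 0 ≤ s.im) (hs : s.re < -1) :
    Integrable fun u : ℝ => auxIntegrand s (zeta8 * u) := by
  obtain ⟨C, hC⟩ := norm_auxIntegrand_zeta8_le_exp ht hs
  refine (integrable_exp_neg_abs.const_mul C).mono' ?_ (Eventually.of_forall fun u => ?_)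
  · exact ((continuousOn_auxIntegrand_zeta8 ht hs).comp_continuous continuous_ofReal
      fun u => by simp; positivity).aestronglyMeasurable
  · simpa using hC u 0 (by simp; positivity) le_rfl

/-- The minus sign appears because the path runs in the direction `-zeta8`. -/
theorem riemannAux_eq_neg_integral {s : ℂ} (ht : 0 ≤ s.im) (hs : s.re < -1) :
    riemannAux s = -((∫ u : ℝ, auxIntegrand s (zeta8 * u)) * zeta8) := by
  obtain ⟨C, hC⟩ := norm_auxIntegrand_zeta8_le_exp ht hs
  have hshift := integral_horizontal_eq (F := fun X => auxIntegrand s (zeta8 * X))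
    (a := -(√2 / 4)) (b := 0) (C := C) (by simp; positivity) (continuousOn_auxIntegrand_zeta8 ht hs)
    (fun z hz => by
      have hX : (z.re + z.im * I : ℂ) ≠ 0 := by
        rw [re_add_im]; rintro rfl; simp at hz
      have h1 := zeta8_mul_mem_slitPlane hz.2.le hX
      have h2 := zeta8_den_ne_zero hz.2.le hz.1.le hX
      rw [re_add_im] at h1 h2
      exact ((differentiableAt_auxIntegrand (s := s) h1 h2).comp z
        (differentiableAt_id.const_mul zeta8)).differentiableWithinAt) hC
  simp only [ofReal_zero, zero_mul, add_zero] at hshift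
  rw [← hshift, ← integral_add_right_eq_self _ (√2 / 4)]
  simp only [zeta8_mul_conj_half]
  rw [riemannAux, integral_mul_const, exp_neg_three_pi_div_four, mul_neg,
    ← integral_neg_eq_self]
  simp only [auxPath, exp_neg_three_pi_div_four]
  simp

theorem norm_kern_mul_exp_zeta8_le_exp {s : ℂ} (ht : 0 ≤ s.im) (hs : s.re < 0) {m b : ℝ}
    (hm : 0 ≤ m) : ∃ C : ℝ, ∀ u v : ℝ, -b ≤ v → v ≤ 0 →
      ‖kern s (zeta8 * (u + v * I)) * exp ((Real.pi : ℂ) * I * (m * (zeta8 * (u + v * I))))‖ ≤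
        C * Real.exp (-|u|) := by
  refine ⟨Real.exp (-s.re * b + Real.pi * s.im + Real.pi * b ^ 2 + Real.pi * m * b +
    ((-s.re + Real.pi * m) + 1) ^ 2 / 4), fun u v hb hv => ?_⟩
  by_cases hX : (u + v * I : ℂ) = 0
  · rw [hX, mul_zero, kern_zero hs, zero_mul, norm_zero]
    positivity
  · have hpi := Real.pi_pos
    have hexp : ‖exp ((Real.pi : ℂ) * I * (m * (zeta8 * (u + v * I))))‖ ≤
        Real.exp (Real.pi * m * (|u| + b)) := by
      rw [norm_exp_pi_I_mul, im_ofReal_mul, zeta8_mul_im]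
      apply Real.exp_le_exp.2
      have h2 : (√2 : ℝ) ^ 2 = 2 := Real.sq_sqrt (by norm_num)
      have h3 : √2 / 2 ≤ 1 := by nlinarith [Real.sqrt_nonneg 2]
      have h4 : -(√2 / 2 * (u + v)) ≤ |u| + b := by
        calc -(√2 / 2 * (u + v)) ≤ √2 / 2 * (|u| + b) := by
              nlinarith [neg_abs_le u, Real.sqrt_nonneg 2]
          _ ≤ 1 * (|u| + b) := by gcongr; linarith [abs_nonneg u]
          _ = _ := one_mul _
      have := mul_le_mul_of_nonneg_left h4 (mul_nonneg hpi.le hm)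
      linarith
    rw [norm_mul]
    calc _ ≤ (Real.exp (-s.re * (|u| + b)) *
          Real.exp (Real.pi * s.im + Real.pi * b ^ 2 - Real.pi * u ^ 2)) *
          Real.exp (Real.pi * m * (|u| + b)) := by
          gcongr
          refine (norm_kern_zeta8_le ht hv hb hX).trans ?_
          gcongr
          exact norm_rpow_le_exp (by linarith) hv hb
      _ ≤ _ := by
          rw [← Real.exp_add, ← Real.exp_add, ← Real.exp_add]
          apply Real.exp_le_exp.2
          linarith [mul_abs_sub_pi_mul_sq_le (-s.re + Real.pi * m) u]

theorem continuousOn_kern_mul_exp_zeta8 {s : ℂ} (hs : s.re < 0) (m b : ℝ) :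
    ContinuousOn (fun X => kern s (zeta8 * X) * exp ((Real.pi : ℂ) * I * (m * (zeta8 * X))))
      {z | -b ≤ z.im ∧ z.im ≤ 0} := by
  intro z hz
  refine ContinuousAt.continuousWithinAt (ContinuousAt.mul ?_ (by fun_prop))
  refine ContinuousAt.comp (g := kern s) ?_ (by fun_prop)
  by_cases h0 : z = 0
  · rw [h0, mul_zero]
    exact (continuousAt_cpow_const_of_re_pos (Or.inl le_rfl) (by simpa using hs)).mul (by fun_prop)
  · have hX : (z.re + z.im * I : ℂ) ≠ 0 := by rwa [re_add_im]
    have h1 := zeta8_mul_mem_slitPlane hz.2 hX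
    rw [re_add_im] at h1
    exact (differentiableAt_kern h1).continuousAt

open Set Filter Topology in
theorem integrable_kern_mul_exp_zeta8 {s : ℂ} (ht : 0 ≤ s.im) (hs : s.re < 0) {m b : ℝ}
    (hm : 0 ≤ m) (hb : 0 ≤ b) : Integrable fun u : ℝ =>
      kern s (zeta8 * (u - b * I)) * exp ((Real.pi : ℂ) * I * (m * (zeta8 * (u - b * I)))) := by
  obtain ⟨C, hC⟩ := norm_kern_mul_exp_zeta8_le_exp (b := b) ht hs hm
  refine (integrable_exp_neg_abs.const_mul C).mono' ?_ (Eventually.of_forall fun u => ?_)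
  · exact ((continuousOn_kern_mul_exp_zeta8 hs m b).comp_continuous
      (f := fun u : ℝ => (u : ℂ) - b * I) (by fun_prop)
      fun u => by simpa using hb).aestronglyMeasurable
  · simpa [sub_eq_add_neg] using hC u (-b) le_rfl (by simpa using hb)

theorem integral_kern_mul_exp_zeta8_shift {s : ℂ} (ht : 0 ≤ s.im) (hs : s.re < 0) {m b : ℝ}
    (hm : 0 ≤ m) (hb : 0 ≤ b) :
    ∫ u : ℝ, kern s (zeta8 * (u - b * I)) * exp ((Real.pi : ℂ) * I * (m * (zeta8 * (u - b * I)))) =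
    ∫ u : ℝ, kern s (zeta8 * u) * exp ((Real.pi : ℂ) * I * (m * (zeta8 * u))) := by
  obtain ⟨C, hC⟩ := norm_kern_mul_exp_zeta8_le_exp (b := b) ht hs hm
  have := integral_horizontal_eq
    (F := fun X => kern s (zeta8 * X) * exp ((Real.pi : ℂ) * I * (m * (zeta8 * X))))
    (a := -b) (b := 0) (C := C) (by linarith) (continuousOn_kern_mul_exp_zeta8 hs m b)
    (fun z hz => by
      have hX : (z.re + z.im * I : ℂ) ≠ 0 := by
        rw [re_add_im]; rintro rfl; simp at hz
      have h1 := zeta8_mul_mem_slitPlane hz.2.le hX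
      rw [re_add_im] at h1
      exact (((differentiableAt_kern (s := s) h1).comp z
        (differentiableAt_id.const_mul zeta8)).mul (by fun_prop)).differentiableWithinAt) hC
  simpa [sub_eq_add_neg] using this

/-! ### Geometric expansion of the reciprocal denominator -/

/-- The contribution of the ray through `zeta8`, damped by `e ^ (2 π i K x)`. -/
noncomputable def rayTail (s : ℂ) (K : ℕ) : ℂ :=
  (∫ u in Set.Ioi (0 : ℝ), exp ((Real.pi : ℂ) * I * ((2 * K : ℝ) * (zeta8 * u))) *
    auxIntegrand s (zeta8 * u)) * zeta8

/-- The ray integral of `kern s x * e ^ (π i m x)`. -/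
noncomputable def rayTerm (s : ℂ) (m : ℝ) : ℂ :=
  (∫ u in Set.Ioi (0 : ℝ), kern s (zeta8 * u) * exp ((Real.pi : ℂ) * I * (m * (zeta8 * u)))) * zeta8

/-- The part of the contour in the third quadrant. -/
noncomputable def lowerPart (s : ℂ) : ℂ :=
  (∫ u in Set.Iic (0 : ℝ), auxIntegrand s (zeta8 * u)) * zeta8

theorem inv_sub_inv_eq_sub_sum {q : ℂ} (hq : q ≠ 0) (h : q - q⁻¹ ≠ 0) (K : ℕ) :
    1 / (q - q⁻¹) = q ^ (2 * K) / (q - q⁻¹) - ∑ k ∈ Finset.range K, q ^ (2 * k + 1) := by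
  induction K with
  | zero => simp
  | succ n ih =>
    have hpow : q ^ (2 * (n + 1)) = q ^ (2 * n) + q ^ (2 * n + 1) * (q - q⁻¹) := by
      rw [mul_sub, pow_succ q (2 * n), mul_inv_cancel_right₀ hq]
      ring
    rw [Finset.sum_range_succ, ih, hpow, add_div, mul_div_cancel_right₀ _ h]
    ring

-- The expansion is used only on the ray in the first quadrant, where `|e ^ (πi x)| < 1`. It stays
-- finite, so no interchange of an infinite sum with the integral is needed.
open Set Filter Topology in
theorem riemannAux_eq_sum {s : ℂ} (ht : 0 ≤ s.im) (hs : s.re < -1) (K : ℕ) :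
    riemannAux s = (∑ k ∈ Finset.range K, rayTerm s (2 * k + 1)) - rayTail s K - lowerPart s := by
  have hI := integrable_auxIntegrand_zeta8 ht hs
  have hs0 : s.re < 0 := by linarith
  have hT : ∀ m : ℝ, 0 ≤ m → Integrable fun u : ℝ =>
      kern s (zeta8 * u) * exp ((Real.pi : ℂ) * I * (m * (zeta8 * u))) := fun m hm => by
    simpa using integrable_kern_mul_exp_zeta8 ht hs0 hm le_rfl
  have hE : ∀ (m : ℕ) (x : ℂ), exp ((Real.pi : ℂ) * I * x) ^ m =
      exp ((Real.pi : ℂ) * I * ((m : ℝ) * x)) := fun m x => by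
    rw [← exp_nat_mul]; push_cast; ring_nf
  have hpt : ∀ u ∈ Ioi (0 : ℝ), auxIntegrand s (zeta8 * u) =
      exp ((Real.pi : ℂ) * I * ((2 * K : ℝ) * (zeta8 * u))) * auxIntegrand s (zeta8 * u) -
      ∑ k ∈ Finset.range K, kern s (zeta8 * u) *
        exp ((Real.pi : ℂ) * I * ((2 * k + 1 : ℝ) * (zeta8 * u))) := by
    intro u hu
    have hd := zeta8_den_ne_zero (u := u) (v := 0) le_rfl (by simp; positivity)
      (by simpa using (show (0 : ℝ) < u from hu).ne')
    rw [ofReal_zero, zero_mul, add_zero, exp_neg] at hd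
    have := inv_sub_inv_eq_sub_sum (exp_ne_zero _) hd K
    simp only [hE] at this
    push_cast at this
    rw [auxIntegrand_eq, exp_neg, ← Finset.mul_sum]
    push_cast
    linear_combination kern s (zeta8 * u) * this
  have hsumI : Integrable (fun u : ℝ => ∑ k ∈ Finset.range K, kern s (zeta8 * u) *
        exp ((Real.pi : ℂ) * I * ((2 * k + 1 : ℝ) * (zeta8 * u)))) :=
    integrable_finsetSum _ fun k _ => hT _ (by positivity)
  -- The tail equals the integrand plus a finite sum of integrable terms, so it needs no estimate of
  -- its own.
  have htail : IntegrableOn (fun u : ℝ => exp ((Real.pi : ℂ) * I * ((2 * K : ℝ) * (zeta8 * u))) *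
      auxIntegrand s (zeta8 * u)) (Ioi 0) := by
    refine (hI.integrableOn.add hsumI.integrableOn).congr_fun (fun u hu => ?_) measurableSet_Ioi
    simp only [Pi.add_apply]
    linear_combination hpt u hu
  rw [riemannAux_eq_neg_integral ht hs, ← intervalIntegral.integral_Iic_add_Ioi
    hI.integrableOn hI.integrableOn (b := 0), setIntegral_congr_fun measurableSet_Ioi hpt,
    integral_sub htail hsumI.integrableOn,
    integral_finsetSum _ fun k _ => (hT _ (by positivity)).integrableOn]
  simp only [rayTerm, rayTail, lowerPart]
  rw [add_mul, sub_mul, Finset.sum_mul]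
  ring

/-! ### Rotating the ray onto the saddle direction -/

theorem arg_pos_of_im_pos {z : ℂ} (h : 0 < z.im) : 0 < arg z :=
  lt_of_le_of_ne (arg_nonneg_iff.2 h.le) fun h0 => h.ne (arg_eq_zero_iff.1 h0.symm).2.symm

theorem arg_lt_pi_div_four {z : ℂ} (h0 : 0 < z.im) (h1 : z.im < z.re) : arg z < Real.pi / 4 := by
  have hz : 0 < z.re := h0.trans h1
  have h2 : |arg z| < Real.pi / 2 := abs_arg_lt_pi_div_two_iff.2 (Or.inl hz)
  rw [← Real.arctan_one, arg_of_re_nonneg hz.le, Real.arcsin_eq_arctan]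
  · apply Real.arctan_strictMono
    have hn : 0 < ‖z‖ := norm_pos_iff.2 (by rintro rfl; simp at hz)
    have hsq : √(1 - (z.im / ‖z‖) ^ 2) = z.re / ‖z‖ := by
      rw [Real.sqrt_eq_iff_mul_self_eq_of_pos (by positivity)]
      have := Complex.sq_norm z
      rw [normSq_apply] at this
      field_simp
      linarith
    rw [hsq, div_div_div_cancel_right₀ hn.ne', div_lt_one hz]
    exact h1
  · have hn : 0 < ‖z‖ := norm_pos_iff.2 (by rintro rfl; simp at hz)
    rw [Set.mem_Ioo, lt_div_iff₀ hn, div_lt_one hn]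
    have := Complex.sq_norm z
    rw [normSq_apply] at this
    constructor <;> nlinarith

theorem norm_mul_exp_arg (z : ℂ) : (‖z‖ : ℂ) * exp (arg z * I) = z := norm_mul_exp_arg_mul_I z

/-- The ray is turned from the angle `π/4` to `arg η` and rescaled by `‖η‖`, which puts the saddle
at `u = 1`. -/
theorem integral_ray_rotate {F : ℂ → ℂ} {η : ℂ} {C : ℝ} (h0 : 0 < η.im) (h1 : η.im < η.re)
    (hd : ∀ x : ℂ, 0 < x.re → 0 < x.im → DifferentiableAt ℂ F x)
    (hF : ∀ u v : ℝ, arg η ≤ v → v ≤ Real.pi / 4 →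
      ‖F (exp (u + v * I))‖ ≤ C * Real.exp (-u - |u|)) :
    (∫ u in Set.Ioi (0 : ℝ), F (zeta8 * u)) * zeta8 =
      (∫ u in Set.Ioi (0 : ℝ), F (η * u)) * η := by
  have harg := arg_lt_pi_div_four h0 h1
  have hargp := arg_pos_of_im_pos h0
  have hn : 0 < ‖η‖ := norm_pos_iff.2 (by rintro rfl; simp at h0)
  have hrot := integral_ray_eq (F := F) harg.le (fun w hw1 hw2 => hd _ ?_ ?_) hF
  · rw [zeta8, ← hrot]
    conv_rhs => rw [← norm_mul_exp_arg η]
    have := integral_comp_mul_left_Ioi (fun u : ℝ => F (exp (arg η * I) * u)) 0 hn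
    rw [mul_zero] at this
    simp only [ofReal_mul] at this
    have h2 : ∀ u : ℝ, (‖η‖ : ℂ) * exp (arg η * I) * u = exp (arg η * I) * (‖η‖ * u) := by
      intro u; ring
    simp only [h2, this, real_smul]
    push_cast
    field_simp
    rw [mul_div_cancel_right₀ _ (ofReal_ne_zero.2 hn.ne')]
  · rw [exp_re]
    exact mul_pos (Real.exp_pos _) (Real.cos_pos_of_mem_Ioo ⟨by linarith, by linarith [Real.pi_pos]⟩)
  · rw [exp_im]
    exact mul_pos (Real.exp_pos _) (Real.sin_pos_of_pos_of_lt_pi (by linarith)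
      (by linarith [Real.pi_pos]))

theorem norm_kern_exp {s : ℂ} {u v : ℝ} (h0 : -Real.pi < v) (h1 : v ≤ Real.pi) :
    ‖kern s (exp (u + v * I))‖ =
      Real.exp (-s.re * u + s.im * v - Real.pi * (Real.exp (2 * u) * Real.sin (2 * v))) := by
  rw [kern, cpow_def_of_ne_zero (exp_ne_zero _), log_exp (by simpa using h0) (by simpa using h1),
    ← exp_nat_mul, ← exp_add, norm_exp]
  congr 1
  have : ((2 : ℕ) : ℂ) * (u + v * I) = ((2 * u : ℝ) : ℂ) + ((2 * v : ℝ) : ℂ) * I := by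
    push_cast; ring
  rw [this]
  simp [exp_im]
  ring

/-- Produces the weight demanded by `integral_ray_eq`: the Gaussian factor, here `exp (-c e ^
(2u))`, absorbs any power of `x = e ^ u`. -/
theorem mul_sub_exp_two_mul_le {k c : ℝ} (hk : 0 ≤ k) (hc : 0 < c) (u : ℝ) :
    k * u - c * Real.exp (2 * u) ≤ (k + 2) ^ 2 / (8 * c) - u - |u| := by
  rcases le_or_gt 0 u with hu | hu
  · rw [abs_of_nonneg hu]
    have h1 := Real.quadratic_le_exp_of_nonneg (x := 2 * u) (by positivity)
    have h2 : c * (2 * u ^ 2) ≤ c * Real.exp (2 * u) := by gcongr; nlinarith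
    have h3 : (k + 2) * u - c * (2 * u ^ 2) ≤ (k + 2) ^ 2 / (8 * c) := by
      rw [le_div_iff₀ (by positivity)]
      nlinarith [sq_nonneg (4 * c * u - (k + 2))]
    linarith
  · rw [abs_of_neg hu]
    have : 0 ≤ (k + 2) ^ 2 / (8 * c) := by positivity
    have : 0 ≤ c * Real.exp (2 * u) := by positivity
    nlinarith

theorem sin_two_arg_le {η : ℂ} (h0 : 0 < η.im) {v : ℝ} (hv0 : arg η ≤ v) (hv1 : v ≤ Real.pi / 4) :
    Real.sin (2 * arg η) ≤ Real.sin (2 * v) := by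
  have hargp := arg_pos_of_im_pos h0
  exact Real.sin_le_sin_of_le_of_le_pi_div_two (by linarith [Real.pi_pos]) (by linarith)
    (by linarith)

/-- On the sector `sin (2v)` is smallest at `v = arg η`, so the decay there is uniform. -/
theorem norm_kern_exp_le {s η : ℂ} (h0 : 0 < η.im) (ht : 0 ≤ s.im) {u v : ℝ}
    (hv0 : arg η ≤ v) (hv1 : v ≤ Real.pi / 4) : ‖kern s (exp (u + v * I))‖ ≤
      Real.exp (-s.re * u + s.im * Real.pi - Real.pi * Real.sin (2 * arg η) * Real.exp (2 * u)) := by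
  have hargp := arg_pos_of_im_pos h0
  have hpi := Real.pi_pos
  rw [norm_kern_exp (by linarith) (by linarith)]
  apply Real.exp_le_exp.2
  have h1 : s.im * v ≤ s.im * Real.pi := by gcongr; linarith
  have h2 : Real.pi * Real.sin (2 * arg η) * Real.exp (2 * u) ≤
      Real.pi * (Real.exp (2 * u) * Real.sin (2 * v)) := by
    rw [mul_assoc, mul_comm (Real.sin _)]
    gcongr
    exact sin_two_arg_le h0 hv0 hv1
  linarith

theorem sin_two_arg_pos {η : ℂ} (h0 : 0 < η.im) (h1 : η.im < η.re) : 0 < Real.sin (2 * arg η) := by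
  have hargp := arg_pos_of_im_pos h0
  have := arg_lt_pi_div_four h0 h1
  exact Real.sin_pos_of_pos_of_lt_pi (by linarith) (by linarith [Real.pi_pos])

theorem rayTerm_eq_rotate {s η : ℂ} (h0 : 0 < η.im) (h1 : η.im < η.re) (ht : 0 ≤ s.im)
    (hs : s.re ≤ 0) {m : ℝ} (hm : 0 ≤ m) : rayTerm s m =
      (∫ u in Set.Ioi (0 : ℝ), kern s (η * u) * exp ((Real.pi : ℂ) * I * (m * (η * u)))) * η := by
  have hS := sin_two_arg_pos h0 h1
  have hpi := Real.pi_pos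
  have hargp := arg_pos_of_im_pos h0
  refine integral_ray_rotate (F := fun x => kern s x * exp ((Real.pi : ℂ) * I * (m * x)))
    (C := Real.exp (s.im * Real.pi + (-s.re + 2) ^ 2 / (8 * (Real.pi * Real.sin (2 * arg η)))))
    h0 h1 (fun x hx _ => (differentiableAt_kern (Or.inl hx)).mul (by fun_prop)) fun u v hv0 hv1 => ?_
  rw [norm_mul, norm_exp_pi_I_mul, im_ofReal_mul, ← Real.exp_add]
  have him : 0 ≤ (exp (u + v * I)).im := by
    rw [exp_im]
    exact mul_nonneg (Real.exp_pos _).le (Real.sin_nonneg_of_nonneg_of_le_pi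
      (by simp; linarith) (by simp; linarith))
  calc _ ≤ Real.exp (-s.re * u + s.im * Real.pi -
        Real.pi * Real.sin (2 * arg η) * Real.exp (2 * u)) * 1 := by
        gcongr
        · exact norm_kern_exp_le h0 ht hv0 hv1
        · rw [Real.exp_le_one_iff]
          have := mul_nonneg hpi.le (mul_nonneg hm him)
          linarith
    _ ≤ _ := by
        rw [mul_one]
        apply Real.exp_le_exp.2
        have := mul_sub_exp_two_mul_le (k := -s.re) (by linarith) (mul_pos hpi hS) u
        linarith

theorem rayTail_eq_rotate {s η : ℂ} (h0 : 0 < η.im) (h1 : η.im < η.re) (ht : 0 ≤ s.im)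
    (hs : s.re ≤ -1) (K : ℕ) : rayTail s K =
      (∫ u in Set.Ioi (0 : ℝ), exp ((Real.pi : ℂ) * I * ((2 * K : ℝ) * (η * u))) *
        auxIntegrand s (η * u)) * η := by
  have hS := sin_two_arg_pos h0 h1
  have hpi := Real.pi_pos
  have hargp := arg_pos_of_im_pos h0
  have harg := arg_lt_pi_div_four h0 h1
  have hsin : 0 < Real.sin (arg η) := Real.sin_pos_of_pos_of_lt_pi (by linarith) (by linarith)
  refine integral_ray_rotate (F := fun x => exp ((Real.pi : ℂ) * I * ((2 * K : ℝ) * x)) *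
      auxIntegrand s x)
    (C := Real.exp (s.im * Real.pi + ((-s.re - 1) + 2) ^ 2 /
      (8 * (Real.pi * Real.sin (2 * arg η)))) / (2 * Real.pi * Real.sin (arg η)))
    h0 h1 (fun x hx hx' => DifferentiableAt.mul (by fun_prop)
      (differentiableAt_auxIntegrand (Or.inl hx) ?_)) fun u v hv0 hv1 => ?_
  · have := two_pi_mul_abs_im_le_norm_den x
    rw [← norm_pos_iff]
    have : 0 < 2 * Real.pi * |x.im| := by positivity
    linarith
  have him : Real.exp u * Real.sin (arg η) ≤ (exp (u + v * I)).im := by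
    rw [exp_im]
    simp only [add_re, ofReal_re, mul_re, I_re, mul_zero, ofReal_im, I_im, sub_self,
      add_zero, add_im, mul_im, mul_one, zero_add]
    gcongr
    exact Real.sin_le_sin_of_le_of_le_pi_div_two (by linarith) (by linarith) hv0
  have him0 : 0 < Real.exp u * Real.sin (arg η) := by positivity
  have hden := two_pi_mul_abs_im_le_norm_den (exp (u + v * I))
  rw [abs_of_pos (him0.trans_le him)] at hden
  have hden' : 2 * Real.pi * (Real.exp u * Real.sin (arg η)) ≤ _ :=
    (mul_le_mul_of_nonneg_left him (by positivity)).trans hden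
  rw [norm_mul, norm_exp_pi_I_mul, im_ofReal_mul, auxIntegrand_eq, norm_div]
  calc _ ≤ 1 * (Real.exp (-s.re * u + s.im * Real.pi -
        Real.pi * Real.sin (2 * arg η) * Real.exp (2 * u)) /
        (2 * Real.pi * (Real.exp u * Real.sin (arg η)))) := by
        gcongr
        · rw [Real.exp_le_one_iff]
          have : 0 ≤ (2 * K : ℝ) * (exp (u + v * I)).im :=
            mul_nonneg (by positivity) (him0.trans_le him).le
          have := mul_nonneg hpi.le this
          linarith
        · exact norm_kern_exp_le h0 ht hv0 hv1
    _ = Real.exp (-s.re * u + s.im * Real.pi -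
        Real.pi * Real.sin (2 * arg η) * Real.exp (2 * u) - u) /
        (2 * Real.pi * Real.sin (arg η)) := by
        rw [Real.exp_sub _ u]
        field_simp
    _ ≤ _ := by
        rw [div_mul_eq_mul_div, ← Real.exp_add]
        gcongr
        have := mul_sub_exp_two_mul_le (k := -s.re - 1) (by linarith) (mul_pos hpi hS) u
        linarith

/-! ### Bounds for the tail and for the ray in the third quadrant -/

theorem two_pi_I_mul_sq_re (η : ℂ) :
    (2 * (Real.pi : ℂ) * I * η ^ 2).re = -(4 * Real.pi * (η.re * η.im)) := by
  simp [pow_two]; ring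

theorem two_pi_I_mul_sq_im (η : ℂ) :
    (2 * (Real.pi : ℂ) * I * η ^ 2).im = 2 * Real.pi * (η.re ^ 2 - η.im ^ 2) := by
  simp [pow_two]

theorem norm_sq_eq_re_sq_add_im_sq (z : ℂ) : ‖z‖ ^ 2 = z.re ^ 2 + z.im ^ 2 := by
  rw [Complex.sq_norm, normSq_apply]; ring

theorem norm_kern_mul_ofReal (s : ℂ) {η : ℂ} (hη : η ≠ 0) {u : ℝ} (hu : 0 < u) :
    ‖kern s (η * u)‖ = ‖kern s η‖ * (u ^ (-s.re) *
      Real.exp (-(2 * Real.pi * (η.re * η.im) * (u ^ 2 - 1)))) := by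
  have hu' : (u : ℂ) ≠ 0 := ofReal_ne_zero.2 hu.ne'
  rw [norm_kern (mul_ne_zero hη hu'), norm_kern hη, norm_mul, norm_real, Real.norm_of_nonneg hu.le,
    Real.mul_rpow (norm_nonneg _) hu.le, arg_mul_real hu, re_mul_ofReal, im_mul_ofReal]
  have : s.im * arg η - 2 * Real.pi * (η.re * u * (η.im * u)) =
      (s.im * arg η - 2 * Real.pi * (η.re * η.im)) +
      -(2 * Real.pi * (η.re * η.im) * (u ^ 2 - 1)) := by ring
  rw [this, Real.exp_add]
  ring

theorem kern_ne_zero {s x : ℂ} (hx : x ≠ 0) : kern s x ≠ 0 :=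
  mul_ne_zero (by simp [cpow_eq_zero_iff, hx]) (exp_ne_zero _)

theorem integral_exp_neg_mul_sub_sq (b c : ℝ) :
    ∫ x : ℝ, Real.exp (-b * (x - c) ^ 2) = √(Real.pi / b) := by
  rw [integral_sub_right_eq_self (fun x : ℝ => Real.exp (-b * x ^ 2)) c, integral_gaussian]

theorem integrable_exp_neg_mul_sub_sq {b : ℝ} (hb : 0 < b) (c : ℝ) :
    Integrable fun x : ℝ => Real.exp (-b * (x - c) ^ 2) :=
  (integrable_exp_neg_mul_sq hb).comp_sub_right c

/-- On the ray through `η`, `log u ≤ u - 1` bounds the kernel by its value at `η` times a Gaussian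
centred at `u = 1`. The damping there is `e ^ (-2πK η.im)`; a quarter of its exponent is given up
below. -/
theorem norm_rayTail_le {s η : ℂ} (h0 : 0 < η.im) (h1 : η.im < η.re)
    (hs : s = 2 * (Real.pi : ℂ) * I * η ^ 2) (h2 : 1 ≤ η.re * η.im) {K : ℕ}
    (hK : (K : ℝ) ≤ η.re / 2) : ‖rayTail s K‖ ≤
      ‖kern s η‖ * (‖η‖ / η.im) * Real.exp (-(3 / 2 * Real.pi * K * η.im)) := by
  have hpi := Real.pi_gt_three
  have hre : 0 < η.re := h0.trans h1
  have hη : η ≠ 0 := by rintro rfl; simp at h0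
  have hsre : s.re = -(4 * Real.pi * (η.re * η.im)) := by rw [hs, two_pi_I_mul_sq_re]
  have hsim : s.im = 2 * Real.pi * (η.re ^ 2 - η.im ^ 2) := by rw [hs, two_pi_I_mul_sq_im]
  have hsim0 : 0 ≤ s.im := by rw [hsim]; have : 0 ≤ η.re ^ 2 - η.im ^ 2 := by nlinarith
                              positivity
  have hsre1 : s.re ≤ -1 := by rw [hsre]; nlinarith
  set A := ‖kern s η‖ * (Real.exp 1 / (2 * Real.pi * η.im)) *
    Real.exp (-(3 / 2 * Real.pi * K * η.im)) with hA
  set b := Real.pi * (η.re * η.im) with hb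
  have hbpos : 0 < b := by positivity
  have hint := (integrable_exp_neg_mul_sub_sq hbpos 1).const_mul A
  have hpt : ∀ u ∈ Set.Ioi (0 : ℝ), ‖exp ((Real.pi : ℂ) * I * ((2 * K : ℝ) * (η * u))) *
      auxIntegrand s (η * u)‖ ≤ A * Real.exp (-b * (u - 1) ^ 2) := by
    intro u hu
    have hu : 0 < u := hu
    have hden := two_pi_mul_abs_im_le_norm_den (η * u)
    rw [im_mul_ofReal, abs_of_pos (by positivity)] at hden
    have hrp : u ^ (-s.re) = u ^ (-s.re - 1) * u := by
      rw [← Real.rpow_add_one hu.ne']; ring_nf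
    have hrp2 := rpow_le_exp_mul_sub_one (x := u) (k := -s.re - 1) hu.le (by linarith)
    rw [norm_mul, norm_exp_pi_I_mul, im_ofReal_mul, im_mul_ofReal, auxIntegrand_eq, norm_div,
      norm_kern_mul_ofReal s hη hu]
    calc _ ≤ Real.exp (-(Real.pi * (2 * K * (η.im * u)))) * (‖kern s η‖ *
          (Real.exp ((-s.re - 1) * (u - 1)) * u *
          Real.exp (-(2 * Real.pi * (η.re * η.im) * (u ^ 2 - 1)))) /
          (2 * Real.pi * (η.im * u))) := by
          rw [hrp]
          gcongr
      _ = ‖kern s η‖ / (2 * Real.pi * η.im) *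
          Real.exp (-(Real.pi * (2 * K * (η.im * u))) + (-s.re - 1) * (u - 1) +
          -(2 * Real.pi * (η.re * η.im) * (u ^ 2 - 1))) := by
          rw [Real.exp_add, Real.exp_add]
          field_simp
      _ ≤ ‖kern s η‖ / (2 * Real.pi * η.im) *
          Real.exp (1 + -(3 / 2 * Real.pi * K * η.im) + -b * (u - 1) ^ 2) := by
          refine mul_le_mul_of_nonneg_left (Real.exp_le_exp.2 ?_) (by positivity)
          rw [hsre, hb]
          -- Completing the square: half of the Gaussian exponent absorbs the cross term `2πK η.im
          -- (u - 1)` at a cost of `π K η.im (K / η.re) ≤ π K η.im / 2`. This leaves `3/2` out of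
          -- `2`.
          have h3 : 0 ≤ Real.pi * η.im * (η.re * (u - 1) + K) ^ 2 / η.re := by positivity
          have h4 : Real.pi * η.im * (η.re * (u - 1) + K) ^ 2 / η.re =
            Real.pi * (η.re * η.im) * (u - 1) ^ 2 + 2 * Real.pi * K * η.im * (u - 1) +
            Real.pi * η.im * K * (K / η.re) := by field_simp; ring
          have h5 : (K : ℝ) / η.re ≤ 1 / 2 := by rw [div_le_iff₀ hre]; linarith
          have h6 : Real.pi * η.im * K * (K / η.re) ≤ Real.pi * η.im * K * (1 / 2) := by gcongr
          linarith
      _ = _ := by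
          rw [Real.exp_add, Real.exp_add, hA]
          ring
  rw [rayTail_eq_rotate h0 h1 hsim0 hsre1, norm_mul]
  have hle : ‖∫ u in Set.Ioi (0 : ℝ), exp ((Real.pi : ℂ) * I * ((2 * K : ℝ) * (η * u))) *
      auxIntegrand s (η * u)‖ ≤ A := by
    calc _ ≤ ∫ u in Set.Ioi (0 : ℝ), A * Real.exp (-b * (u - 1) ^ 2) :=
          norm_integral_le_of_norm_le hint.integrableOn
            ((ae_restrict_iff' measurableSet_Ioi).2 (Filter.Eventually.of_forall hpt))
      _ ≤ ∫ u : ℝ, A * Real.exp (-b * (u - 1) ^ 2) :=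
          setIntegral_le_integral hint (Filter.Eventually.of_forall fun u => by
            simp only [Pi.zero_apply]; positivity)
      _ = A * √(Real.pi / b) := by rw [integral_const_mul, integral_exp_neg_mul_sub_sq]
      _ ≤ A * 1 := by
          gcongr
          refine Real.sqrt_le_iff.2 ⟨zero_le_one, ?_⟩
          rw [one_pow, div_le_one hbpos, hb]
          nlinarith
      _ = A := mul_one A
  calc _ ≤ A * ‖η‖ := by gcongr
    _ = (‖kern s η‖ * (‖η‖ / η.im) * Real.exp (-(3 / 2 * Real.pi * K * η.im))) *
        (Real.exp 1 / (2 * Real.pi)) := by rw [hA]; field_simp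
    _ ≤ (‖kern s η‖ * (‖η‖ / η.im) * Real.exp (-(3 / 2 * Real.pi * K * η.im))) * 1 := by
        gcongr
        rw [div_le_one (by positivity)]
        linarith [Real.exp_one_lt_d9]
    _ = _ := mul_one _

theorem norm_kern_neg_zeta8 (s : ℂ) {u : ℝ} (hu : 0 < u) : ‖kern s (zeta8 * (-u : ℝ))‖ =
    u ^ (-s.re) * Real.exp (-(3 / 4 * Real.pi * s.im) - Real.pi * u ^ 2) := by
  have hpi := Real.pi_pos
  have h : zeta8 * (-u : ℝ) = exp ((Real.log u : ℝ) + (-(3 * Real.pi / 4) : ℝ) * I) := by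
    rw [exp_add, ← ofReal_exp, Real.exp_log hu]
    have := exp_neg_three_pi_div_four
    rw [show ((-(3 * Real.pi / 4) : ℝ) : ℂ) * I = -(3 * (Real.pi : ℂ) * I / 4) by push_cast; ring,
      this]
    push_cast; ring
  have hsin : Real.sin (2 * (-(3 * Real.pi / 4))) = 1 := by
    rw [show 2 * (-(3 * Real.pi / 4)) = Real.pi / 2 - 2 * Real.pi by ring, Real.sin_sub_two_pi,
      Real.sin_pi_div_two]
  rw [h, norm_kern_exp (by linarith) (by linarith), hsin, mul_one, two_mul, Real.exp_add,
    Real.exp_log hu, Real.rpow_def_of_pos hu, ← Real.exp_add]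
  ring_nf

/-- Keeps both features of `1 / (2 sinh v)`: the decay `e ^ (-v)` for large `v` and the simple pole
at `0`. -/
theorem inv_exp_sub_exp_le {v : ℝ} (hv : 0 < v) :
    1 / (Real.exp v - Real.exp (-v)) ≤ Real.exp (-v) * (1 + 1 / (2 * v)) := by
  have h1 : Real.exp (-v) < Real.exp v := Real.exp_lt_exp.2 (by linarith)
  rw [div_le_iff₀ (by linarith)]
  have h2 := Real.add_one_le_exp (2 * v)
  have h3 : Real.exp (-v) * Real.exp v = 1 := by rw [← Real.exp_add]; simp
  have h4 : Real.exp (2 * v) * (Real.exp (-v) * Real.exp (-v)) = 1 := by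
    rw [← Real.exp_add, ← Real.exp_add, ← Real.exp_zero]; congr 1; ring
  have h5 : 0 < Real.exp (-v) * Real.exp (-v) := by positivity
  have h6 : (2 * v + 1) * (Real.exp (-v) * Real.exp (-v)) ≤ 1 := by
    have := mul_le_mul_of_nonneg_right h2 h5.le
    rwa [h4] at this
  have h7 : Real.exp (-v) * (1 + 1 / (2 * v)) * (Real.exp v - Real.exp (-v)) =
      (1 + 1 / (2 * v)) * (1 - Real.exp (-v) * Real.exp (-v)) := by
    linear_combination (1 + 1 / (2 * v)) * h3
  rw [h7]
  have h8 : (1 + 1 / (2 * v)) = (2 * v + 1) / (2 * v) := by field_simp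
  rw [h8, div_mul_eq_mul_div, one_le_div₀ (by positivity)]
  linarith

theorem rpow_le_rpow_mul_exp {u r k : ℝ} (hu : 0 < u) (hr : 0 < r) (hk : 0 ≤ k) :
    u ^ k ≤ r ^ k * Real.exp (k * (u / r - 1)) := by
  have : u ^ k = r ^ k * (u / r) ^ k := by
    rw [← Real.mul_rpow hr.le (by positivity), mul_div_cancel₀ _ hr.ne']
  rw [this]
  gcongr
  exact rpow_le_exp_mul_sub_one (by positivity) hk

/-- Discards the factor `e ^ (t arg η) ≥ 1`. It serves to compare the ray in the third quadrant with
the saddle value. -/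
theorem rpow_mul_exp_le_norm_kern {s η : ℂ} (h0 : 0 < η.im) (ht : 0 ≤ s.im) :
    ‖η‖ ^ (-s.re) * Real.exp (-(2 * Real.pi * (η.re * η.im))) ≤ ‖kern s η‖ := by
  have hη : η ≠ 0 := by rintro rfl; simp at h0
  rw [norm_kern hη]
  gcongr
  have := mul_nonneg ht (arg_pos_of_im_pos h0).le
  linarith

/-- If `sin (2 arg η) ≤ 1/2`, then `cos (2 arg η) ≥ √3/2 > 3/4`. -/
theorem three_fourths_norm_sq_le {η : ℂ} (h0 : 0 < η.im) (h1 : η.im < η.re)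
    (hS : 4 * (η.re * η.im) ≤ ‖η‖ ^ 2) : 3 / 4 * ‖η‖ ^ 2 ≤ η.re ^ 2 - η.im ^ 2 := by
  have h := norm_sq_eq_re_sq_add_im_sq η
  have h2 : 0 < η.re := h0.trans h1
  refine le_of_sq_le_sq ?_ (by nlinarith)
  rw [h] at hS ⊢
  have h3 : 0 < η.re * η.im := by positivity
  nlinarith [mul_self_le_mul_self (by positivity) hS]

theorem norm_integral_Ioi_gaussian_le {f : ℝ → ℂ} {A b c : ℝ} (hb : 0 < b) (hA : 0 ≤ A)
    (hf : ∀ u, 0 < u → ‖f u‖ ≤ A * Real.exp (-b * (u - c) ^ 2)) :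
    ‖∫ u in Set.Ioi (0 : ℝ), f u‖ ≤ A * √(Real.pi / b) := by
  have hint := (integrable_exp_neg_mul_sub_sq hb c).const_mul A
  calc _ ≤ ∫ u in Set.Ioi (0 : ℝ), A * Real.exp (-b * (u - c) ^ 2) :=
        norm_integral_le_of_norm_le hint.integrableOn
          ((ae_restrict_iff' measurableSet_Ioi).2 (Filter.Eventually.of_forall hf))
    _ ≤ ∫ u : ℝ, A * Real.exp (-b * (u - c) ^ 2) :=
        setIntegral_le_integral hint (Filter.Eventually.of_forall fun u => by
          simp only [Pi.zero_apply]; positivity)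
    _ = A * √(Real.pi / b) := by rw [integral_const_mul, integral_exp_neg_mul_sub_sq]

theorem integral_Iic_eq_integral_Ioi_neg (f : ℝ → ℂ) :
    ∫ u in Set.Iic (0 : ℝ), f u = ∫ u in Set.Ioi (0 : ℝ), f (-u) := by
  simp [integral_comp_neg_Ioi]

theorem im_le_norm_div_sqrt_two {η : ℂ} (h0 : 0 < η.im) (h1 : η.im < η.re) :
    η.im ≤ √2 / 2 * ‖η‖ := by
  have h := norm_sq_eq_re_sq_add_im_sq η
  have h2 : (√2 : ℝ) ^ 2 = 2 := Real.sq_sqrt (by norm_num)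
  refine le_of_sq_le_sq ?_ (by positivity)
  rw [mul_pow, div_pow, h2, h]
  nlinarith

theorem norm_auxIntegrand_neg_zeta8_le {s η : ℂ} (h0 : 0 < η.im) (h1 : η.im < η.re)
    (hs : s = 2 * (Real.pi : ℂ) * I * η ^ 2) (h2 : 1 ≤ η.re * η.im) {u : ℝ} (hu : 0 < u) :
    ‖auxIntegrand s (zeta8 * (-u : ℝ))‖ ≤ 2 * ‖kern s η‖ *
      Real.exp (2 * Real.pi * (η.re * η.im) * (2 * (u / ‖η‖) - 1) -
        Real.pi * u ^ 2 - Real.pi * (√2 / 2 * u) - 3 / 4 * Real.pi * s.im) := by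
  have hpi := Real.pi_gt_three
  have hre : 0 < η.re := h0.trans h1
  have hη : η ≠ 0 := by rintro rfl; simp at h0
  have hsre : s.re = -(4 * Real.pi * (η.re * η.im)) := by rw [hs, two_pi_I_mul_sq_re]
  have hsim : s.im = 2 * Real.pi * (η.re ^ 2 - η.im ^ 2) := by rw [hs, two_pi_I_mul_sq_im]
  have hsim0 : 0 ≤ s.im := by
    rw [hsim]; have : 0 ≤ η.re ^ 2 - η.im ^ 2 := by nlinarith
    positivity
  have hr : 0 < ‖η‖ := norm_pos_iff.2 hη
  have hr1 : 1 < ‖η‖ ^ 2 := by rw [norm_sq_eq_re_sq_add_im_sq]; nlinarith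
  have hr2 : 1 ≤ ‖η‖ := by nlinarith
  set v := Real.pi * (√2 / 2 * u) with hv
  have hv0 : 0 < v := by positivity
  have hden := exp_sub_exp_le_norm_den (zeta8 * (-u : ℝ))
  have him : (zeta8 * (-u : ℝ)).im = -(√2 / 2 * u) := by
    rw [im_mul_ofReal, zeta8_im]; ring
  rw [him, abs_neg, abs_of_pos (by positivity), ← hv] at hden
  have hpos : 0 < Real.exp v - Real.exp (-v) := by
    have := Real.exp_lt_exp.2 (show -v < v by linarith)
    linarith
  set k := -s.re with hk
  have hk1 : 1 ≤ k := by rw [hk, hsre]; nlinarith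
  have hv1 : u ≤ v := by
    rw [hv]
    have h3 : (1.4 : ℝ) ≤ √2 := Real.le_sqrt_of_sq_le (by norm_num)
    have : u * 1 ≤ u * (Real.pi * (√2 / 2)) := by gcongr; nlinarith
    linarith
  have hE : u ^ k * (1 + 1 / (2 * v)) ≤
      2 * (‖η‖ ^ k * Real.exp (k * (u / ‖η‖ - 1))) := by
    have e1 := rpow_le_rpow_mul_exp (k := k) hu hr (by linarith)
    have e2 := rpow_le_rpow_mul_exp (k := k - 1) hu hr (by linarith)
    have e3 : u ^ k = u ^ (k - 1) * u := by rw [← Real.rpow_add_one hu.ne']; ring_nf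
    have e4 : u ^ k * (1 / (2 * v)) ≤ u ^ (k - 1) * (1 / 2 * (1 / Real.pi * √2)) := by
      rw [e3, mul_assoc]
      refine mul_le_mul_of_nonneg_left ?_ (by positivity)
      rw [hv]
      have h3 : (√2 : ℝ) ^ 2 = 2 := Real.sq_sqrt (by norm_num)
      have h4 : 0 < √2 := by positivity
      apply le_of_eq
      field_simp
      linarith
    have e5 : 1 / 2 * (1 / Real.pi * √2) ≤ 1 / 4 := by
      have : √2 ≤ 1.5 := Real.sqrt_le_iff.2 ⟨by norm_num, by norm_num⟩
      rw [one_div_mul_eq_div, one_div_mul_eq_div, div_div, div_le_iff₀ (by positivity)]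
      linarith
    have e6 : ‖η‖ ^ (k - 1) ≤ ‖η‖ ^ k := Real.rpow_le_rpow_of_exponent_le hr2 (by linarith)
    have e7 : Real.exp ((k - 1) * (u / ‖η‖ - 1)) ≤ Real.exp (k * (u / ‖η‖ - 1)) * 3 := by
      calc _ ≤ Real.exp (k * (u / ‖η‖ - 1) + 1) := by
            apply Real.exp_le_exp.2
            have : 0 < u / ‖η‖ := by positivity
            linarith
        _ ≤ _ := by
            rw [Real.exp_add]
            gcongr
            linarith [Real.exp_one_lt_d9]
    have e8 : u ^ (k - 1) ≤ ‖η‖ ^ k * (Real.exp (k * (u / ‖η‖ - 1)) * 3) :=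
      e2.trans (by gcongr)
    have e9 : u ^ (k - 1) * (1 / 2 * (1 / Real.pi * √2)) ≤ u ^ (k - 1) * (1 / 4) := by gcongr
    have e10 : 0 ≤ ‖η‖ ^ k * Real.exp (k * (u / ‖η‖ - 1)) := by positivity
    rw [mul_add, mul_one]
    linarith
  have hN := rpow_mul_exp_le_norm_kern (s := s) h0 hsim0
  rw [auxIntegrand_eq, norm_div, norm_kern_neg_zeta8 s hu]
  calc _ ≤ u ^ k * Real.exp (-(3 / 4 * Real.pi * s.im) - Real.pi * u ^ 2) *
        (1 / (Real.exp v - Real.exp (-v))) := by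
        rw [mul_one_div]; gcongr
    _ ≤ u ^ k * Real.exp (-(3 / 4 * Real.pi * s.im) - Real.pi * u ^ 2) *
        (Real.exp (-v) * (1 + 1 / (2 * v))) := by
        gcongr; exact inv_exp_sub_exp_le hv0
    _ = (u ^ k * (1 + 1 / (2 * v))) *
        Real.exp (-(3 / 4 * Real.pi * s.im) - Real.pi * u ^ 2 - v) := by
        rw [Real.exp_sub _ v, Real.exp_neg v]; ring
    _ ≤ 2 * (‖η‖ ^ k * Real.exp (k * (u / ‖η‖ - 1))) *
        Real.exp (-(3 / 4 * Real.pi * s.im) - Real.pi * u ^ 2 - v) := by gcongr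
    _ = 2 * (‖η‖ ^ k * Real.exp (-(2 * Real.pi * (η.re * η.im)))) *
        Real.exp (2 * Real.pi * (η.re * η.im) * (2 * (u / ‖η‖) - 1) -
        Real.pi * u ^ 2 - v - 3 / 4 * Real.pi * s.im) := by
        rw [show 2 * (‖η‖ ^ k * Real.exp (k * (u / ‖η‖ - 1))) *
          Real.exp (-(3 / 4 * Real.pi * s.im) - Real.pi * u ^ 2 - v) = 2 * ‖η‖ ^ k *
          (Real.exp (k * (u / ‖η‖ - 1)) *
          Real.exp (-(3 / 4 * Real.pi * s.im) - Real.pi * u ^ 2 - v)) by ring, ← Real.exp_add,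
          show ∀ z, 2 * (‖η‖ ^ k * Real.exp (-(2 * Real.pi * (η.re * η.im)))) * z = 2 * ‖η‖ ^ k *
          (Real.exp (-(2 * Real.pi * (η.re * η.im))) * z) by intro z; ring, ← Real.exp_add, hk, hsre]
        ring_nf
    _ ≤ _ := by gcongr

/-- The gain is `e ^ (-3πt/4)`, from `arg x = -3π/4`. Besides `e ^ (-t)` the bound must contain `e ^
(-π η.im)`, the size of the first saddle term, even though `η.im` may be large. -/
theorem norm_lowerPart_le {s η : ℂ} (h0 : 0 < η.im) (h1 : η.im < η.re)
    (hs : s = 2 * (Real.pi : ℂ) * I * η ^ 2) (h2 : 1 ≤ η.re * η.im) :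
    ‖lowerPart s‖ ≤ 40 * ‖kern s η‖ * Real.exp (-(Real.pi * η.im)) * Real.exp (-s.im) := by
  have hpi := Real.pi_gt_three
  have hpi2 := Real.pi_lt_d2
  have hre : 0 < η.re := h0.trans h1
  have hη : η ≠ 0 := by rintro rfl; simp at h0
  have hsim : s.im = 2 * Real.pi * (η.re ^ 2 - η.im ^ 2) := by rw [hs, two_pi_I_mul_sq_im]
  have hsim0 : 0 ≤ s.im := by
    rw [hsim]; have : 0 ≤ η.re ^ 2 - η.im ^ 2 := by nlinarith
    positivity
  have hr : 0 < ‖η‖ := norm_pos_iff.2 hη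
  have hrsq := norm_sq_eq_re_sq_add_im_sq η
  have hr2 : 1 ≤ ‖η‖ := by nlinarith
  have hy := im_le_norm_div_sqrt_two h0 h1
  have hsq2 : √2 ≤ 1.5 := Real.sqrt_le_iff.2 ⟨by norm_num, by norm_num⟩
  have hsq0 : 0 ≤ √2 := Real.sqrt_nonneg 2
  set r := ‖η‖ with hrdef
  -- `S` is `sin (2 arg η)`.
  obtain ⟨S, hS⟩ : ∃ S, η.re * η.im = r ^ 2 * S / 2 := ⟨2 * (η.re * η.im) / r ^ 2, by field_simp⟩
  have hquad : ∀ u : ℝ, 2 * Real.pi * (η.re * η.im) * (2 * (u / r) - 1) - Real.pi * u ^ 2 =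
      -(Real.pi * S * (u - r) ^ 2) - Real.pi * (1 - S) * u ^ 2 := by
    intro u
    rw [hS]; field_simp; ring
  have hSpos : 0 < S := by
    have : 0 < r ^ 2 * S / 2 := hS ▸ (by positivity)
    have h3 : 0 < r ^ 2 := by positivity
    nlinarith
  have hS1 : S ≤ 1 := by
    have h3 : r ^ 2 * S ≤ r ^ 2 * 1 := by nlinarith [sq_nonneg (η.re - η.im)]
    exact le_of_mul_le_mul_left h3 (by positivity)
  have hkey : ∃ c : ℝ, ∀ u : ℝ, 0 < u →
      2 * Real.pi * (η.re * η.im) * (2 * (u / r) - 1) - Real.pi * u ^ 2 -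
        Real.pi * (√2 / 2 * u) - 3 / 4 * Real.pi * s.im ≤
      Real.pi / 2 - Real.pi * η.im - s.im + -(Real.pi / 4) * (u - c) ^ 2 := by
    -- For `S ≥ 1/2` the mass sits near `u = r`, where the denominator supplies `e ^ (-πr/√2) ≤ e ^
    -- (-π η.im)`. For `S < 1/2` the ordinate `t` is at least a multiple of `r²`, and the surplus
    -- `3π/4 - 1` in the power of `e ^ (-t)` pays for it.
    rcases le_or_gt (1 / 2) S with hS2 | hS2
    · refine ⟨r, fun u hu => ?_⟩
      rw [hquad]
      have e1 : Real.pi * (1 / 2) * (u - r) ^ 2 ≤ Real.pi * S * (u - r) ^ 2 := by gcongr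
      have e2 : 0 ≤ Real.pi * (1 - S) * u ^ 2 := by
        have : 0 ≤ 1 - S := by linarith
        positivity
      have e3 : Real.pi * η.im ≤ Real.pi * (√2 / 2 * r) := by gcongr
      have e4 : s.im ≤ 3 / 4 * Real.pi * s.im := by nlinarith
      have e5 : √2 / 2 * (r - u) ≤ 1 / 4 * (u - r) ^ 2 + 1 / 2 := by
        have h3 : (√2 : ℝ) ^ 2 = 2 := Real.sq_sqrt (by norm_num)
        nlinarith [sq_nonneg ((r - u) / 2 - √2 / 2)]
      have e6 := mul_le_mul_of_nonneg_left e5 (by positivity : 0 ≤ Real.pi)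
      linarith
    · refine ⟨0, fun u hu => ?_⟩
      rw [hquad, sub_zero]
      have e1 : 0 ≤ Real.pi * S * (u - r) ^ 2 := by positivity
      have e2 : Real.pi * (1 / 4) * u ^ 2 ≤ Real.pi * (1 - S) * u ^ 2 := by gcongr; linarith
      have e3 : 3 / 4 * r ^ 2 ≤ η.re ^ 2 - η.im ^ 2 :=
        three_fourths_norm_sq_le h0 h1 (by nlinarith)
      have e4 : Real.pi * η.im ≤ Real.pi * r ^ 2 := by
        gcongr
        calc η.im ≤ √2 / 2 * r := hy
          _ ≤ 1 * r := by gcongr; linarith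
          _ ≤ r ^ 2 := by nlinarith
      have e5 : 0 ≤ Real.pi * (√2 / 2 * u) := by positivity
      have e6 : Real.pi * r ^ 2 ≤ (3 / 4 * Real.pi - 1) * s.im := by
        have : 3 / 4 * Real.pi - 1 ≥ 5 / 4 := by linarith
        have h7 : 2 * Real.pi * (3 / 4 * r ^ 2) ≤ s.im := by rw [hsim]; gcongr
        nlinarith
      linarith
  obtain ⟨c, hc⟩ := hkey
  have hb : (0 : ℝ) < Real.pi / 4 := by positivity
  have := norm_integral_Ioi_gaussian_le (f := fun u : ℝ => auxIntegrand s (zeta8 * (-u : ℝ)))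
    (A := 2 * ‖kern s η‖ * Real.exp (Real.pi / 2 - Real.pi * η.im - s.im)) (b := Real.pi / 4)
    (c := c) hb (by positivity) (fun u hu => by
      refine (norm_auxIntegrand_neg_zeta8_le h0 h1 hs h2 hu).trans ?_
      rw [mul_assoc _ (Real.exp _), ← Real.exp_add]
      refine mul_le_mul_of_nonneg_left (Real.exp_le_exp.2 (hc u hu)) (by positivity))
  rw [lowerPart, norm_mul, norm_zeta8, mul_one, integral_Iic_eq_integral_Ioi_neg]
  refine this.trans ?_
  have hsqrt : √(Real.pi / (Real.pi / 4)) = 2 := by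
    rw [show Real.pi / (Real.pi / 4) = 2 ^ 2 by field_simp; norm_num, Real.sqrt_sq (by norm_num)]
  have hexp : Real.exp (Real.pi / 2) ≤ 10 := by
    calc Real.exp (Real.pi / 2) ≤ Real.exp (1 + 1) := Real.exp_le_exp.2 (by linarith)
      _ = Real.exp 1 * Real.exp 1 := Real.exp_add _ _
      _ ≤ 3 * 3 := by gcongr <;> linarith [Real.exp_one_lt_d9]
      _ ≤ 10 := by norm_num
  rw [hsqrt, show Real.pi / 2 - Real.pi * η.im - s.im = Real.pi / 2 + (-(Real.pi * η.im) + -s.im) by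
    ring, Real.exp_add, Real.exp_add]
  calc _ = 4 * Real.exp (Real.pi / 2) * (‖kern s η‖ * Real.exp (-(Real.pi * η.im)) *
        Real.exp (-s.im)) := by ring
    _ ≤ 4 * 10 * (‖kern s η‖ * Real.exp (-(Real.pi * η.im)) * Real.exp (-s.im)) := by gcongr
    _ = _ := by ring

/-! ### The saddle point on the ray, for large argument of `η` -/

theorem norm_exp_sub_exp_le (z w : ℂ) :
    ‖exp z - exp w‖ ≤ Real.exp w.re * (‖z - w‖ * Real.exp ‖z - w‖) := by
  have h := norm_exp_sub_sum_le_norm_mul_exp (z - w) 1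
  simp only [Finset.range_one, Finset.sum_singleton, pow_zero, Nat.factorial_zero, Nat.cast_one,
    div_one, pow_one] at h
  have h2 : exp z - exp w = exp w * (exp (z - w) - 1) := by
    rw [mul_sub, ← exp_add, mul_one]; congr 2; ring
  rw [h2, norm_mul, norm_exp]
  gcongr

theorem norm_log_one_add_sub_sq_le {w : ℂ} (hw : ‖w‖ ≤ 1 / 4) :
    ‖log (1 + w) - (w - w ^ 2 / 2)‖ ≤ ‖w‖ ^ 3 / 2 := by
  have h := norm_log_sub_logTaylor_le 2 (z := w) (by linarith)
  have h2 : logTaylor 3 w = w - w ^ 2 / 2 := by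
    simp [logTaylor_succ, logTaylor_zero]; ring
  norm_num [h2] at h
  refine h.trans ?_
  have h3 : (1 - ‖w‖)⁻¹ ≤ (3 / 4)⁻¹ := by gcongr; linarith
  have h4 : ‖w‖ ^ 3 * (1 - ‖w‖)⁻¹ ≤ ‖w‖ ^ 3 * (3 / 4)⁻¹ := by gcongr
  have : 0 ≤ ‖w‖ ^ 3 := by positivity
  norm_num at h4
  linarith

/-- An exact factorisation. With `x = η (1 + w)` the bracket is `w + w²/2 - log (1 + w) = w² +
O(w³)`, at least for small `w`; the linear term vanishes because `η` is critical. -/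
theorem kern_eq_mul_exp {η x : ℂ} (hη : η ≠ 0) (hx : x ≠ 0) :
    kern (2 * (Real.pi : ℂ) * I * η ^ 2) x = kern (2 * (Real.pi : ℂ) * I * η ^ 2) η *
      exp (2 * (Real.pi : ℂ) * I * η ^ 2 * (((x / η) ^ 2 - 1) / 2 - (log x - log η))) := by
  rw [kern, kern, cpow_def_of_ne_zero hη, cpow_def_of_ne_zero hx, ← exp_add, ← exp_add, ← exp_add]
  congr 1
  field_simp
  ring

theorem cube_le_exp {z : ℝ} (hz : 0 ≤ z) : z ^ 3 ≤ 6 * Real.exp z := by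
  have := Real.pow_div_factorial_le_exp z hz 3
  norm_num [Nat.factorial] at this
  linarith

theorem re_ray_quadratic (η : ℂ) (w : ℝ) :
    (2 * (Real.pi : ℂ) * I * η ^ 2 * w ^ 2 + (Real.pi : ℂ) * I * η * w).re =
      -(4 * Real.pi * (η.re * η.im) * w ^ 2) - Real.pi * η.im * w := by
  have h : (2 * (Real.pi : ℂ) * I * η ^ 2 * w ^ 2 + (Real.pi : ℂ) * I * η * w) =
    ((w ^ 2 : ℝ) : ℂ) * (2 * (Real.pi : ℂ) * I * η ^ 2) + ((Real.pi * w : ℝ) : ℂ) * (I * η) := by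
    push_cast; ring
  rw [h, add_re, re_ofReal_mul, re_ofReal_mul, two_pi_I_mul_sq_re]
  simp; ring

theorem re_ray_quadratic_le {η : ℂ} (h0 : 0 < η.im) (hS : ‖η‖ ^ 2 ≤ 4 * (η.re * η.im)) (w : ℝ) :
    (2 * (Real.pi : ℂ) * I * η ^ 2 * w ^ 2 + (Real.pi : ℂ) * I * η * w).re ≤
      -(Real.pi * (‖η‖ * w) ^ 2) + Real.pi * |‖η‖ * w| := by
  have hpi := Real.pi_pos
  rw [re_ray_quadratic]
  have h1 : Real.pi * w ^ 2 * ‖η‖ ^ 2 ≤ Real.pi * w ^ 2 * (4 * (η.re * η.im)) := by gcongr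
  have h2 : -(η.im * w) ≤ |‖η‖ * w| := by
    rw [abs_mul, abs_norm]
    have h3 : η.im ≤ ‖η‖ := (le_abs_self _).trans (abs_im_le_norm η)
    have h4 := neg_abs_le w
    have h5 := abs_nonneg w
    nlinarith
  have h6 := mul_le_mul_of_nonneg_left h2 hpi.le
  linarith

/-- Away from the saddle `1 < 8 |w| = 8 |z| / ‖η‖` with `z = ‖η‖ w`, so a factor `1 / ‖η‖` can be
bought with part of the Gaussian. The weaker coefficient `π/2` lets the lemma serve both the true
exponent and its quadratic model. -/
theorem norm_exp_ray_quadratic_le {η : ℂ} (h0 : 0 < η.im)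
    (hS : ‖η‖ ^ 2 ≤ 4 * (η.re * η.im)) {w : ℝ} (hw : 1 / 8 < |w|) {E : ℂ}
    (hE : E.re ≤ -(Real.pi / 2 * (‖η‖ * w) ^ 2) + Real.pi * |‖η‖ * w|) :
    ‖exp E‖ ≤ 8 * Real.exp 5 / ‖η‖ * Real.exp (-(1 / 2) * (‖η‖ * w) ^ 2) := by
  have hη : η ≠ 0 := by rintro rfl; simp at h0
  have hr : 0 < ‖η‖ := norm_pos_iff.2 hη
  have hpi := Real.pi_gt_three
  have hpi2 := Real.pi_lt_d2
  rw [norm_exp]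
  set z := ‖η‖ * w with hz
  have hz8 : ‖η‖ ≤ 8 * |z| := by
    rw [hz, abs_mul, abs_norm]; nlinarith
  have h1 : |z| ≤ Real.exp |z| := by linarith [Real.add_one_le_exp |z|]
  have h2 : (1 : ℝ) ≤ 8 * Real.exp |z| / ‖η‖ := by
    rw [one_le_div₀ hr]; linarith
  calc Real.exp E.re ≤ Real.exp (-(Real.pi / 2 * z ^ 2) + Real.pi * |z|) * 1 := by
        rw [mul_one]; gcongr
    _ ≤ Real.exp (-(Real.pi / 2 * z ^ 2) + Real.pi * |z|) * (8 * Real.exp |z| / ‖η‖) := by gcongr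
    _ = 8 / ‖η‖ * Real.exp (-(Real.pi / 2 * z ^ 2) + Real.pi * |z| + |z|) := by
        rw [Real.exp_add _ |z|]; ring
    _ ≤ 8 / ‖η‖ * Real.exp (5 + -(1 / 2) * z ^ 2) := by
        refine mul_le_mul_of_nonneg_left (Real.exp_le_exp.2 ?_) (by positivity)
        have e1 : Real.pi * |z| ≤ 3.15 * |z| := by gcongr
        have e2 : 3 / 2 * z ^ 2 ≤ Real.pi / 2 * z ^ 2 := by gcongr
        have e3 := sq_abs z
        nlinarith [sq_nonneg (|z| - 2.1)]
    _ = _ := by rw [Real.exp_add]; ring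

theorem norm_exp_ray_sub_le {η : ℂ} (h0 : 0 < η.im)
    (hS : ‖η‖ ^ 2 ≤ 4 * (η.re * η.im)) {w : ℝ} (hw : -1 < w) :
    ‖exp (2 * (Real.pi : ℂ) * I * η ^ 2 * (((1 + w) ^ 2 - 1) / 2 - Real.log (1 + w)) +
        (Real.pi : ℂ) * I * η * w) -
      exp (2 * (Real.pi : ℂ) * I * η ^ 2 * w ^ 2 + (Real.pi : ℂ) * I * η * w)‖ ≤
      20 * Real.exp 5 / ‖η‖ * Real.exp (-(1 / 2) * (‖η‖ * w) ^ 2) := by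
  have hη : η ≠ 0 := by rintro rfl; simp at h0
  have hr : 0 < ‖η‖ := norm_pos_iff.2 hη
  have hpi := Real.pi_gt_three
  have hpi2 := Real.pi_lt_d2
  have hQ := re_ray_quadratic_le h0 hS w
  -- Near the saddle the cubic Taylor remainder is at most `π |z|³ / ‖η‖`. Far away both
  -- exponentials are small separately: `log (1 + w) ≤ w` still leaves half of the quadratic term.
  rcases le_or_gt |w| (1 / 8) with h | h
  · have hlog := norm_log_one_add_sub_sq_le (w := w) (by rw [norm_real, Real.norm_eq_abs]; linarith)
    rw [norm_real, Real.norm_eq_abs, show (1 : ℂ) + w = ((1 + w : ℝ) : ℂ) by push_cast; rfl,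
      ← ofReal_log (by linarith)] at hlog
    refine (norm_exp_sub_exp_le _ _).trans ?_
    set z := ‖η‖ * w with hz
    have hdiff : ‖(2 * (Real.pi : ℂ) * I * η ^ 2 * (((1 + w) ^ 2 - 1) / 2 - Real.log (1 + w)) +
        (Real.pi : ℂ) * I * η * w) -
        (2 * (Real.pi : ℂ) * I * η ^ 2 * w ^ 2 + (Real.pi : ℂ) * I * η * w)‖ ≤
        Real.pi * |z| ^ 3 / ‖η‖ := by
      have : (2 * (Real.pi : ℂ) * I * η ^ 2 * (((1 + w) ^ 2 - 1) / 2 - Real.log (1 + w)) +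
        (Real.pi : ℂ) * I * η * w) -
        (2 * (Real.pi : ℂ) * I * η ^ 2 * w ^ 2 + (Real.pi : ℂ) * I * η * w) =
        -(2 * (Real.pi : ℂ) * I * η ^ 2) * (Real.log (1 + w) - (w - w ^ 2 / 2)) := by ring
      rw [this, norm_mul, norm_neg, norm_mul, norm_mul, norm_mul, norm_pow, norm_I, norm_real,
        Real.norm_of_nonneg Real.pi_pos.le, Complex.norm_ofNat]
      calc _ ≤ 2 * Real.pi * 1 * ‖η‖ ^ 2 * (|w| ^ 3 / 2) := by gcongr
        _ = _ := by rw [hz, abs_mul, abs_norm]; field_simp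
    have hz2 : Real.pi * |z| ^ 3 / ‖η‖ ≤ Real.pi / 8 * z ^ 2 := by
      rw [div_le_iff₀ hr]
      have : |z| ≤ 1 / 8 * ‖η‖ := by rw [hz, abs_mul, abs_norm, mul_comm]; gcongr
      rw [← sq_abs z]
      calc Real.pi * |z| ^ 3 = Real.pi * |z| ^ 2 * |z| := by ring
        _ ≤ Real.pi * |z| ^ 2 * (1 / 8 * ‖η‖) := by gcongr
        _ = _ := by ring
    have hc := cube_le_exp (abs_nonneg z)
    calc _ ≤ Real.exp (-(Real.pi * z ^ 2) + Real.pi * |z|) *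
          (Real.pi * |z| ^ 3 / ‖η‖ * Real.exp (Real.pi / 8 * z ^ 2)) := by
          gcongr
          exact hdiff.trans hz2
      _ ≤ Real.exp (-(Real.pi * z ^ 2) + Real.pi * |z|) *
          (3.15 * (6 * Real.exp |z|) / ‖η‖ * Real.exp (Real.pi / 8 * z ^ 2)) := by
          gcongr
      _ = 18.9 / ‖η‖ * Real.exp (-(Real.pi * z ^ 2) + Real.pi * |z| + |z| + Real.pi / 8 * z ^ 2) := by
          rw [Real.exp_add _ (Real.pi / 8 * z ^ 2), Real.exp_add _ |z|]; ring
      _ ≤ 20 / ‖η‖ * Real.exp (5 + -(1 / 2) * z ^ 2) := by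
          refine mul_le_mul (by gcongr; norm_num) (Real.exp_le_exp.2 ?_) (by positivity)
            (by positivity)
          have e1 : Real.pi * |z| ≤ 3.15 * |z| := by gcongr
          have e2 : 3 * (7 / 8 * z ^ 2) ≤ Real.pi * (7 / 8 * z ^ 2) := by gcongr
          have e3 := sq_abs z
          nlinarith [sq_nonneg (|z| - 1.2)]
      _ = _ := by rw [Real.exp_add]; ring
  · have h1 := norm_exp_ray_quadratic_le h0 hS h (E := 2 * (Real.pi : ℂ) * I * η ^ 2 * w ^ 2 +
      (Real.pi : ℂ) * I * η * w) (by
        have : 0 ≤ Real.pi / 2 * (‖η‖ * w) ^ 2 := by positivity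
        linarith)
    have h2 := norm_exp_ray_quadratic_le h0 hS h (E := 2 * (Real.pi : ℂ) * I * η ^ 2 *
      (((1 + w) ^ 2 - 1) / 2 - Real.log (1 + w)) + (Real.pi : ℂ) * I * η * w) (by
        have hl := Real.log_le_sub_one_of_pos (show 0 < 1 + w by linarith)
        have e1 : w ^ 2 / 2 ≤ ((1 + w) ^ 2 - 1) / 2 - Real.log (1 + w) := by nlinarith
        have e2 : (2 * (Real.pi : ℂ) * I * η ^ 2 * (((1 + w) ^ 2 - 1) / 2 - Real.log (1 + w)) +
            (Real.pi : ℂ) * I * η * w) =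
            (((((1 + w) ^ 2 - 1) / 2 - Real.log (1 + w) : ℝ)) : ℂ) * (2 * (Real.pi : ℂ) * I * η ^ 2) +
            ((Real.pi * w : ℝ) : ℂ) * (I * η) := by push_cast; ring
        rw [e2, add_re, re_ofReal_mul, re_ofReal_mul, two_pi_I_mul_sq_re]
        have e3 := re_ray_quadratic η w
        have e4 : (I * η).re = -η.im := by simp
        rw [e4]
        have hS0 : 0 < η.re * η.im := by
          have : 0 < ‖η‖ ^ 2 := by positivity
          linarith
        have e5 := mul_le_mul_of_nonneg_right e1 (by positivity : 0 ≤ 4 * Real.pi * (η.re * η.im))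
        have e6 : Real.pi * w ^ 2 * ‖η‖ ^ 2 ≤ Real.pi * w ^ 2 * (4 * (η.re * η.im)) := by gcongr
        rw [e3] at hQ
        have h2 : -(η.im * w) ≤ |‖η‖ * w| := by
          rw [abs_mul, abs_norm]
          have h3 : η.im ≤ ‖η‖ := (le_abs_self _).trans (abs_im_le_norm η)
          have h4 := neg_abs_le w
          have h5 := abs_nonneg w
          nlinarith
        have h6 := mul_le_mul_of_nonneg_left h2 Real.pi_pos.le
        linarith)
    calc _ ≤ _ := norm_sub_le _ _
      _ ≤ _ := add_le_add h2 h1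
      _ ≤ _ := by
        rw [← add_mul, ← add_div, ← add_mul]
        gcongr
        norm_num

theorem rayTerm_eq_mul_integral {η : ℂ} (h0 : 0 < η.im) (h1 : η.im < η.re) :
    rayTerm (2 * (Real.pi : ℂ) * I * η ^ 2) 1 = kern (2 * (Real.pi : ℂ) * I * η ^ 2) η *
      exp ((Real.pi : ℂ) * I * η) * η * ∫ u in Set.Ioi (0 : ℝ),
        exp (2 * (Real.pi : ℂ) * I * η ^ 2 * (((1 + (u - 1 : ℝ)) ^ 2 - 1) / 2 -
          Real.log (1 + (u - 1))) + (Real.pi : ℂ) * I * η * (u - 1 : ℝ)) := by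
  have hη : η ≠ 0 := by rintro rfl; simp at h0
  have hre : 0 < η.re := h0.trans h1
  have hpi := Real.pi_pos
  rw [rayTerm_eq_rotate h0 h1 ?_ ?_ zero_le_one, mul_comm (∫ u in Set.Ioi (0 : ℝ), _) η,
    mul_comm (kern _ _ * _) η, mul_assoc η]
  · refine congrArg (η * ·) ?_
    rw [← integral_const_mul]
    refine setIntegral_congr_fun (s := Set.Ioi (0 : ℝ)) measurableSet_Ioi fun u hu => ?_
    have hu : 0 < u := hu
    have hu' : (u : ℂ) ≠ 0 := ofReal_ne_zero.2 hu.ne'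
    rw [kern_eq_mul_exp hη (mul_ne_zero hη hu'), log_mul_ofReal u hu η hη, mul_assoc (kern _ _),
      mul_assoc (kern _ _), ← exp_add, ← exp_add, mul_div_cancel_left₀ _ hη]
    congr 2
    rw [add_sub_cancel]
    push_cast
    ring
  · rw [two_pi_I_mul_sq_im]
    have : 0 ≤ η.re ^ 2 - η.im ^ 2 := by nlinarith
    positivity
  · rw [two_pi_I_mul_sq_re]
    have : 0 < η.re * η.im := by positivity
    nlinarith

/-- Completing the square gives the phase `e ^ (-πi/8)`, the case `m = 1` of `e ^ (-πi m²/8)`. The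
branch of the square root is fixed by `Re (zeta8 / (√2 η)) > 0`. -/
theorem integral_cexp_ray_quadratic {η : ℂ} (h0 : 0 < η.im) (h1 : 0 < η.re) :
    η * ∫ u : ℝ, exp (2 * (Real.pi : ℂ) * I * η ^ 2 * (u - 1 : ℝ) ^ 2 +
      (Real.pi : ℂ) * I * η * (u - 1 : ℝ)) = zeta8 / √2 * exp (-(Real.pi * I / 8)) := by
  have hη : η ≠ 0 := by rintro rfl; simp at h0
  have hpi := Real.pi_pos
  have hpi' : (Real.pi : ℂ) ≠ 0 := ofReal_ne_zero.2 hpi.ne'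
  have h2 : ((√2 : ℝ) : ℂ) ^ 2 = 2 := by
    rw [← ofReal_pow, Real.sq_sqrt (by norm_num)]; norm_num
  have h20 : ((√2 : ℝ) : ℂ) ≠ 0 := ofReal_ne_zero.2 (by positivity)
  rw [integral_sub_right_eq_self (fun w : ℝ => exp (2 * (Real.pi : ℂ) * I * η ^ 2 * (w : ℂ) ^ 2 +
      (Real.pi : ℂ) * I * η * w)) 1]
  have hq := integral_cexp_quadratic (b := 2 * (Real.pi : ℂ) * I * η ^ 2) (by
    rw [two_pi_I_mul_sq_re]
    have : 0 < η.re * η.im := by positivity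
    nlinarith) ((Real.pi : ℂ) * I * η) 0
  simp only [add_zero] at hq
  have hroot : (Real.pi : ℂ) / -(2 * (Real.pi : ℂ) * I * η ^ 2) = (zeta8 / (√2 * η)) ^ 2 := by
    rw [div_pow, mul_pow, h2, zeta8_sq]
    field_simp
    rw [I_sq]
  have hre : 0 < (zeta8 / (√2 * η)).re := by
    rw [← div_div, div_re]
    have e1 : (zeta8 / (√2 : ℝ)).re = 1 / 2 := by
      rw [div_ofReal_re, zeta8_re]; field_simp
    have e2 : (zeta8 / (√2 : ℝ)).im = 1 / 2 := by
      rw [div_ofReal_im, zeta8_im]; field_simp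
    rw [e1, e2]
    have : 0 < normSq η := normSq_pos.2 hη
    positivity
  rw [hq, hroot, one_div, sq_cpow_two_inv hre]
  have hexp : (0 : ℂ) - ((Real.pi : ℂ) * I * η) ^ 2 / (4 * (2 * (Real.pi : ℂ) * I * η ^ 2)) =
      -(Real.pi * I / 8) := by
    field_simp
    ring
  rw [hexp]
  field_simp

/-- The integral over `u > 0` is compared with the full Gaussian. The missing half-line lies at `|w|
≥ 1` from the saddle and obeys the same bound. -/
theorem norm_rayTerm_sub_le {η : ℂ} (h0 : 0 < η.im) (h1 : η.im < η.re)
    (hS : ‖η‖ ^ 2 ≤ 4 * (η.re * η.im)) :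
    ‖rayTerm (2 * (Real.pi : ℂ) * I * η ^ 2) 1 - kern (2 * (Real.pi : ℂ) * I * η ^ 2) η *
      (zeta8 / √2) * (exp (-(Real.pi * I / 8)) * exp ((Real.pi : ℂ) * I * η))‖ ≤
    ‖kern (2 * (Real.pi : ℂ) * I * η ^ 2) η‖ * Real.exp (-(Real.pi * η.im)) *
      (60 * Real.exp 5 / ‖η‖) := by
  have hη : η ≠ 0 := by rintro rfl; simp at h0
  have hre : 0 < η.re := h0.trans h1
  have hr : 0 < ‖η‖ := norm_pos_iff.2 hη
  have hpi := Real.pi_gt_three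
  set s := 2 * (Real.pi : ℂ) * I * η ^ 2 with hs
  set E : ℝ → ℂ := fun u => exp (s * (((1 + (u - 1 : ℝ)) ^ 2 - 1) / 2 -
          Real.log (1 + (u - 1))) + (Real.pi : ℂ) * I * η * (u - 1 : ℝ)) with hE
  set Q : ℝ → ℂ := fun u => exp (s * (u - 1 : ℝ) ^ 2 + (Real.pi : ℂ) * I * η * (u - 1 : ℝ)) with hQ
  have hQi : Integrable Q := by
    have := integrable_cexp_quadratic' (b := s) (by
      rw [hs, two_pi_I_mul_sq_re]
      have : 0 < η.re * η.im := by positivity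
      nlinarith) ((Real.pi : ℂ) * I * η) 0
    simp only [add_zero] at this
    exact this.comp_sub_right 1
  have hpt : ∀ u : ℝ, ‖(Set.Ioi (0 : ℝ)).indicator E u - Q u‖ ≤
      20 * Real.exp 5 / ‖η‖ * Real.exp (-(‖η‖ ^ 2 / 2) * (u - 1) ^ 2) := by
    intro u
    have hsq : -(‖η‖ ^ 2 / 2) * (u - 1) ^ 2 = -(1 / 2) * (‖η‖ * (u - 1)) ^ 2 := by ring
    rw [hsq]
    by_cases hu : 0 < u
    · rw [Set.indicator_of_mem (show u ∈ Set.Ioi (0 : ℝ) from hu)]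
      exact norm_exp_ray_sub_le h0 hS (by linarith)
    · rw [Set.indicator_of_notMem (by simpa using hu), zero_sub, norm_neg]
      refine (norm_exp_ray_quadratic_le h0 hS (w := u - 1) ?_ ?_).trans ?_
      · rw [abs_of_nonpos (by linarith)]; linarith
      · refine (re_ray_quadratic_le h0 hS (u - 1)).trans ?_
        have : 0 ≤ Real.pi / 2 * (‖η‖ * (u - 1)) ^ 2 := by positivity
        linarith
      · gcongr
        norm_num
  have hEm : AEStronglyMeasurable ((Set.Ioi (0 : ℝ)).indicator E) := by
    refine AEStronglyMeasurable.indicator ?_ measurableSet_Ioi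
    refine Measurable.aestronglyMeasurable ?_
    simp only [hE]
    fun_prop
  have hb : 0 < ‖η‖ ^ 2 / 2 := by positivity
  have hgi := (integrable_exp_neg_mul_sub_sq hb 1).const_mul (20 * Real.exp 5 / ‖η‖)
  have hdi : Integrable fun u => (Set.Ioi (0 : ℝ)).indicator E u - Q u :=
    hgi.mono' (hEm.sub hQi.aestronglyMeasurable) (Filter.Eventually.of_forall hpt)
  have hEi : Integrable ((Set.Ioi (0 : ℝ)).indicator E) := by
    have := hdi.add hQi
    refine this.congr (Filter.Eventually.of_forall fun u => ?_)
    simp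
  have hle : ‖(∫ u in Set.Ioi (0 : ℝ), E u) - ∫ u, Q u‖ ≤
      20 * Real.exp 5 / ‖η‖ * √(Real.pi / (‖η‖ ^ 2 / 2)) := by
    rw [← integral_indicator measurableSet_Ioi, ← integral_sub hEi hQi,
      ← integral_exp_neg_mul_sub_sq _ 1, ← integral_const_mul]
    exact norm_integral_le_of_norm_le hgi (Filter.Eventually.of_forall hpt)
  have hsqrt : √(Real.pi / (‖η‖ ^ 2 / 2)) ≤ 3 / ‖η‖ := by
    refine Real.sqrt_le_iff.2 ⟨by positivity, ?_⟩
    rw [div_pow, div_div_eq_mul_div]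
    gcongr
    linarith [Real.pi_lt_d2]
  have hmain : rayTerm s 1 - kern s η * (zeta8 / √2) * (exp (-(Real.pi * I / 8)) *
      exp ((Real.pi : ℂ) * I * η)) = kern s η * exp ((Real.pi : ℂ) * I * η) * η *
      ((∫ u in Set.Ioi (0 : ℝ), E u) - ∫ u, Q u) := by
    have h3 := integral_cexp_ray_quadratic h0 hre
    rw [hs, rayTerm_eq_mul_integral h0 h1, mul_sub]
    linear_combination kern (2 * (Real.pi : ℂ) * I * η ^ 2) η * exp ((Real.pi : ℂ) * I * η) * h3
  rw [hmain, norm_mul, norm_mul, norm_mul, norm_exp_pi_I_mul]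
  calc _ ≤ ‖kern s η‖ * Real.exp (-(Real.pi * η.im)) * ‖η‖ *
        (20 * Real.exp 5 / ‖η‖ * (3 / ‖η‖)) := by
        gcongr
        exact hle.trans (by gcongr)
    _ = _ := by field_simp; ring

/-! ### The exponent on the line through the shifted saddle, for small argument of `η` -/

/-- `arctan` is concave on `[0, ∞)`, hence lies below its tangents there. -/
theorem arctan_sub_arctan_le {q q₀ : ℝ} (hq : 0 ≤ q) (hq₀ : 0 ≤ q₀) :
    Real.arctan q - Real.arctan q₀ ≤ (q - q₀) / (1 + q₀ ^ 2) := by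
  rcases lt_trichotomy q q₀ with h | h | h
  · obtain ⟨ξ, hξ, hd⟩ := exists_deriv_eq_slope Real.arctan h Real.continuous_arctan.continuousOn
      Real.differentiable_arctan.differentiableOn
    rw [Real.deriv_arctan, eq_div_iff (by linarith)] at hd
    have h1 : 1 / (1 + q₀ ^ 2) ≤ 1 / (1 + ξ ^ 2) := by
      gcongr
      · linarith [hξ.1]
      · exact hξ.2.le
    have h2 := mul_le_mul_of_nonneg_right h1 (by linarith : 0 ≤ q₀ - q)
    have h3 : (q - q₀) / (1 + q₀ ^ 2) = -(1 / (1 + q₀ ^ 2) * (q₀ - q)) := by ring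
    rw [h3]
    linarith
  · simp [h]
  · obtain ⟨ξ, hξ, hd⟩ := exists_deriv_eq_slope Real.arctan h Real.continuous_arctan.continuousOn
      Real.differentiable_arctan.differentiableOn
    rw [Real.deriv_arctan, eq_div_iff (by linarith)] at hd
    have h1 : 1 / (1 + ξ ^ 2) ≤ 1 / (1 + q₀ ^ 2) := by
      gcongr
      exact hξ.1.le
    have h2 := mul_le_mul_of_nonneg_right h1 (by linarith : 0 ≤ q - q₀)
    have h3 : (q - q₀) / (1 + q₀ ^ 2) = 1 / (1 + q₀ ^ 2) * (q - q₀) := by ring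
    rw [h3]
    linarith

/-- In the frame `η = zeta8 (α - β i)`, `x = zeta8 (a - b i)`, the left side bounds the real part of
the relative exponent, divided by `π`, once the logarithm of `‖x‖ / ‖η‖` has been replaced by its
linear bound. `κ` is the effect of the shift by `m/4`. -/
theorem far_exponent_le {α β κ a b u : ℝ} (hβ : 0 < β) (hαβ : β ≤ α)
    (hS : 3 / 8 * (α ^ 2 + β ^ 2) ≤ α * β) (hS' : (α ^ 2 + β ^ 2) ≤ 4 * β ^ 2)
    (hκ : 0 ≤ κ) (ha : a = α - κ + u) (hb : b = β - κ) (hbβ : β ≤ 2 * b) (hκu : 300 * κ ≤ |u|)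
    (hu : α ^ 2 + β ^ 2 ≤ 64 * u ^ 2) :
    2 / (α ^ 2 + β ^ 2) * (α ^ 2 * b ^ 2 - β ^ 2 * a ^ 2) +
      4 * (α * β) * (Real.arctan (a / b) - Real.arctan (α / β)) - 4 * κ * u ≤ -(u ^ 2 / 5) := by
  have hα : 0 < α := hβ.trans_le hαβ
  have hb0 : 0 < b := by linarith
  have hr : 0 < α ^ 2 + β ^ 2 := by positivity
  have hbb : b ^ 2 ≤ β ^ 2 := by nlinarith
  have hab2 : 2 * (α * β) ≤ α ^ 2 + β ^ 2 := by nlinarith [sq_nonneg (α - β)]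
  have hfrac : 1 / 2 ≤ 2 * β ^ 2 / (α ^ 2 + β ^ 2) := by
    rw [le_div_iff₀ hr]; linarith
  have hku : -(4 * κ * u) ≤ 4 * κ * |u| := by
    have := neg_abs_le u
    nlinarith
  have hku2 : κ * |u| ≤ u ^ 2 / 300 := by
    rw [← sq_abs u]; nlinarith [abs_nonneg u]
  -- For `a ≤ 0` the angle has dropped by at least `π/4`, which outweighs the positive term `αβ`.
  -- For `a > 0` the tangent to `arctan` at `α / β` combines with the squares into `-2β² (a - α)² /
  -- (α² + β²)`, up to small terms in `κ`.
  rcases le_or_gt a 0 with ha0 | ha0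
  · have h1 : Real.arctan (a / b) ≤ 0 := by
      rw [← Real.arctan_zero]
      exact Real.arctan_mono (div_nonpos_of_nonpos_of_nonneg ha0 hb0.le)
    have h2 : Real.pi / 4 ≤ Real.arctan (α / β) := by
      rw [← Real.arctan_one]
      exact Real.arctan_mono ((one_le_div₀ hβ).2 hαβ)
    have h3 : 4 * (α * β) * (Real.arctan (a / b) - Real.arctan (α / β)) ≤
        4 * (α * β) * -(3 / 4) := by
      gcongr
      linarith [Real.pi_gt_three]
    have h4 : 2 / (α ^ 2 + β ^ 2) * (α ^ 2 * b ^ 2 - β ^ 2 * a ^ 2) =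
        2 / (α ^ 2 + β ^ 2) * (α ^ 2 * b ^ 2) - 2 * β ^ 2 / (α ^ 2 + β ^ 2) * a ^ 2 := by ring
    have h5 : 2 / (α ^ 2 + β ^ 2) * (α ^ 2 * b ^ 2) ≤ α * β := by
      rw [div_mul_eq_mul_div, div_le_iff₀ hr]
      have e1 : α ^ 2 * b ^ 2 ≤ α ^ 2 * β ^ 2 := by gcongr
      have e2 : α * β * (2 * (α * β)) ≤ α * β * (α ^ 2 + β ^ 2) := by gcongr
      linarith
    have h6 : 1 / 2 * a ^ 2 ≤ 2 * β ^ 2 / (α ^ 2 + β ^ 2) * a ^ 2 := by gcongr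
    have h7 : u ^ 2 ≤ 2 * a ^ 2 + 2 * α ^ 2 := by
      have hu0 : u = a - (α - κ) := by rw [ha]; ring
      have e1 : (α - κ) ^ 2 ≤ α ^ 2 := by
        have : κ ≤ β := by linarith
        nlinarith
      rw [hu0]
      nlinarith [sq_nonneg (a + (α - κ))]
    have h8 := sq_nonneg β
    rw [h4]
    linarith
  · have h1 := arctan_sub_arctan_le (div_nonneg ha0.le hb0.le) (div_nonneg hα.le hβ.le)
    have h2 : 4 * (α * β) * (Real.arctan (a / b) - Real.arctan (α / β)) ≤
        4 * (α * β) * ((a / b - α / β) / (1 + (α / β) ^ 2)) := by gcongr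
    have h3 : 4 * (α * β) * ((a / b - α / β) / (1 + (α / β) ^ 2)) =
        2 * β ^ 2 / (α ^ 2 + β ^ 2) * (2 * α * a - 2 * α ^ 2) +
        4 * (α * β) / (α ^ 2 + β ^ 2) * (β / b * a * κ) := by
      have hbk : β = b + κ := by linarith
      have e1 : 1 + (α / β) ^ 2 = (α ^ 2 + β ^ 2) / β ^ 2 := by field_simp; ring
      have e2 : a / b = a / β + a * κ / (b * β) := by field_simp; rw [hbk]
      rw [e1, e2]
      field_simp
      ring
    have h4 : 2 / (α ^ 2 + β ^ 2) * (α ^ 2 * b ^ 2 - β ^ 2 * a ^ 2) ≤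
        2 * β ^ 2 / (α ^ 2 + β ^ 2) * (α ^ 2 - a ^ 2) := by
      have e1 : 2 * β ^ 2 / (α ^ 2 + β ^ 2) * (α ^ 2 - a ^ 2) =
          2 / (α ^ 2 + β ^ 2) * (α ^ 2 * β ^ 2 - β ^ 2 * a ^ 2) := by ring
      rw [e1]
      gcongr
    have h5 : 1 / 2 * (a - α) ^ 2 ≤ 2 * β ^ 2 / (α ^ 2 + β ^ 2) * (a - α) ^ 2 := by gcongr
    have h6 : 4 * (α * β) / (α ^ 2 + β ^ 2) * (β / b * a * κ) ≤ 2 * (2 * a * κ) := by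
      have e1 : 4 * (α * β) / (α ^ 2 + β ^ 2) ≤ 2 := by rw [div_le_iff₀ hr]; linarith
      have e2 : β / b ≤ 2 := by rw [div_le_iff₀ hb0]; exact hbβ
      gcongr
    have h7 : a ≤ 9 * |u| := by
      have e1 : α ≤ 8 * |u| := by
        refine le_of_sq_le_sq ?_ (by positivity)
        rw [mul_pow, sq_abs]
        nlinarith
      rw [ha]
      linarith [le_abs_self u]
    have h8 : a * κ ≤ 9 * |u| * κ := by gcongr
    have h9 : (a - α) ^ 2 = u ^ 2 - 2 * (κ * u) + κ ^ 2 := by rw [ha]; ring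
    have h10 : κ * u ≤ κ * |u| := by gcongr; exact le_abs_self u
    have h11 := sq_nonneg κ
    linarith

theorem arg_zeta8_mul (a : ℝ) {b : ℝ} (hb : 0 < b) :
    arg (zeta8 * (a - b * I)) = -(Real.pi / 4) + Real.arctan (a / b) := by
  have hpi := Real.pi_pos
  set θ := Real.arctan (a / b) with hθ
  have h1 := Real.arctan_lt_pi_div_two (a / b)
  have h2 := Real.neg_pi_div_two_lt_arctan (a / b)
  have hcos : 0 < Real.cos θ := Real.cos_arctan_pos _
  have htan : a = b * (Real.sin θ / Real.cos θ) := by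
    rw [← Real.tan_eq_sin_div_cos, hθ, Real.tan_arctan, mul_div_cancel₀ _ hb.ne']
  have hzeta : zeta8 = I * (Real.cos (-(Real.pi / 4)) + Real.sin (-(Real.pi / 4)) * I) := by
    rw [zeta8_eq, Real.cos_neg, Real.sin_neg, Real.cos_pi_div_four, Real.sin_pi_div_four]
    push_cast
    linear_combination (√2 / 2 : ℂ) * I_sq
  have hx : zeta8 * (a - b * I) = ((b / Real.cos θ : ℝ) : ℂ) *
      (cos ((-(Real.pi / 4) + θ : ℝ) : ℂ) + sin ((-(Real.pi / 4) + θ : ℝ) : ℂ) * I) := by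
    have hc : ((Real.cos θ : ℝ) : ℂ) ≠ 0 := ofReal_ne_zero.2 hcos.ne'
    rw [hzeta, htan, ← ofReal_cos, ← ofReal_sin, Real.cos_add, Real.sin_add]
    generalize Real.cos (-(Real.pi / 4)) = c
    generalize Real.sin (-(Real.pi / 4)) = d
    generalize hC : Real.cos θ = C at *
    push_cast
    field_simp
    linear_combination (-(I * d * b * C) - c * b * C + d * b * sin (θ : ℂ)) * I_sq
  rw [hx, arg_mul_cos_add_sin_mul_I (by positivity) ⟨by linarith, by linarith⟩]

theorem zeta8_mul_sub (a b : ℝ) : zeta8 * (a - b * I) =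
    ((√2 / 2 * (a + b) : ℝ) : ℂ) + ((√2 / 2 * (a - b) : ℝ) : ℂ) * I := by
  rw [zeta8_eq]; push_cast; linear_combination (-(√2 / 2 : ℂ) * b) * I_sq

theorem eq_zeta8_mul (x : ℂ) : x =
    zeta8 * ((√2 / 2 * (x.re + x.im) : ℝ) - (√2 / 2 * (x.re - x.im) : ℝ) * I) := by
  have h2 : (√2 : ℝ) ^ 2 = 2 := Real.sq_sqrt (by norm_num)
  rw [zeta8_mul_sub]
  apply Complex.ext
  · simp; linear_combination (-(x.re / 2)) * h2
  · simp; linear_combination (-(x.im / 2)) * h2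

/-- The exponent of `kern s x * e ^ (π i m x)` relative to its value at `η`, where
`s = 2 π i η ^ 2`. -/
noncomputable def relExponent (η : ℂ) (m : ℝ) (x : ℂ) : ℂ :=
  2 * (Real.pi : ℂ) * I * η ^ 2 * (((x / η) ^ 2 - 1) / 2 - (log x - log η)) +
    (Real.pi : ℂ) * I * m * (x - η)

theorem relExponent_re {η : ℂ} (hη : η ≠ 0) (m : ℝ) (x : ℂ) : (relExponent η m x).re =
    4 * Real.pi * (η.re * η.im) * (Real.log ‖x‖ - Real.log ‖η‖) +
    2 * Real.pi * (η.re ^ 2 - η.im ^ 2) * (arg x - arg η) -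
    2 * Real.pi * (x.re * x.im - η.re * η.im) - Real.pi * m * (x.im - η.im) := by
  have h : relExponent η m x = -((2 * (Real.pi : ℂ) * I * η ^ 2) * (log x - log η)) +
      (Real.pi : ℝ) * (I * (x ^ 2 - η ^ 2)) + ((Real.pi * m : ℝ) : ℂ) * (I * (x - η)) := by
    rw [relExponent]
    field_simp
    push_cast
    ring
  rw [h, add_re, add_re, neg_re, re_ofReal_mul, re_ofReal_mul, mul_re, two_pi_I_mul_sq_re,
    two_pi_I_mul_sq_im, sub_re, sub_im, log_re, log_re, log_im, log_im]
  simp [pow_two]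
  ring

theorem relExponent_re_le {η : ℂ} (h0 : 0 < η.im) (h1 : η.im < η.re)
    (hS : 4 * (η.re * η.im) ≤ ‖η‖ ^ 2) {m : ℝ} (hm : 0 ≤ m) (hmr : 1000 * m ≤ ‖η‖) {u : ℝ}
    (hu : ‖η‖ ≤ 8 * |u|) : (relExponent η m (η - (m / 4 : ℝ) + zeta8 * u)).re ≤ -(u ^ 2 / 2) := by
  have hη : η ≠ 0 := by rintro rfl; simp at h0
  have hr : 0 < ‖η‖ := norm_pos_iff.2 hη
  have h2 : (√2 : ℝ) ^ 2 = 2 := Real.sq_sqrt (by norm_num)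
  have hsq2 : √2 ≤ 1.5 := Real.sqrt_le_iff.2 ⟨by norm_num, by norm_num⟩
  have hsq0 : 0 < √2 := by positivity
  obtain ⟨α, hα⟩ : ∃ α, α = √2 / 2 * (η.re + η.im) := ⟨_, rfl⟩
  obtain ⟨β, hβ⟩ : ∃ β, β = √2 / 2 * (η.re - η.im) := ⟨_, rfl⟩
  obtain ⟨κ, hκ⟩ : ∃ κ, κ = √2 / 2 * (m / 4) := ⟨_, rfl⟩
  obtain ⟨a, ha⟩ : ∃ a, a = α - κ + u := ⟨_, rfl⟩
  obtain ⟨b, hb⟩ : ∃ b, b = β - κ := ⟨_, rfl⟩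
  have hβ0 : 0 < β := by rw [hβ]; have : 0 < η.re - η.im := by linarith
                         positivity
  have hnorm := norm_sq_eq_re_sq_add_im_sq η
  have hrr : α ^ 2 + β ^ 2 = ‖η‖ ^ 2 := by
    rw [hnorm, hα, hβ]; linear_combination ((η.re ^ 2 + η.im ^ 2) / 2) * h2
  have hαβ2 : α ^ 2 - β ^ 2 = 2 * (η.re * η.im) := by
    rw [hα, hβ]; linear_combination (η.re * η.im) * h2
  have hαβ1 : 2 * (α * β) = η.re ^ 2 - η.im ^ 2 := by
    rw [hα, hβ]; linear_combination ((η.re ^ 2 - η.im ^ 2) / 2) * h2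
  have h34 := three_fourths_norm_sq_le h0 h1 hS
  have hκ0 : 0 ≤ κ := by rw [hκ]; positivity
  have hκm : κ ≤ m / 4 := by rw [hκ]; nlinarith
  have hβr : ‖η‖ ≤ 2 * β := by
    refine le_of_sq_le_sq ?_ (by positivity)
    nlinarith
  have hb0 : 0 < b := by linarith
  have hη' : η = zeta8 * (α - β * I) := by rw [hα, hβ]; exact eq_zeta8_mul η
  have hx' : η - (m / 4 : ℝ) + zeta8 * u = zeta8 * (a - b * I) := by
    have := eq_zeta8_mul ((m / 4 : ℝ) : ℂ)
    rw [ofReal_re, ofReal_im, add_zero, sub_zero, ← hκ] at this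
    rw [this, hη', ha, hb]
    push_cast
    ring
  have hfar := far_exponent_le (u := u) hβ0 (by rw [hα, hβ]; gcongr; linarith) (by rw [hrr]; linarith)
    (by rw [hrr]; nlinarith) hκ0 ha hb (by linarith) (by linarith)
    (by rw [hrr, ← sq_abs u]; nlinarith [norm_nonneg η])
  rw [relExponent_re hη, hx', arg_zeta8_mul a hb0]
  conv_lhs => rw [show arg η = -(Real.pi / 4) + Real.arctan (α / β) by
    rw [← arg_zeta8_mul α hβ0, ← hη']]
  obtain ⟨x, hx⟩ : ∃ x, x = zeta8 * (a - b * I) := ⟨_, rfl⟩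
  have hxre : x.re = √2 / 2 * (a + b) := by rw [hx, zeta8_mul_sub]; simp
  have hxim : x.im = √2 / 2 * (a - b) := by rw [hx, zeta8_mul_sub]; simp
  rw [← hx, hxre, hxim]
  have hxn : ‖x‖ ^ 2 = a ^ 2 + b ^ 2 := by
    rw [norm_sq_eq_re_sq_add_im_sq, hxre, hxim]
    linear_combination ((a ^ 2 + b ^ 2) / 2) * h2
  have hx0 : 0 < ‖x‖ := by
    have : 0 < ‖x‖ ^ 2 := by rw [hxn]; positivity
    exact lt_of_le_of_ne (norm_nonneg _) fun h => by rw [← h] at this; simp at this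
  have hlog : Real.log ‖x‖ - Real.log ‖η‖ ≤ ((a ^ 2 + b ^ 2) / (α ^ 2 + β ^ 2) - 1) / 2 := by
    have := Real.log_le_sub_one_of_pos (show 0 < (‖x‖ / ‖η‖) ^ 2 by positivity)
    rw [Real.log_pow, Real.log_div hx0.ne' hr.ne', div_pow, hxn, ← hrr] at this
    push_cast at this
    linarith
  have hpq : 0 < η.re * η.im := mul_pos (h0.trans h1) h0
  have hlog2 := mul_le_mul_of_nonneg_left hlog
    (by positivity : 0 ≤ 4 * Real.pi * (η.re * η.im))
  have him : η.im = √2 / 2 * (α - β) := by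
    rw [hα, hβ]; linear_combination (-(η.im / 2)) * h2
  have hab : a - b = α - β + u := by rw [ha, hb]; ring
  have hmκ : Real.pi * m * (√2 / 2 * (a - b) - η.im) = Real.pi * (4 * κ * u) := by
    rw [him, hab, hκ]; ring
  have hprod : √2 / 2 * (a + b) * (√2 / 2 * (a - b)) = (a ^ 2 - b ^ 2) / 2 := by
    linear_combination ((a ^ 2 - b ^ 2) / 4) * h2
  rw [hmκ, hprod, ← hαβ1]
  have hpiu := mul_le_mul_of_nonneg_left hfar Real.pi_pos.le
  have hpi3 : 3 * (u ^ 2 / 5) ≤ Real.pi * (u ^ 2 / 5) := by gcongr; exact Real.pi_gt_three.le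
  have hident : 4 * Real.pi * (η.re * η.im) * (((a ^ 2 + b ^ 2) / (α ^ 2 + β ^ 2) - 1) / 2) -
      2 * Real.pi * ((a ^ 2 - b ^ 2) / 2 - η.re * η.im) =
      Real.pi * (2 / (α ^ 2 + β ^ 2) * (α ^ 2 * b ^ 2 - β ^ 2 * a ^ 2)) := by
    have e1 : η.re * η.im = (α ^ 2 - β ^ 2) / 2 := by linarith
    have e2 : α ^ 2 + β ^ 2 ≠ 0 := by positivity
    rw [e1]
    field_simp
    ring
  have hu2 := sq_nonneg u
  linarith

theorem log_mul_one_add_sub {η w : ℂ} (h0 : 0 < η.im) (h1 : η.im < η.re) (hw : ‖w‖ ≤ 1 / 4) :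
    log (η * (1 + w)) - log η = log (1 + w) := by
  have hη : η ≠ 0 := by rintro rfl; simp at h0
  have hre : 0 < (1 + w).re := by
    have := (abs_le.1 (abs_re_le_norm w)).1
    simp; linarith
  have hw0 : 1 + w ≠ 0 := by intro h; rw [h] at hre; simp at hre
  have ha := abs_lt.1 (abs_arg_lt_pi_div_two_iff.2 (Or.inl hre))
  have hb := arg_pos_of_im_pos h0
  have hc := arg_lt_pi_div_four h0 h1
  rw [log_mul hη hw0 ⟨by linarith, by linarith [Real.pi_pos]⟩, add_sub_cancel_left]

/-- With `z = x - η`, `2πi z² + πi m z = 2πi (z + m/4)² - πi m²/8`, and `z + m/4 = zeta8 u` makes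
this `-2πu² - πi m²/8`. The error is the cubic term of the logarithm. -/
theorem norm_relExponent_sub_le {η : ℂ} (h0 : 0 < η.im) (h1 : η.im < η.re) {m : ℝ} (hm : 0 ≤ m)
    {u : ℝ} (hu : |u| + m / 4 ≤ ‖η‖ / 4) :
    ‖relExponent η m (η - (m / 4 : ℝ) + zeta8 * u) - (-(2 * Real.pi * u ^ 2) -
      Real.pi * I * m ^ 2 / 8)‖ ≤ Real.pi * (|u| + m / 4) ^ 3 / ‖η‖ := by
  have hη : η ≠ 0 := by rintro rfl; simp at h0
  have hr : 0 < ‖η‖ := norm_pos_iff.2 hη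
  obtain ⟨z, hz⟩ : ∃ z : ℂ, z = zeta8 * u - (m / 4 : ℝ) := ⟨_, rfl⟩
  have hzn : ‖z‖ ≤ |u| + m / 4 := by
    rw [hz]
    refine (norm_sub_le _ _).trans_eq ?_
    rw [norm_mul, norm_zeta8, one_mul, norm_real, norm_real, Real.norm_eq_abs,
      Real.norm_of_nonneg (by positivity)]
  have hw : ‖z / η‖ ≤ 1 / 4 := by
    rw [norm_div, div_le_iff₀ hr]; linarith
  have hx : η - (m / 4 : ℝ) + zeta8 * u = η * (1 + z / η) := by
    rw [hz]; field_simp; ring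
  have hxe : η * (1 + z / η) - η = z := by field_simp; ring
  have hlog := norm_log_one_add_sub_sq_le hw
  rw [hx, relExponent, log_mul_one_add_sub h0 h1 hw, hxe, mul_div_cancel_left₀ _ hη]
  have hsq : z ^ 2 = I * u ^ 2 - zeta8 * u * (m / 2) + (m / 4) ^ 2 := by
    rw [hz]; push_cast; linear_combination (u : ℂ) ^ 2 * zeta8_sq
  have hid : 2 * (Real.pi : ℂ) * I * η ^ 2 * (((1 + z / η) ^ 2 - 1) / 2 - log (1 + z / η)) +
      (Real.pi : ℂ) * I * m * z - (-(2 * Real.pi * u ^ 2) - Real.pi * I * m ^ 2 / 8) =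
      -(2 * (Real.pi : ℂ) * I * η ^ 2) * (log (1 + z / η) - (z / η - (z / η) ^ 2 / 2)) := by
    have e1 : η ^ 2 * (z / η) ^ 2 = z ^ 2 := by field_simp
    have e2 : (Real.pi : ℂ) * I * m * z = Real.pi * I * m * (zeta8 * u - m / 4) := by
      rw [hz]; push_cast; ring
    rw [e2]
    linear_combination 2 * Real.pi * I * e1 + 2 * Real.pi * I * hsq + 2 * Real.pi * u ^ 2 * I_sq
  rw [hid, norm_mul, norm_neg, norm_mul, norm_mul, norm_mul, norm_pow, norm_I, norm_real,
    Real.norm_of_nonneg Real.pi_pos.le, Complex.norm_ofNat]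
  calc _ ≤ 2 * Real.pi * 1 * ‖η‖ ^ 2 * (‖z / η‖ ^ 3 / 2) := by gcongr
    _ = Real.pi * ‖z‖ ^ 3 / ‖η‖ := by rw [norm_div]; field_simp
    _ ≤ _ := by gcongr

theorem norm_exp_le_of_far {r u : ℝ} (hr : 0 < r) (hu : r ≤ 8 * |u|) {E : ℂ}
    (hE : E.re ≤ -(u ^ 2 / 2)) : ‖exp E‖ ≤ 24 / r * Real.exp (-(1 / 8) * u ^ 2) := by
  rw [norm_exp]
  have h1 : |u| ≤ Real.exp |u| := by linarith [Real.add_one_le_exp |u|]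
  have h2 : (1 : ℝ) ≤ 8 * Real.exp |u| / r := by rw [one_le_div₀ hr]; linarith
  calc Real.exp E.re ≤ Real.exp (-(u ^ 2 / 2)) * 1 := by rw [mul_one]; gcongr
    _ ≤ Real.exp (-(u ^ 2 / 2)) * (8 * Real.exp |u| / r) := by gcongr
    _ = 8 / r * Real.exp (-(u ^ 2 / 2) + |u|) := by rw [Real.exp_add]; ring
    _ ≤ 8 / r * Real.exp (1 + -(1 / 8) * u ^ 2) := by
        refine mul_le_mul_of_nonneg_left (Real.exp_le_exp.2 ?_) (by positivity)
        rw [← sq_abs]; nlinarith [sq_nonneg (|u| - 4 / 3)]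
    _ = 8 * Real.exp 1 / r * Real.exp (-(1 / 8) * u ^ 2) := by rw [Real.exp_add]; ring
    _ ≤ _ := by gcongr; linarith [Real.exp_one_lt_d9]

/-- The far range uses `relExponent_re_le`, the near range the cubic remainder. The assumption `m³ ≤
‖η‖` keeps the part of that remainder coming from the shift `m/4` bounded inside the exponential. -/
theorem norm_exp_relExponent_sub_le {η : ℂ} (h0 : 0 < η.im) (h1 : η.im < η.re)
    (hS : 4 * (η.re * η.im) ≤ ‖η‖ ^ 2) {m : ℝ} (hm : 1 ≤ m) (hmr : 1000 * m ≤ ‖η‖)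
    (hm3 : m ^ 3 ≤ ‖η‖) (u : ℝ) :
    ‖exp (relExponent η m (η - (m / 4 : ℝ) + zeta8 * u)) - exp (-(2 * Real.pi * u ^ 2) -
      Real.pi * I * m ^ 2 / 8)‖ ≤ 2000 * m ^ 3 / ‖η‖ * Real.exp (-(1 / 8) * u ^ 2) := by
  have hr : 0 < ‖η‖ := by linarith
  have hpi := Real.pi_gt_three
  have hpi2 := Real.pi_lt_d2
  have hQre : (-(2 * Real.pi * u ^ 2) - Real.pi * I * m ^ 2 / 8 : ℂ).re = -(2 * Real.pi * u ^ 2) := by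
    rw [show (-(2 * Real.pi * u ^ 2) - Real.pi * I * m ^ 2 / 8 : ℂ) =
      ((-(2 * Real.pi * u ^ 2) : ℝ) : ℂ) + ((-(Real.pi * m ^ 2 / 8) : ℝ) : ℂ) * I by push_cast; ring,
      add_re, ofReal_re, re_ofReal_mul, I_re, mul_zero, add_zero]
  have hm31 : 1 ≤ m ^ 3 := one_le_pow₀ hm
  rcases le_or_gt ‖η‖ (8 * |u|) with h | h
  · have hE := norm_exp_le_of_far hr h (relExponent_re_le h0 h1 hS (by linarith) hmr h)
    have hQ := norm_exp_le_of_far hr h (E := -(2 * Real.pi * u ^ 2) - Real.pi * I * m ^ 2 / 8) (by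
      rw [hQre]; nlinarith [sq_nonneg u])
    calc _ ≤ _ := norm_sub_le _ _
      _ ≤ _ := add_le_add hE hQ
      _ ≤ _ := by
        rw [← add_mul, ← add_div]
        gcongr
        linarith
  · have hd := norm_relExponent_sub_le h0 h1 (by linarith : 0 ≤ m) (u := u) (by linarith)
    refine (norm_exp_sub_exp_le _ _).trans ?_
    rw [hQre]
    have hcube : (|u| + m / 4) ^ 3 ≤ 4 * |u| ^ 3 + m ^ 3 / 16 := by
      have : 0 ≤ (|u| + m / 4) * (|u| - m / 4) ^ 2 := by positivity
      nlinarith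
    have hd2 : Real.pi * (|u| + m / 4) ^ 3 / ‖η‖ ≤ Real.pi * (4 * |u| ^ 3 + m ^ 3 / 16) / ‖η‖ := by
      gcongr
    have hexpo : Real.pi * (4 * |u| ^ 3 + m ^ 3 / 16) / ‖η‖ ≤ Real.pi / 2 * u ^ 2 + 1 := by
      rw [div_le_iff₀ hr]
      have e1 : |u| ^ 3 ≤ u ^ 2 * (‖η‖ / 8) := by
        rw [← sq_abs u, pow_succ]; gcongr; linarith
      have e2 : Real.pi * (4 * |u| ^ 3) ≤ Real.pi * (4 * (u ^ 2 * (‖η‖ / 8))) := by gcongr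
      have e3 : Real.pi * (m ^ 3 / 16) ≤ 3.15 * (‖η‖ / 16) := by gcongr
      linarith
    have hpoly : Real.pi * (4 * |u| ^ 3 + m ^ 3 / 16) ≤ 80 * m ^ 3 * Real.exp |u| := by
      have e1 := cube_le_exp (abs_nonneg u)
      have e2 := Real.add_one_le_exp |u|
      have e3 := abs_nonneg u
      calc _ ≤ 3.15 * (4 * (6 * Real.exp |u|) + m ^ 3 / 16) := by gcongr
        _ ≤ 3.15 * (4 * (6 * (m ^ 3 * Real.exp |u|)) + m ^ 3 * Real.exp |u| / 16) := by
            gcongr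
            · exact le_mul_of_one_le_left (by positivity) hm31
            · exact le_mul_of_one_le_right (by positivity) (by linarith)
        _ ≤ _ := by
            have : 0 ≤ m ^ 3 * Real.exp |u| := by positivity
            linarith
    calc _ ≤ Real.exp (-(2 * Real.pi * u ^ 2)) * (80 * m ^ 3 * Real.exp |u| / ‖η‖ *
          Real.exp (Real.pi / 2 * u ^ 2 + 1)) := by
          gcongr
          · exact hd.trans (hd2.trans (by gcongr))
          · exact hd.trans (hd2.trans hexpo)
      _ = 80 * m ^ 3 / ‖η‖ * Real.exp (-(2 * Real.pi * u ^ 2) + |u| +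
          (Real.pi / 2 * u ^ 2 + 1)) := by
          rw [Real.exp_add (_ + _), Real.exp_add _ |u|]; ring
      _ ≤ 80 * m ^ 3 / ‖η‖ * Real.exp (2 + -(1 / 8) * u ^ 2) := by
          refine mul_le_mul_of_nonneg_left (Real.exp_le_exp.2 ?_) (by positivity)
          have e1 : 3 * (3 / 2 * u ^ 2) ≤ Real.pi * (3 / 2 * u ^ 2) := by gcongr
          have e2 := sq_abs u
          nlinarith [sq_nonneg (|u| - 1 / 2)]
      _ = 80 * Real.exp 2 * m ^ 3 / ‖η‖ * Real.exp (-(1 / 8) * u ^ 2) := by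
          rw [Real.exp_add]; ring
      _ ≤ _ := by
          gcongr
          have : Real.exp 2 = Real.exp 1 * Real.exp 1 := by rw [← Real.exp_add]; norm_num
          have h3 := Real.exp_one_lt_d9
          have h4 := Real.exp_pos 1
          rw [this]
          nlinarith

/-! ### Asymptotics of the individual terms -/

/-- The integral of `kern s x * e ^ (π i m x)` over the full line through `0`. -/
noncomputable def lineTerm (s : ℂ) (m : ℝ) : ℂ :=
  (∫ u : ℝ, kern s (zeta8 * u) * exp ((Real.pi : ℂ) * I * (m * (zeta8 * u)))) * zeta8

/-- Without the denominator the line may move down freely, with no poles to cross, as far as the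
saddle `η - m/4`, in the steepest descent direction `zeta8`. The factor `1/√2` is `∫ e ^ (-2πu²)
du`. -/
theorem norm_lineTerm_sub_le {η : ℂ} (h0 : 0 < η.im) (h1 : η.im < η.re)
    (hS : 4 * (η.re * η.im) ≤ ‖η‖ ^ 2) {m : ℝ} (hm : 1 ≤ m) (hmr : 1000 * m ≤ ‖η‖)
    (hm3 : m ^ 3 ≤ ‖η‖) :
    ‖lineTerm (2 * (Real.pi : ℂ) * I * η ^ 2) m - kern (2 * (Real.pi : ℂ) * I * η ^ 2) η *
      (zeta8 / √2) * (exp (-(Real.pi * I * m ^ 2 / 8)) * exp ((Real.pi : ℂ) * I * (m * η)))‖ ≤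
    ‖kern (2 * (Real.pi : ℂ) * I * η ^ 2) η‖ * Real.exp (-(Real.pi * (m * η.im))) *
      (12000 * m ^ 3 / ‖η‖) := by
  have hη : η ≠ 0 := by rintro rfl; simp at h0
  have hre : 0 < η.re := h0.trans h1
  have hr : 0 < ‖η‖ := norm_pos_iff.2 hη
  have hpi := Real.pi_gt_three
  have hpi2 := Real.pi_lt_d2
  have h34 := three_fourths_norm_sq_le h0 h1 hS
  have hm0 : 0 ≤ m := by linarith
  set s := 2 * (Real.pi : ℂ) * I * η ^ 2 with hs
  have hsre : s.re < 0 := by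
    rw [hs, two_pi_I_mul_sq_re]
    have : 0 < η.re * η.im := by positivity
    nlinarith
  have hsim : 0 ≤ s.im := by
    rw [hs, two_pi_I_mul_sq_im]
    have : 0 ≤ η.re ^ 2 - η.im ^ 2 := by nlinarith
    positivity
  have hd0 : ‖η‖ / 4 ≤ η.re - η.im := by
    have e1 := norm_sq_eq_re_sq_add_im_sq η
    have e2 : η.re ≤ ‖η‖ := (le_abs_self _).trans (abs_re_le_norm η)
    have e3 : η.im ≤ ‖η‖ := (le_abs_self _).trans (abs_im_le_norm η)
    have e4 : 0 ≤ η.re - η.im := by linarith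
    have e5 : (η.re - η.im) * (η.re + η.im) ≤ (η.re - η.im) * (2 * ‖η‖) := by
      gcongr; linarith
    nlinarith
  -- Coordinates of the shifted saddle: `η - m/4 = zeta8 (a - b i)`. Thus `b` is the depth of the
  -- shift and `a` recentres the parameter.
  obtain ⟨b, hb⟩ : ∃ b, b = √2 / 2 * (η.re - m / 4 - η.im) := ⟨_, rfl⟩
  obtain ⟨a, ha⟩ : ∃ a, a = √2 / 2 * (η.re - m / 4 + η.im) := ⟨_, rfl⟩
  have hb0 : 0 ≤ b := by
    rw [hb]
    have : 0 ≤ η.re - m / 4 - η.im := by linarith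
    positivity
  have hpt0 : ∀ u : ℝ, zeta8 * (((u + a : ℝ) : ℂ) - b * I) = η - (m / 4 : ℝ) + zeta8 * u := by
    intro u
    have e1 := eq_zeta8_mul (η - (m / 4 : ℝ))
    have e2 : (η - ((m / 4 : ℝ) : ℂ)).re = η.re - m / 4 := by simp
    have e3 : (η - ((m / 4 : ℝ) : ℂ)).im = η.im := by simp
    rw [e2, e3, ← ha, ← hb] at e1
    rw [e1]; push_cast; ring
  have hx0 : ∀ u : ℝ, η - (m / 4 : ℝ) + zeta8 * u ≠ 0 := by
    intro u hu
    have e1 := congrArg re hu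
    have e2 := congrArg im hu
    simp [zeta8_re, zeta8_im] at e1 e2
    linarith
  have hfac : ∀ u : ℝ, kern s (η - (m / 4 : ℝ) + zeta8 * u) *
      exp ((Real.pi : ℂ) * I * (m * (η - (m / 4 : ℝ) + zeta8 * u))) =
      kern s η * exp ((Real.pi : ℂ) * I * (m * η)) *
        exp (relExponent η m (η - (m / 4 : ℝ) + zeta8 * u)) := by
    intro u
    rw [hs, kern_eq_mul_exp hη (hx0 u), mul_assoc (kern _ _), mul_assoc (kern _ _), ← exp_add,
      ← exp_add, relExponent]
    congr 2
    ring
  have hint := (integrable_kern_mul_exp_zeta8 hsim hsre hm0 hb0).comp_add_right a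
  simp only [hpt0, hfac] at hint
  have hc0 : kern s η * exp ((Real.pi : ℂ) * I * (m * η)) ≠ 0 :=
    mul_ne_zero (kern_ne_zero hη) (exp_ne_zero _)
  have hEi : Integrable fun u : ℝ => exp (relExponent η m (η - (m / 4 : ℝ) + zeta8 * u)) := by
    have := hint.const_mul (kern s η * exp ((Real.pi : ℂ) * I * (m * η)))⁻¹
    simpa only [inv_mul_cancel_left₀ hc0] using this
  have hQ := integral_cexp_quadratic (b := ((-(2 * Real.pi) : ℝ) : ℂ))
    (by rw [ofReal_re]; linarith) 0 (-(Real.pi * I * m ^ 2 / 8))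
  have hQi := integrable_cexp_quadratic' (b := ((-(2 * Real.pi) : ℝ) : ℂ))
    (by rw [ofReal_re]; linarith) 0 (-(Real.pi * I * m ^ 2 / 8))
  have hQe : ∀ u : ℝ, exp (((-(2 * Real.pi) : ℝ) : ℂ) * (u : ℂ) ^ 2 + 0 * u +
      -(Real.pi * I * m ^ 2 / 8)) = exp (-(2 * Real.pi * u ^ 2) - Real.pi * I * m ^ 2 / 8) := by
    intro u; congr 1; push_cast; ring
  simp only [hQe] at hQ hQi
  have hroot : (Real.pi : ℂ) / -((-(2 * Real.pi) : ℝ) : ℂ) = ((1 / √2 : ℝ) : ℂ) ^ 2 := by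
    rw [← ofReal_neg, ← ofReal_div, ← ofReal_pow]
    congr 1
    rw [div_pow, Real.sq_sqrt (by norm_num)]
    field_simp
  rw [hroot, show (1 / 2 : ℂ) = 2⁻¹ by norm_num, sq_cpow_two_inv (by rw [ofReal_re]; positivity)] at hQ
  have hle : ‖(∫ u : ℝ, exp (relExponent η m (η - (m / 4 : ℝ) + zeta8 * u))) -
      ∫ u : ℝ, exp (-(2 * Real.pi * u ^ 2) - Real.pi * I * m ^ 2 / 8)‖ ≤
      2000 * m ^ 3 / ‖η‖ * 6 := by
    have hg : (0 : ℝ) < 1 / 8 := by norm_num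
    have hgi := (integrable_exp_neg_mul_sub_sq hg 0).const_mul (2000 * m ^ 3 / ‖η‖)
    rw [← integral_sub hEi hQi]
    refine (norm_integral_le_of_norm_le hgi (Filter.Eventually.of_forall fun u => ?_)).trans ?_
    · rw [sub_zero]
      exact norm_exp_relExponent_sub_le h0 h1 hS hm hmr hm3 u
    · rw [integral_const_mul, integral_exp_neg_mul_sub_sq]
      gcongr
      refine Real.sqrt_le_iff.2 ⟨by norm_num, ?_⟩
      rw [div_le_iff₀ hg]; linarith
  have hmain : lineTerm s m - kern s η * (zeta8 / √2) * (exp (-(Real.pi * I * m ^ 2 / 8)) *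
      exp ((Real.pi : ℂ) * I * (m * η))) = kern s η * exp ((Real.pi : ℂ) * I * (m * η)) *
      ((∫ u : ℝ, exp (relExponent η m (η - (m / 4 : ℝ) + zeta8 * u))) -
      ∫ u : ℝ, exp (-(2 * Real.pi * u ^ 2) - Real.pi * I * m ^ 2 / 8)) * zeta8 := by
    rw [lineTerm, ← integral_kern_mul_exp_zeta8_shift hsim hsre hm0 hb0,
      ← integral_add_right_eq_self _ a]
    simp only [hpt0, hfac]
    rw [integral_const_mul, hQ]
    have e1 : (-(Real.pi * I * m ^ 2 / 8) : ℂ) - 0 ^ 2 / (4 * ((-(2 * Real.pi) : ℝ) : ℂ)) =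
      -(Real.pi * I * m ^ 2 / 8) := by simp
    rw [e1]
    push_cast
    ring
  rw [hmain, norm_mul, norm_mul, norm_mul, norm_zeta8, mul_one, norm_exp_pi_I_mul, im_ofReal_mul]
  calc _ ≤ ‖kern s η‖ * Real.exp (-(Real.pi * (m * η.im))) * (2000 * m ^ 3 / ‖η‖ * 6) := by
        gcongr
    _ = _ := by ring

theorem norm_lineTerm_sub_rayTerm_le {s η : ℂ} (h0 : 0 < η.im) (h1 : η.im < η.re)
    (hs : s = 2 * (Real.pi : ℂ) * I * η ^ 2)
    (hS : 4 * (η.re * η.im) ≤ ‖η‖ ^ 2) {m : ℝ} (hm : 1 ≤ m) (hmr : 1000 * m ≤ ‖η‖) :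
    ‖lineTerm s m - rayTerm s m‖ ≤
      ‖kern s η‖ * Real.exp (-(Real.pi * (m * η.im))) * (2 / ‖η‖) := by
  have hpi := Real.pi_gt_three
  have hre : 0 < η.re := h0.trans h1
  have hr : 0 < ‖η‖ := by linarith
  have h34 := three_fourths_norm_sq_le h0 h1 hS
  have hsre : s.re = -(4 * Real.pi * (η.re * η.im)) := by rw [hs, two_pi_I_mul_sq_re]
  have hsim : s.im = 2 * Real.pi * (η.re ^ 2 - η.im ^ 2) := by rw [hs, two_pi_I_mul_sq_im]
  have hsim0 : 0 ≤ s.im := by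
    rw [hsim]; have : 0 ≤ η.re ^ 2 - η.im ^ 2 := by nlinarith
    positivity
  have hpq : 0 < η.re * η.im := by positivity
  have hsre0 : s.re < 0 := by rw [hsre]; nlinarith
  have hm0 : 0 ≤ m := by linarith
  have hi := integrable_kern_mul_exp_zeta8 hsim0 hsre0 hm0 le_rfl
  simp only [ofReal_zero, zero_mul, sub_zero] at hi
  have hdiff : lineTerm s m - rayTerm s m = (∫ u in Set.Ioi (0 : ℝ), kern s (zeta8 * (-u : ℝ)) *
      exp ((Real.pi : ℂ) * I * (m * (zeta8 * (-u : ℝ))))) * zeta8 := by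
    rw [lineTerm, rayTerm, ← intervalIntegral.integral_Iic_add_Ioi hi.integrableOn
      hi.integrableOn (b := 0), integral_Iic_eq_integral_Ioi_neg]
    ring
  have hb : 0 < Real.pi / 2 := by positivity
  have hpt : ∀ u : ℝ, 0 < u → ‖kern s (zeta8 * (-u : ℝ)) *
      exp ((Real.pi : ℂ) * I * (m * (zeta8 * (-u : ℝ))))‖ ≤ ‖kern s η‖ *
      Real.exp (-(Real.pi * (m * η.im))) * Real.exp (-‖η‖) *
      Real.exp (-(Real.pi / 2) * (u - 0) ^ 2) := by
    intro u hu
    have hN := rpow_mul_exp_le_norm_kern (s := s) h0 hsim0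
    have hsq2 : √2 ≤ 1.5 := Real.sqrt_le_iff.2 ⟨by norm_num, by norm_num⟩
    have him : (zeta8 * (-u : ℝ)).im = -(√2 / 2 * u) := by
      rw [im_mul_ofReal, zeta8_im]; ring
    rw [norm_mul, norm_kern_neg_zeta8 s hu, norm_exp_pi_I_mul, im_ofReal_mul, him]
    have hk : 0 ≤ -s.re := by linarith
    calc _ ≤ ‖η‖ ^ (-s.re) * Real.exp (-s.re * (u / ‖η‖ - 1)) *
          Real.exp (-(3 / 4 * Real.pi * s.im) - Real.pi * u ^ 2) *
          Real.exp (-(Real.pi * (m * -(√2 / 2 * u)))) := by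
          gcongr
          exact rpow_le_rpow_mul_exp hu hr hk
      _ = (‖η‖ ^ (-s.re) * Real.exp (-(2 * Real.pi * (η.re * η.im)))) *
          Real.exp (-s.re * (u / ‖η‖ - 1) + (-(3 / 4 * Real.pi * s.im) - Real.pi * u ^ 2) +
          -(Real.pi * (m * -(√2 / 2 * u))) + 2 * Real.pi * (η.re * η.im)) := by
          rw [mul_assoc (‖η‖ ^ (-s.re) * _), mul_assoc (‖η‖ ^ (-s.re)), mul_assoc (‖η‖ ^ (-s.re))]
          simp only [← Real.exp_add]
          ring_nf
      _ ≤ ‖kern s η‖ * Real.exp (-(Real.pi * (m * η.im)) + -‖η‖ +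
          -(Real.pi / 2) * (u - 0) ^ 2) := by
          refine mul_le_mul hN (Real.exp_le_exp.2 ?_) (by positivity) (by positivity)
          have e1 : -s.re * (u / ‖η‖ - 1) + 2 * Real.pi * (η.re * η.im) ≤ Real.pi * (‖η‖ * u) := by
            have e2 : -s.re * (u / ‖η‖) ≤ Real.pi * ‖η‖ ^ 2 * (u / ‖η‖) := by
              gcongr
              rw [hsre]
              nlinarith
            have e3 : Real.pi * ‖η‖ ^ 2 * (u / ‖η‖) = Real.pi * (‖η‖ * u) := by
              field_simp
            have : 0 < Real.pi * (η.re * η.im) := by positivity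
            linarith
          -- The phase on the opposite ray gives `e ^ (-3πr²)`, ample for the growth `e ^ (πru)` of
          -- the power once half of `e ^ (-πu²)` is spent, and for the small terms in `m ≤ r /
          -- 1000`.
          have e4 : Real.pi * (3 * ‖η‖ ^ 2) ≤ 3 / 4 * Real.pi * s.im := by
            have e5 : 3 * (2 * (3 / 4 * ‖η‖ ^ 2)) ≤ s.im := by
              rw [hsim, mul_assoc 2 Real.pi, mul_left_comm 2 Real.pi]
              gcongr
            have := mul_le_mul_of_nonneg_left e5 (by positivity : 0 ≤ 3 / 4 * Real.pi)
            nlinarith [sq_nonneg ‖η‖]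
          have e6 : Real.pi * (m * (√2 / 2 * u)) ≤ Real.pi * (‖η‖ / 1000 * u) := by
            gcongr Real.pi * ?_
            calc m * (√2 / 2 * u) ≤ m * (1 * u) := by gcongr; linarith
              _ ≤ ‖η‖ / 1000 * u := by rw [one_mul]; gcongr; linarith
          have e7 : Real.pi * (m * η.im) ≤ Real.pi * (‖η‖ / 1000 * ‖η‖) := by
            gcongr
            · linarith
            · exact (le_abs_self _).trans (abs_im_le_norm η)
          have e8 : ‖η‖ ≤ Real.pi * ‖η‖ ^ 2 := by
            have : 1 ≤ ‖η‖ := by linarith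
            nlinarith
          have e9 : Real.pi * (1001 / 1000 * (‖η‖ * u)) ≤
              Real.pi * (1 / 2 * u ^ 2 + 0.6 * ‖η‖ ^ 2) := by
            gcongr
            nlinarith [sq_nonneg (‖η‖ - u)]
          have e10 : 0 ≤ Real.pi * ‖η‖ ^ 2 := by positivity
          linarith
      _ = _ := by rw [Real.exp_add, Real.exp_add]; ring
  have hle := norm_integral_Ioi_gaussian_le (c := 0) hb (by positivity) hpt
  rw [hdiff, norm_mul, norm_zeta8, mul_one]
  refine hle.trans ?_
  have hsqrt : √(Real.pi / (Real.pi / 2)) ≤ 2 := by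
    refine Real.sqrt_le_iff.2 ⟨by norm_num, ?_⟩
    rw [div_le_iff₀ hb]; linarith
  have hexp : Real.exp (-‖η‖) ≤ 1 / ‖η‖ := by
    rw [Real.exp_neg, one_div]
    gcongr
    linarith [Real.add_one_le_exp ‖η‖]
  calc _ ≤ ‖kern s η‖ * Real.exp (-(Real.pi * (m * η.im))) * (1 / ‖η‖) * 2 := by gcongr
    _ = _ := by ring

theorem norm_rayTerm_sub_le_of_small {s η : ℂ} (h0 : 0 < η.im) (h1 : η.im < η.re)
    (hs : s = 2 * (Real.pi : ℂ) * I * η ^ 2)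
    (hS : 4 * (η.re * η.im) ≤ ‖η‖ ^ 2) {m : ℝ} (hm : 1 ≤ m) (hmr : 1000 * m ≤ ‖η‖)
    (hm3 : m ^ 3 ≤ ‖η‖) :
    ‖rayTerm s m - kern s η * (zeta8 / √2) *
      (exp (-(Real.pi * I * m ^ 2 / 8)) * exp ((Real.pi : ℂ) * I * (m * η)))‖ ≤
    ‖kern s η‖ * Real.exp (-(Real.pi * (m * η.im))) * (20000 * m ^ 3 / ‖η‖) := by
  have hr : 0 < ‖η‖ := by linarith
  have e1 := norm_lineTerm_sub_rayTerm_le h0 h1 hs hS hm hmr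
  have e2 := norm_lineTerm_sub_le h0 h1 hS hm hmr hm3
  rw [← hs] at e2
  rw [norm_sub_rev] at e1
  have e3 : 1 ≤ m ^ 3 := one_le_pow₀ hm
  calc _ ≤ _ := norm_sub_le_norm_sub_add_norm_sub _ (lineTerm s m) _
    _ ≤ _ := add_le_add e1 e2
    _ ≤ _ := by
      rw [← mul_add, ← add_div]
      gcongr
      linarith

/-! ### Summing the saddle contributions -/

/-- The phase `e ^ (-π i (2 k + 1) ^ 2 / 8)` of the `k`-th saddle point term. -/
noncomputable def saddlePhase (k : ℕ) : ℂ := exp (-(Real.pi * I * (2 * k + 1) ^ 2 / 8))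

theorem norm_saddlePhase (k : ℕ) : ‖saddlePhase k‖ = 1 := by
  rw [saddlePhase, show -(Real.pi * I * (2 * k + 1) ^ 2 / 8 : ℂ) =
    ((-(Real.pi * (2 * k + 1) ^ 2 / 8) : ℝ) : ℂ) * I by push_cast; ring, norm_exp_ofReal_mul_I]

/-- `(2k + 5)² - (2k + 1)² = 8 (2k + 3)`, an odd multiple of `8`. -/
theorem saddlePhase_add_two (k : ℕ) : saddlePhase (k + 2) = -saddlePhase k := by
  rw [saddlePhase, saddlePhase, show -(Real.pi * I * (2 * (k + 2 : ℕ) + 1) ^ 2 / 8 : ℂ) =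
    -(Real.pi * I * (2 * k + 1) ^ 2 / 8) - Real.pi * I + ((-(k + 1) : ℤ) : ℂ) * (2 * Real.pi * I) by
    push_cast; ring, exp_periodic.int_mul (-(k + 1)), exp_sub, exp_pi_mul_I, div_neg, div_one]

theorem saddlePhase_one : saddlePhase 1 = -saddlePhase 0 := by
  rw [saddlePhase, saddlePhase, show -(Real.pi * I * (2 * (1 : ℕ) + 1) ^ 2 / 8 : ℂ) =
    -(Real.pi * I * (2 * (0 : ℕ) + 1) ^ 2 / 8) - Real.pi * I by
    push_cast; ring, exp_sub, exp_pi_mul_I, div_neg, div_one]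

/-- The antiperiodicity makes the sum telescope, so the phases cannot make it smaller than about
`|q| (1 - |q|²) / 2`. -/
theorem one_add_pow_mul_sum_saddlePhase (q : ℂ) (K : ℕ) :
    (1 + q ^ 4) * ∑ k ∈ Finset.range K, saddlePhase k * q ^ (2 * k + 1) =
      saddlePhase 0 * (q - q ^ 3) - saddlePhase K * q ^ (2 * K + 1) -
        saddlePhase (K + 1) * q ^ (2 * K + 3) := by
  induction K with
  | zero => rw [Finset.sum_range_zero, saddlePhase_one]; ring
  | succ n ih =>
    rw [Finset.sum_range_succ, mul_add, ih, saddlePhase_add_two]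
    ring

theorem le_norm_sum_saddlePhase {q : ℂ} (hq : ‖q‖ ≤ 1) (K : ℕ) :
    (‖q‖ * (1 - ‖q‖ ^ 2) - 2 * ‖q‖ ^ (2 * K + 1)) / 2 ≤
      ‖∑ k ∈ Finset.range K, saddlePhase k * q ^ (2 * k + 1)‖ := by
  have h := congrArg norm (one_add_pow_mul_sum_saddlePhase q K)
  rw [norm_mul] at h
  have h1 : ‖1 + q ^ 4‖ ≤ 2 := by
    refine (norm_add_le _ _).trans ?_
    rw [norm_one, norm_pow]
    have := pow_le_one₀ (n := 4) (norm_nonneg q) hq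
    linarith
  have h2 : ‖q‖ * (1 - ‖q‖ ^ 2) ≤ ‖saddlePhase 0 * (q - q ^ 3)‖ := by
    rw [norm_mul, norm_saddlePhase, one_mul]
    have := norm_sub_norm_le q (q ^ 3)
    rw [norm_pow] at this
    linarith
  have h3 : ‖saddlePhase K * q ^ (2 * K + 1)‖ = ‖q‖ ^ (2 * K + 1) := by
    rw [norm_mul, norm_saddlePhase, one_mul, norm_pow]
  have h4 : ‖saddlePhase (K + 1) * q ^ (2 * K + 3)‖ ≤ ‖q‖ ^ (2 * K + 1) := by
    rw [norm_mul, norm_saddlePhase, one_mul, norm_pow]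
    exact pow_le_pow_of_le_one (norm_nonneg _) hq (by omega)
  have h5 := norm_sub_norm_le (saddlePhase 0 * (q - q ^ 3) - saddlePhase K * q ^ (2 * K + 1))
    (saddlePhase (K + 1) * q ^ (2 * K + 3))
  have h6 := norm_sub_norm_le (saddlePhase 0 * (q - q ^ 3)) (saddlePhase K * q ^ (2 * K + 1))
  have h7 := mul_le_mul_of_nonneg_right h1
    (norm_nonneg (∑ k ∈ Finset.range K, saddlePhase k * q ^ (2 * k + 1)))
  linarith

/-- `(2k + 1)³ ≤ 8 (k + 1)(k + 2)(k + 3) = 48 C(k + 3, 3)`, followed by the negative binomial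
series. -/
theorem sum_cube_mul_pow_le {x : ℝ} (h0 : 0 ≤ x) (h1 : x < 1) (K : ℕ) :
    ∑ k ∈ Finset.range K, (2 * k + 1 : ℝ) ^ 3 * x ^ k ≤ 48 / (1 - x) ^ 4 := by
  have hs := hasSum_choose_mul_geometric_of_norm_lt_one 3 (r := x)
    (by rwa [Real.norm_of_nonneg h0])
  have hle := hs.summable.sum_le_tsum (Finset.range K) fun k _ => by positivity
  rw [hs.tsum_eq] at hle
  calc _ ≤ ∑ k ∈ Finset.range K, 48 * (((k + 3).choose 3 : ℕ) * x ^ k : ℝ) := by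
        refine Finset.sum_le_sum fun k _ => ?_
        rw [← mul_assoc]
        gcongr
        have h3 : (((k + 3).choose 3 : ℕ) : ℝ) = (k + 3) * (k + 2) * (k + 1) / 6 := by
          have := Nat.choose_mul_factorial_mul_factorial (show 3 ≤ k + 3 by omega)
          have hd : (k + 3).descFactorial 3 = Nat.factorial 3 * (k + 3).choose 3 :=
            Nat.descFactorial_eq_factorial_mul_choose _ _
          have hd' : (k + 3).descFactorial 3 = (k + 3) * (k + 2) * (k + 1) := by
            simp [Nat.descFactorial_succ]; ring
          rw [hd'] at hd
          have := congrArg (Nat.cast (R := ℝ)) hd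
          push_cast [Nat.factorial] at this
          linarith
        rw [h3]
        have hk : (0 : ℝ) ≤ k := Nat.cast_nonneg k
        nlinarith [mul_nonneg hk hk, mul_nonneg (mul_nonneg hk hk) hk]
    _ = 48 * ∑ k ∈ Finset.range K, (((k + 3).choose 3 : ℕ) * x ^ k : ℝ) := by rw [Finset.mul_sum]
    _ ≤ 48 * (1 / (1 - x) ^ 4) := by gcongr
    _ = _ := by ring

theorem half_le_norm_zeta8_div_sqrt_two : 1 / 2 ≤ ‖zeta8 / √2‖ := by
  rw [norm_div, norm_zeta8, norm_real, Real.norm_of_nonneg (Real.sqrt_nonneg 2)]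
  have hsq2 : √2 ≤ 1.5 := Real.sqrt_le_iff.2 ⟨by norm_num, by norm_num⟩
  gcongr
  linarith

/-! ### Nonvanishing in the two ranges of `arg η` -/

/-- Here `arg η ≥ π/12`, so `η.im ≥ ‖η‖ / 4` and `K = 1` suffices: relative errors `1/10`, `1/10`
and `1/8` against a main term of at least `1/2`. The ordinate need not be large compared with `‖η‖`,
so its lower bound `6` (with `e⁶ ≥ 320`) is assumed separately. -/
theorem riemannAux_ne_zero_of_large_im {η : ℂ} (h0 : 0 < η.im) (h1 : η.im < η.re)
    (hS : ‖η‖ ^ 2 ≤ 4 * (η.re * η.im)) (hr : 1000000 ≤ ‖η‖)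
    (ht : 6 ≤ (2 * (Real.pi : ℂ) * I * η ^ 2).im) :
    riemannAux (2 * (Real.pi : ℂ) * I * η ^ 2) ≠ 0 := by
  have hη : η ≠ 0 := by rintro rfl; simp at h0
  have hre : 0 < η.re := h0.trans h1
  have hpi := Real.pi_gt_three
  have hren : η.re ≤ ‖η‖ := (le_abs_self _).trans (abs_re_le_norm η)
  have hr0 : 0 < ‖η‖ := by linarith
  have hy : ‖η‖ / 4 ≤ η.im := by
    have : η.re * η.im ≤ ‖η‖ * η.im := by gcongr
    nlinarith
  have hpy : 1 ≤ η.re * η.im := by nlinarith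
  set s := 2 * (Real.pi : ℂ) * I * η ^ 2 with hs
  have hsre : s.re < -1 := by rw [hs, two_pi_I_mul_sq_re]; nlinarith
  have eR := riemannAux_eq_sum (s := s) (by linarith) hsre 1
  rw [Finset.sum_range_one, Nat.cast_zero, mul_zero, zero_add] at eR
  have eI := norm_rayTerm_sub_le h0 h1 hS
  have eT := norm_rayTail_le h0 h1 hs hpy (K := 1) (by push_cast; linarith)
  have eL := norm_lowerPart_le h0 h1 hs hpy
  rw [← hs] at eI
  set N := ‖kern s η‖ with hN
  have hNpos : 0 < N := norm_pos_iff.2 (kern_ne_zero hη)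
  set Q := Real.exp (-(Real.pi * η.im)) with hQ
  have hQpos : 0 < Q := Real.exp_pos _
  have hmain : 1 / 2 * (N * Q) ≤ ‖kern s η * (zeta8 / √2) *
      (exp (-(Real.pi * I / 8)) * exp ((Real.pi : ℂ) * I * η))‖ := by
    rw [norm_mul, norm_mul, norm_mul, norm_exp_pi_I_mul,
      show -(Real.pi * I / 8 : ℂ) = ((-(Real.pi / 8) : ℝ) : ℂ) * I by push_cast; ring,
      norm_exp_ofReal_mul_I, one_mul, ← hN, ← hQ]
    have := mul_le_mul_of_nonneg_right half_le_norm_zeta8_div_sqrt_two (mul_pos hNpos hQpos).le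
    linarith
  have hT : ‖rayTail s 1‖ ≤ N * Q * (1 / 10) := by
    refine eT.trans ?_
    have e1 : ‖η‖ / η.im ≤ 4 := by rw [div_le_iff₀ h0]; linarith
    have e2 : Real.exp (-(3 / 2 * Real.pi * (1 : ℕ) * η.im)) ≤ Q * (1 / 40) := by
      rw [show -(3 / 2 * Real.pi * (1 : ℕ) * η.im) = -(Real.pi * η.im) + -(Real.pi * η.im / 2) by
        push_cast; ring, Real.exp_add]
      gcongr
      rw [Real.exp_neg, one_div]
      gcongr
      have := Real.add_one_le_exp (Real.pi * η.im / 2)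
      nlinarith
    calc _ ≤ N * 4 * (Q * (1 / 40)) := by gcongr
      _ = _ := by ring
  have hL : ‖lowerPart s‖ ≤ N * Q * (1 / 8) := by
    refine eL.trans ?_
    have : Real.exp (-s.im) ≤ 1 / 320 := by
      rw [Real.exp_neg, one_div]
      gcongr
      have h2 : (2.7 : ℝ) ^ 6 ≤ Real.exp 1 ^ 6 := by
        gcongr; linarith [Real.exp_one_gt_d9]
      have h3 : Real.exp 1 ^ 6 = Real.exp 6 := by rw [← Real.exp_nat_mul]; norm_num
      have h4 : Real.exp 6 ≤ Real.exp s.im := Real.exp_le_exp.2 ht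
      rw [h3] at h2
      norm_num at h2
      linarith
    calc _ ≤ 40 * N * Q * (1 / 320) := by gcongr
      _ = _ := by ring
  have hI : N * Q * (60 * Real.exp 5 / ‖η‖) ≤ N * Q * (1 / 10) := by
    refine mul_le_mul_of_nonneg_left ?_ (mul_pos hNpos hQpos).le
    rw [div_le_iff₀ hr0]
    have h3 : Real.exp 1 ^ 5 = Real.exp 5 := by rw [← Real.exp_nat_mul]; norm_num
    have h4 : Real.exp 1 ^ 5 ≤ (2.8 : ℝ) ^ 5 := by
      gcongr; linarith [Real.exp_one_lt_d9]
    rw [h3] at h4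
    norm_num at h4
    linarith
  intro hzero
  rw [hzero] at eR
  have hfin : kern s η * (zeta8 / √2) * (exp (-(Real.pi * I / 8)) * exp ((Real.pi : ℂ) * I * η)) =
      rayTail s 1 + lowerPart s - (rayTerm s 1 - kern s η * (zeta8 / √2) *
        (exp (-(Real.pi * I / 8)) * exp ((Real.pi : ℂ) * I * η))) := by
    linear_combination -eR
  rw [hfin] at hmain
  have e1 := norm_sub_le (rayTail s 1 + lowerPart s) (rayTerm s 1 - kern s η * (zeta8 / √2) *
        (exp (-(Real.pi * I / 8)) * exp ((Real.pi : ℂ) * I * η)))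
  have e2 := norm_add_le (rayTail s 1) (lowerPart s)
  have := mul_pos hNpos hQpos
  linarith

theorem le_one_sub_exp_sq {x y : ℝ} (hx0 : 0 ≤ x) (hx : x ≤ 1 / 2) (hxy : x ≤ y) :
    x ≤ 1 - Real.exp (-(Real.pi * y)) ^ 2 := by
  have hpi := Real.pi_gt_three
  have e2 : Real.exp (-(Real.pi * y)) ^ 2 = Real.exp (-(2 * (Real.pi * y))) := by
    rw [← Real.exp_nat_mul]; push_cast; ring_nf
  have e3 : x ≤ Real.pi * y := by nlinarith
  have e4 : Real.exp (-(Real.pi * y)) ^ 2 ≤ Real.exp (-(2 * x)) := by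
    rw [e2]; exact Real.exp_le_exp.2 (by linarith)
  have e5 : Real.exp (-(2 * x)) ≤ 1 / (1 + 2 * x) := by
    rw [Real.exp_neg, one_div]
    gcongr
    linarith [Real.add_one_le_exp (2 * x)]
  have e6 : 1 / (1 + 2 * x) ≤ 1 - x := by
    rw [div_le_iff₀ (by positivity)]
    nlinarith
  linarith

set_option maxHeartbeats 1000000 in
theorem riemannAux_ne_zero_of_small_im {η : ℂ} {ρ : ℝ} (h0 : 0 < η.im) (h1 : η.im < η.re)
    (hS : 4 * (η.re * η.im) ≤ ‖η‖ ^ 2) (hρ : 100 ≤ ρ) (hr : ‖η‖ = ρ ^ 5)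
    (hlog : 40 ≤ Real.log ‖η‖) (hlogρ : 2 * Real.log ‖η‖ ≤ ρ) (hy : Real.log ‖η‖ ≤ ρ * η.im) :
    riemannAux (2 * (Real.pi : ℂ) * I * η ^ 2) ≠ 0 := by
  have hη : η ≠ 0 := by rintro rfl; simp at h0
  have hre : 0 < η.re := h0.trans h1
  have hpi := Real.pi_gt_three
  have hρ0 : 0 < ρ := by linarith
  have hr0 : 0 < ‖η‖ := norm_pos_iff.2 hη
  have h34 := three_fourths_norm_sq_le h0 h1 hS
  set r := ‖η‖ with hrdef
  set L := Real.log r with hL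
  have hρ4 : (100 : ℝ) ^ 4 ≤ ρ ^ 4 := by gcongr
  have hrρ : 100000000 * ρ ≤ r := by
    rw [hr, pow_succ]; gcongr; linarith
  have hrp : r / 2 ≤ η.re := by
    refine le_of_sq_le_sq ?_ hre.le
    nlinarith [sq_nonneg η.im]
  have hyρ : 40 / ρ ≤ η.im := by rw [div_le_iff₀ hρ0]; linarith
  have hpy : 1 ≤ η.re * η.im := by
    calc (1 : ℝ) ≤ r / 2 * (40 / ρ) := by
          rw [div_mul_div_comm, one_le_div₀ (by positivity)]; linarith
      _ ≤ _ := by gcongr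
  set s := 2 * (Real.pi : ℂ) * I * η ^ 2 with hs
  have hsre : s.re < -1 := by rw [hs, two_pi_I_mul_sq_re]; nlinarith
  have hsim : r ≤ s.im := by
    rw [hs, two_pi_I_mul_sq_im]
    nlinarith
  -- `K η.im ≥ 2 log r` makes the tail and the boundary terms smaller than a power of `1/r`, while
  -- `K ≤ 3ρ` keeps `(2k + 1)³ ≤ r`.
  obtain ⟨K, hK⟩ : ∃ K, K = ⌈2 * L / η.im⌉₊ := ⟨_, rfl⟩
  have hK1 : 2 * L ≤ K * η.im := by
    rw [← div_le_iff₀ h0, hK]; exact Nat.le_ceil _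
  have hK2 : (K : ℝ) ≤ 3 * ρ := by
    have e1 := Nat.ceil_lt_add_one (show 0 ≤ 2 * L / η.im by positivity)
    rw [← hK] at e1
    have e2 : 2 * L / η.im ≤ 2 * ρ := by rw [div_le_iff₀ h0]; linarith
    linarith
  have hK0 : (1 : ℝ) ≤ K := by
    have : 0 < K := by
      rw [hK, Nat.ceil_pos]; positivity
    exact_mod_cast this
  have eR := riemannAux_eq_sum (s := s) (by linarith) hsre K
  have eT := norm_rayTail_le h0 h1 hs hpy (K := K) (by linarith)
  have eL := norm_lowerPart_le h0 h1 hs hpy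
  set N := ‖kern s η‖ with hN
  have hNpos : 0 < N := norm_pos_iff.2 (kern_ne_zero hη)
  obtain ⟨q, hq⟩ : ∃ q, q = exp ((Real.pi : ℂ) * I * η) := ⟨_, rfl⟩
  obtain ⟨Q, hQ⟩ : ∃ Q, Q = ‖q‖ := ⟨_, rfl⟩
  have hQe : Q = Real.exp (-(Real.pi * η.im)) := by rw [hQ, hq, norm_exp_pi_I_mul]
  have hQpos : 0 < Q := by rw [hQe]; exact Real.exp_pos _
  have hQ1 : Q < 1 := by rw [hQe, Real.exp_lt_one_iff]; nlinarith
  obtain ⟨D, hD⟩ : ∃ D, D = 1 - Q ^ 2 := ⟨_, rfl⟩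
  have hDL : L / ρ ≤ D := by
    rw [hD, hQe]
    refine le_one_sub_exp_sq (by positivity) ?_ ?_
    · rw [div_le_iff₀ hρ0]; linarith
    · rw [div_le_iff₀ hρ0]; linarith
  have hD0 : 0 < D := lt_of_lt_of_le (by positivity) hDL
  have hDρ : 1 / ρ ≤ D := le_trans (by gcongr; linarith) hDL
  have hNQ : 0 < N * Q := mul_pos hNpos hQpos
  set c := zeta8 / (√2 : ℂ) with hc
  have hexpm : ∀ k : ℕ, Real.exp (-(Real.pi * ((2 * k + 1 : ℝ) * η.im))) = Q * (Q ^ 2) ^ k := by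
    intro k
    rw [hQe, ← pow_mul, ← pow_succ', ← Real.exp_nat_mul]
    congr 1; push_cast; ring
  -- the saddle point terms
  have hsum : ‖(∑ k ∈ Finset.range K, rayTerm s (2 * k + 1)) -
      kern s η * c * ∑ k ∈ Finset.range K, saddlePhase k * q ^ (2 * k + 1)‖ ≤
      N * Q * (960000 / (r * D ^ 4)) := by
    rw [Finset.mul_sum, ← Finset.sum_sub_distrib]
    refine (norm_sum_le _ _).trans ?_
    calc _ ≤ ∑ k ∈ Finset.range K, N * Q * (20000 / r) * ((2 * k + 1 : ℝ) ^ 3 * (Q ^ 2) ^ k) := by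
          refine Finset.sum_le_sum fun k hk => ?_
          have hkK : (k : ℝ) + 1 ≤ K := by
            have := Finset.mem_range.1 hk
            exact_mod_cast this
          have hk0 : (0 : ℝ) ≤ k := Nat.cast_nonneg k
          have hm6 : (2 * k + 1 : ℝ) ≤ 6 * ρ := by linarith
          have := norm_rayTerm_sub_le_of_small h0 h1 hs hS (m := 2 * k + 1) (by linarith)
            (by rw [← hrdef]; linarith) (by
              rw [← hrdef]
              calc (2 * k + 1 : ℝ) ^ 3 ≤ (6 * ρ) ^ 3 := by gcongr
                _ = 216 * ρ ^ 3 := by ring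
                _ ≤ ρ ^ 2 * ρ ^ 3 := by gcongr; nlinarith
                _ = r := by rw [hr]; ring)
          rw [← hN, ← hrdef, hexpm] at this
          have e1 : saddlePhase k * q ^ (2 * k + 1) =
              exp (-(Real.pi * I * ((2 * k + 1 : ℝ) : ℂ) ^ 2 / 8)) *
              exp ((Real.pi : ℂ) * I * (((2 * k + 1 : ℝ) : ℂ) * η)) := by
            rw [saddlePhase, hq, ← exp_nat_mul]
            push_cast
            ring_nf
          rw [e1]
          refine this.trans_eq ?_
          ring
      _ ≤ N * Q * (20000 / r) * (48 / (1 - Q ^ 2) ^ 4) := by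
          rw [← Finset.mul_sum]
          gcongr
          exact sum_cube_mul_pow_le (by positivity) (by nlinarith) K
      _ = _ := by rw [← hD]; field_simp; norm_num
  -- This is where the exponent `2/5` is decided: `r D⁵` must exceed an absolute constant. From `D ≥
  -- L / ρ` and `r = ρ⁵` it is at least `L⁵ ≥ 40⁵ > 9600000`.
  have hE1 : 960000 / (r * D ^ 4) ≤ D / 10 := by
    rw [div_le_iff₀ (by positivity)]
    have e1 : (40 : ℝ) ^ 5 ≤ L ^ 5 := by gcongr
    have e2 : (L / ρ) ^ 5 ≤ D ^ 5 := by gcongr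
    have e3 : L ^ 5 ≤ r * D ^ 5 := by
      rw [hr]
      calc L ^ 5 = ρ ^ 5 * (L / ρ) ^ 5 := by field_simp
        _ ≤ _ := by gcongr
    nlinarith
  -- the tail
  have hrL : ∀ n : ℕ, Real.exp (-(n * L)) = (r ^ n)⁻¹ := by
    intro n
    rw [Real.exp_neg, Real.exp_nat_mul, hL, Real.exp_log hr0]
  have hT : ‖rayTail s K‖ ≤ N * Q * (D / 100) := by
    refine eT.trans ?_
    have e1 : r / η.im ≤ r * ρ := by
      rw [div_le_iff₀ h0, mul_assoc]
      exact le_mul_of_one_le_right hr0.le (by linarith)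
    -- Of the exponent `3πK η.im / 2`, the part `πK η.im` covers `Q` because `K ≥ 1`, and the
    -- remaining half of that amount is at least `3 log r`.
    have e2 : Real.exp (-(3 / 2 * Real.pi * K * η.im)) ≤ Q * (r ^ 3)⁻¹ := by
      rw [← hrL 3, hQe, ← Real.exp_add]
      apply Real.exp_le_exp.2
      have e3 : Real.pi * η.im ≤ Real.pi * (K * η.im) := by
        gcongr; exact le_mul_of_one_le_left h0.le hK0
      have e4 : 3 * (2 * L) ≤ Real.pi * (K * η.im) := by gcongr
      push_cast
      linarith
    calc _ ≤ N * (r * ρ) * (Q * (r ^ 3)⁻¹) := by gcongr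
      _ = N * Q * (ρ / r ^ 2) := by field_simp
      _ ≤ N * Q * (1 / ρ / 100) := by
          refine mul_le_mul_of_nonneg_left ?_ hNQ.le
          rw [div_div, div_le_div_iff₀ (by positivity) (by positivity)]
          nlinarith
      _ ≤ _ := by gcongr
  have hLow : ‖lowerPart s‖ ≤ N * Q * (D / 100) := by
    refine eL.trans ?_
    rw [← hQe]
    have e1 : Real.exp (-s.im) ≤ 1 / r := by
      rw [Real.exp_neg, one_div]
      gcongr
      linarith [Real.add_one_le_exp s.im]
    calc _ ≤ 40 * N * Q * (1 / r) := by gcongr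
      _ = N * Q * (40 / r) := by ring
      _ ≤ N * Q * (1 / ρ / 100) := by
          refine mul_le_mul_of_nonneg_left ?_ hNQ.le
          rw [div_div, div_le_div_iff₀ (by positivity) (by positivity)]
          linarith
      _ ≤ _ := by gcongr
  have hQK : Q ^ (2 * K + 1) ≤ Q * (D / 100) := by
    rw [pow_succ']
    gcongr
    have e1 : Q ^ (2 * K) = Real.exp (-(2 * K * (Real.pi * η.im))) := by
      rw [hQe, ← Real.exp_nat_mul]; push_cast; ring_nf
    have e2 : Real.exp (-(2 * K * (Real.pi * η.im))) ≤ (r ^ 1)⁻¹ := by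
      rw [← hrL 1]
      apply Real.exp_le_exp.2
      have e4 : 3 * (2 * L) ≤ Real.pi * (K * η.im) := by gcongr
      push_cast
      linarith
    rw [e1]
    refine e2.trans (le_trans ?_ (show 1 / ρ / 100 ≤ D / 100 by gcongr))
    rw [pow_one, div_div, ← one_div]
    gcongr
    linarith
  have hmain : N * Q * (D / 5) ≤ ‖kern s η * c * ∑ k ∈ Finset.range K,
      saddlePhase k * q ^ (2 * k + 1)‖ := by
    rw [norm_mul, norm_mul]
    have e1 := le_norm_sum_saddlePhase (q := q) (by rw [← hQ]; exact hQ1.le) K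
    rw [← hQ, ← hD] at e1
    have e2 : Q * (D * 0.49) ≤ ‖∑ k ∈ Finset.range K, saddlePhase k * q ^ (2 * k + 1)‖ := by
      linarith
    calc N * Q * (D / 5) ≤ N * (1 / 2) * (Q * (D * 0.49)) := by
          have : 0 < N * Q * D := mul_pos hNQ hD0
          linarith
      _ ≤ _ := by
          gcongr
          exact half_le_norm_zeta8_div_sqrt_two
  -- Relative to `N Q D`, the errors `1/10 + 1/100 + 1/100` stay below the main term `1/5`.
  intro hzero
  rw [hzero] at eR
  have hfin : kern s η * c * ∑ k ∈ Finset.range K, saddlePhase k * q ^ (2 * k + 1) =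
      rayTail s K + lowerPart s - ((∑ k ∈ Finset.range K, rayTerm s (2 * k + 1)) -
        kern s η * c * ∑ k ∈ Finset.range K, saddlePhase k * q ^ (2 * k + 1)) := by
    linear_combination -eR
  rw [hfin] at hmain
  have e1 := norm_sub_le (rayTail s K + lowerPart s) ((∑ k ∈ Finset.range K, rayTerm s (2 * k + 1)) -
        kern s η * c * ∑ k ∈ Finset.range K, saddlePhase k * q ^ (2 * k + 1))
  have e2 := norm_add_le (rayTail s K) (lowerPart s)
  have e3 := hsum.trans (mul_le_mul_of_nonneg_left hE1 hNQ.le)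
  have : 0 < N * Q * D := mul_pos hNQ hD0
  linarith

/-! ### Translation to `σ`, `t` and choice of constants -/

theorem exists_eq_two_pi_I_mul_sq {s : ℂ} (hre : s.re < 0) (him : 0 < s.im) :
    ∃ η : ℂ, s = 2 * (Real.pi : ℂ) * I * η ^ 2 ∧ 0 < η.im ∧ η.im < η.re := by
  have hpi : (Real.pi : ℂ) ≠ 0 := ofReal_ne_zero.2 Real.pi_ne_zero
  obtain ⟨w, hw⟩ := IsAlgClosed.exists_pow_nat_eq (s / (2 * (Real.pi : ℂ) * I)) (n := 2) two_pos
  obtain ⟨η, hη, h0⟩ : ∃ η : ℂ, η ^ 2 = s / (2 * (Real.pi : ℂ) * I) ∧ 0 ≤ η.re := by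
    rcases le_total 0 w.re with h | h
    · exact ⟨w, hw, h⟩
    · exact ⟨-w, by rw [neg_sq, hw], by simpa using h⟩
  have hs : s = 2 * (Real.pi : ℂ) * I * η ^ 2 := by
    rw [hη, mul_div_cancel₀]
    simp [hpi]
  have h1 := hre
  have h2 := him
  rw [hs, two_pi_I_mul_sq_re] at h1
  rw [hs, two_pi_I_mul_sq_im] at h2
  have hp := Real.pi_pos
  have h3 : 0 < η.re * η.im := by
    by_contra h
    nlinarith
  have h4 : 0 < η.im := (pos_iff_pos_of_mul_pos h3).1 (h0.lt_of_ne (by rintro h; simp [← h] at h3))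
  have h5 : 0 < η.re ^ 2 - η.im ^ 2 := (pos_iff_pos_of_mul_pos h2).1 (by positivity)
  refine ⟨η, hs, h4, ?_⟩
  exact lt_of_pow_lt_pow_left₀ 2 h0 (by linarith)

theorem exists_log_le_rpow :
    ∃ r₀ : ℝ, 10 ^ 10 ≤ r₀ ∧ ∀ r, r₀ ≤ r →
      40 ≤ Real.log r ∧ 2 * Real.log r ≤ r ^ (1 / 5 : ℝ) := by
  have h1 := Real.tendsto_log_atTop.eventually_ge_atTop 40
  have h2 := (isLittleO_log_rpow_atTop (show (0 : ℝ) < 1 / 5 by norm_num)).bound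
    (show (0 : ℝ) < 1 / 2 by norm_num)
  obtain ⟨b, hb⟩ := Filter.eventually_atTop.1 (h1.and h2)
  refine ⟨max (10 ^ 10) b, le_max_left _ _, fun r hr => ?_⟩
  obtain ⟨h3, h4⟩ := hb r ((le_max_right _ _).trans hr)
  have hr0 : 0 ≤ r := le_trans (by positivity) ((le_max_left _ _).trans hr)
  refine ⟨h3, ?_⟩
  rw [Real.norm_of_nonneg (by linarith), Real.norm_of_nonneg (by positivity)] at h4
  linarith

theorem exists_mul_rpow_mul_log_lt {A a : ℝ} (hA : 0 < A) (ha : 0 < a) :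
    ∃ t₁ : ℝ, ∀ t : ℝ, t₁ ≤ t →
      A * t ^ (2 / 5 : ℝ) * Real.log t < a * t ^ (3 / 7 : ℝ) := by
  -- `1/35 = 3/7 - 2/5`.
  have h2 := (isLittleO_log_rpow_atTop (show (0 : ℝ) < 1 / 35 by norm_num)).bound
    (show (0 : ℝ) < a / (2 * A) by positivity)
  obtain ⟨b, hb⟩ := Filter.eventually_atTop.1 h2
  refine ⟨max 1 b, fun t ht => ?_⟩
  have ht1 : 1 ≤ t := (le_max_left _ _).trans ht
  have h3 := hb t ((le_max_right _ _).trans ht)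
  have ht0 : 0 < t := by linarith
  rw [Real.norm_of_nonneg (Real.log_nonneg ht1), Real.norm_of_nonneg (by positivity)] at h3
  have h4 : t ^ (3 / 7 : ℝ) = t ^ (2 / 5 : ℝ) * t ^ (1 / 35 : ℝ) := by
    rw [← Real.rpow_add ht0]; norm_num
  calc _ ≤ A * t ^ (2 / 5 : ℝ) * (a / (2 * A) * t ^ (1 / 35 : ℝ)) := by gcongr
    _ = a * t ^ (3 / 7 : ℝ) / 2 := by rw [h4]; field_simp
    _ < _ := half_lt_self (by positivity)

/-- With `ρ = r ^ (1/5)` and `t ≥ r²`, the hypothesis gives `14 ρ⁴ log r ≤ 1 + 4π r η.im`. Since `4π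
< 13` and `1 ≤ ρ⁴ log r`, division by `ρ⁴` yields the claim; this is where `A = 7` comes from. -/
theorem log_norm_le_mul_im {η : ℂ} (h0 : 0 < η.im) (h1 : η.im < η.re)
    (hS : 4 * (η.re * η.im) ≤ ‖η‖ ^ 2) (hr : 1 ≤ ‖η‖) (hlog : 1 ≤ Real.log ‖η‖)
    (h : 7 * (2 * (Real.pi : ℂ) * I * η ^ 2).im ^ (2 / 5 : ℝ) *
      Real.log (2 * (Real.pi : ℂ) * I * η ^ 2).im ≤
      1 - (2 * (Real.pi : ℂ) * I * η ^ 2).re) :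
    Real.log ‖η‖ ≤ ‖η‖ ^ (1 / 5 : ℝ) * η.im := by
  have hpi := Real.pi_gt_three
  have hpi2 := Real.pi_lt_d2
  have hren : η.re ≤ ‖η‖ := (le_abs_self _).trans (abs_re_le_norm η)
  have h34 := three_fourths_norm_sq_le h0 h1 hS
  rw [two_pi_I_mul_sq_re, two_pi_I_mul_sq_im] at h
  set r := ‖η‖ with hrdef
  have hr0 : 0 < r := by linarith
  set t := 2 * Real.pi * (η.re ^ 2 - η.im ^ 2) with ht
  have htr : r ^ 2 ≤ t := by nlinarith
  set ρ := r ^ (1 / 5 : ℝ) with hρ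
  have hρ1 : 1 ≤ ρ := Real.one_le_rpow hr (by norm_num)
  have hρ5 : ρ ^ 5 = r := by
    rw [hρ, ← Real.rpow_natCast, ← Real.rpow_mul hr0.le]; norm_num
  have e1 : ρ ^ 4 ≤ t ^ (2 / 5 : ℝ) := by
    calc ρ ^ 4 = (r ^ 2) ^ (2 / 5 : ℝ) := by
          rw [hρ, ← Real.rpow_natCast, ← Real.rpow_natCast, ← Real.rpow_mul hr0.le,
            ← Real.rpow_mul hr0.le]
          norm_num
      _ ≤ _ := by gcongr
  have e2 : 2 * Real.log r ≤ Real.log t := by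
    rw [show 2 * Real.log r = Real.log (r ^ 2) by rw [Real.log_pow]; norm_num]
    exact Real.log_le_log (by positivity) htr
  have e3 : 7 * ρ ^ 4 * (2 * Real.log r) ≤ 7 * t ^ (2 / 5 : ℝ) * Real.log t := by
    have : 0 ≤ t ^ (2 / 5 : ℝ) := le_trans (by positivity) e1
    gcongr
  have e4 : η.re * η.im ≤ r * η.im := by gcongr
  have e5 : Real.pi * (η.re * η.im) ≤ 3.15 * (r * η.im) := by
    have : 0 ≤ η.re * η.im := mul_nonneg (by linarith) h0.le
    gcongr
  have e6 : (1 : ℝ) ≤ ρ ^ 4 * Real.log r := one_le_mul_of_one_le_of_one_le (one_le_pow₀ hρ1) hlog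
  have e7 : ρ ^ 4 * Real.log r ≤ ρ ^ 4 * (ρ * η.im) := by
    have : ρ ^ 4 * (ρ * η.im) = r * η.im := by rw [← hρ5]; ring
    rw [this]
    linarith
  exact le_of_mul_le_mul_left e7 (by positivity)

theorem mainTheorem3 :
    ∃ t₀ A : ℝ, 0 < t₀ ∧ 0 < A ∧
      (∀ s : ℂ, t₀ ≤ s.im →
        A * s.im ^ (2 / 5 : ℝ) * Real.log s.im ≤ 1 - s.re → riemannAux s ≠ 0) ∧
      (∀ a : ℝ, 0 < a → ∃ t₁ : ℝ, ∀ t : ℝ, t₁ ≤ t →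
        A * t ^ (2 / 5 : ℝ) * Real.log t < a * t ^ (3 / 7 : ℝ)) := by
  obtain ⟨r₀, hr₀, hr₀'⟩ := exists_log_le_rpow
  -- As `t ≤ 2π r² ≤ 7 r²`, the condition `t ≥ 7 r₀²` forces `r ≥ r₀`.
  refine ⟨7 * r₀ ^ 2, 7, by positivity, by norm_num, fun s ht hσ => ?_,
    fun a ha => exists_mul_rpow_mul_log_lt (by norm_num) ha⟩
  have hbig : r₀ ≤ r₀ ^ 2 := by nlinarith
  have ht6 : 6 ≤ s.im := by linarith
  have him : 0 < s.im := by linarith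
  have hlog : 1 ≤ Real.log s.im := by
    rw [Real.le_log_iff_exp_le him]
    linarith [Real.exp_one_lt_d9]
  have hre : s.re < 0 := by
    have e1 : (1 : ℝ) ≤ s.im ^ (2 / 5 : ℝ) := Real.one_le_rpow (by linarith) (by norm_num)
    have e2 := one_le_mul_of_one_le_of_one_le e1 hlog
    linarith
  obtain ⟨η, rfl, h0, h1⟩ := exists_eq_two_pi_I_mul_sq hre him
  have hr : r₀ ≤ ‖η‖ := by
    refine le_of_sq_le_sq ?_ (norm_nonneg _)
    rw [two_pi_I_mul_sq_im] at ht
    rw [norm_sq_eq_re_sq_add_im_sq]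
    have := Real.pi_lt_d2
    have h3 : 0 ≤ η.re ^ 2 - η.im ^ 2 := by nlinarith
    have h4 : 2 * Real.pi * (η.re ^ 2 - η.im ^ 2) ≤ 7 * (η.re ^ 2 - η.im ^ 2) := by
      gcongr; linarith
    nlinarith [sq_nonneg η.im]
  -- The comparison is `sin (2 arg η)` against `1/2`.
  rcases le_total (‖η‖ ^ 2) (4 * (η.re * η.im)) with hS | hS
  · exact riemannAux_ne_zero_of_large_im h0 h1 hS (by linarith) ht6
  obtain ⟨hl, hl'⟩ := hr₀' _ hr
  have hn0 : 0 ≤ ‖η‖ := norm_nonneg η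
  refine riemannAux_ne_zero_of_small_im (ρ := ‖η‖ ^ (1 / 5 : ℝ)) h0 h1 hS ?_ ?_ hl hl'
    (log_norm_le_mul_im h0 h1 hS (by linarith) (by linarith) hσ)
  · calc (100 : ℝ) = (10 ^ 10 : ℝ) ^ (1 / 5 : ℝ) := by
          rw [← Real.rpow_natCast, ← Real.rpow_mul (by norm_num)]; norm_num
      _ ≤ _ := by gcongr; linarith
  · rw [← Real.rpow_natCast, ← Real.rpow_mul hn0]; norm_num
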